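/- **Utility configuration.** A (discrete) instance consists of $n\ge 1$ actions; each action $i$ has finitely many, and at least one, configurations; configuration $\ell$ of action $i$ is a finitely supported distribution $F_{i\ell}$ of pairs $(u_i^A,u_i^P)$ of agent and principal utilities, given as a list of point masses with positive rational probabilities, with $u_i^A\in\mathbb Q\cup\{-\infty\}$ and $u_i^P\in\mathbb Q_{\ge 0}$. A configuration $\mathbf C=(C_1,\dots,C_n)$ chooses one configuration of every action. Under $\mathbf C$, the pairs $(u_i^A,u_i^P)\sim F_{iC_i}$ are drawn independently and the agent picks the action that maximizes $u_i^A$, with ties broken in favor of the principal; $(u^A,u^P)$ denotes the utilities from this action. The principal wants to maximize $\mathbb E[u^P]$ over $\mathbf C$. The instance is *$2$-utility aligned* if for an optimal configuration $\mathbf C^*$ and every threshold $U$ with $\Pr[u^A\le U]>0$ under $\mathbf C^*$, $\mathbb E[u^P\mid u^A\le U]\le 2\,\mathbb E[u^P]$. An $\alpha$-approximation returns a configuration with expected principal utility at least $\alpha$ times the optimal one. **The algorithm $\mathrm{ALG}_M$** (fineness parameter $M$). 1. *Preprocessing.* Replace $-\infty$ by a finite number below all finite agent utilities. Go through all point masses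 $(u^A,u^P,p)$ of all configurations of all actions in non-decreasing order of $u^P$, and split each one into $\lfloor pM^2\rfloor$ masses of probability $1/M^2$ and one with the remaining probability; the successive pieces, counted by $r=0,1,2,\dots$ throughout the whole process, get agent utility $u^A+\delta r$ and principal utility $u^P$, where $\delta>0$ is so small that no strict preference of the agent changes. 2. *Guesses.* For all $\hat u_1\le\dots\le\hat u_M$ from the union of the supports of all agent utilities after preprocessing, let $\hat u_0=-\infty$, $B_j=[\hat u_{j-1},\hat u_j)$ for $j<M$, $B_M=[\hat u_{M-1},\hat u_M]$, $B_{\le j}=\bigcup_{k\le j}B_k$. For $u_i\sim F_{i\ell}$ (after preprocessing) let $q_{ij}(\ell)=\Pr[u_i^A\in B_j\mid u_i^A\in B_{\le j}]$, let $\bar q_{ij}(\ell)$ be $q_{ij}(\ell)$ rounded down to a multiple of $1/(M^2n)$, and let $\psi_i(\ell)=\sum_{j=6}^M\frac{j-5}{M-1}\,\mathbb E[u_i^P\mid u_i^A\in B_j]\,q_{ij}(\ell)$ (conditional quantities given null events are read as $0$). By dynamic programming over the actions and the vectors of multiples of $1/(M^2n)$, maximize $\sum_i\psi_i(C_i)$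 over all $\mathbf C$ with $$\sum_{i=1}^n\bar q_{ij}(C_i)\in\Big[\tfrac{1-1/M}{j}-\tfrac1{M^2},\ \tfrac{1+1/M}{j-1}\Big]\qquad(1\le j\le M),$$ where the upper bound for $j=1$ is $+\infty$. 3. *Output.* Among the configurations found, return one with the largest true expected principal utility (an arbitrary fixed configuration if no guess is feasible). **Corollary.** (a) There is an absolute constant $c>0$ such that for every integer $M\ge2$, $\mathrm{ALG}_M$ is a $\big(1-c\,\frac{\log M}{M}\big)$-approximation on all $2$-utility aligned instances. (b) For every fixed $M\ge1$, the running time of $\mathrm{ALG}_M$ on all instances, aligned or not, counting bit operations for rational arithmetic, is at most a polynomial (depending on $M$) in the input size, i.e. in the total number of actions, configurations and point masses plus the total bit length of all utilities and probabilities. (c) Consequently there is a PTAS for $2$-utility aligned instances: for every $\varepsilon>0$ there is an $M=M(\varepsilon)$ such that $\mathrm{ALG}_M$ is a polynomial-time $(1-\varepsilon)$-approximation on these instances. -/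

import Mathlib

namespace UtilityConfiguration

/-! ### Instances, configurations and expected utilities -/

/-- A point mass of a joint distribution of (agent utility, principal utility): it carries the pair
`(agent, principal)` with probability `prob`. -/
structure MassPoint (U : Type) where
  agent : U
  principal : ℚ
  prob : ℚ

/-- A discrete joint distribution of (agent utility, principal utility), as a list of point masses.
Agent utilities range over the rationals together with `⊥`, which stands for `-∞`. -/
abbrev Dist := List (MassPoint (WithBot ℚ))

/-- A discrete instance: the list of actions; an action is the list of its configurations; a
configuration of an action is the distribution that it induces. -/
abbrev Instance := List (List Dist)

/-- A discrete probability distribution with positive masses and nonnegative principal utilities. -/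
def Dist.Valid (D : Dist) : Prop :=
  (∀ x ∈ D, 0 < x.prob ∧ 0 ≤ x.principal) ∧ (D.map MassPoint.prob).sum = 1

/-- There is at least one action, every action has at least one configuration, and every
configuration of every action induces a probability distribution. -/
def Instance.Valid (I : Instance) : Prop :=
  I ≠ [] ∧ ∀ A ∈ I, A ≠ [] ∧ ∀ D ∈ A, Dist.Valid D

/-- `C` picks (the index of) one configuration of every action. -/
def IsConfiguration (I : Instance) (C : List ℕ) : Prop :=
  List.Forall₂ (fun (A : List Dist) (c : ℕ) => c < A.length) I C

/-- The distributions, one for each action, that the configuration `C` picks. -/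
def chosen (I : Instance) (C : List ℕ) : List Dist :=
  List.zipWith (fun (A : List Dist) (c : ℕ) => A.getD c []) I C

/-- The joint outcomes under `C`: all lists with one point mass from the distribution of each
action. -/
def outcomes (I : Instance) (C : List ℕ) : List (List (MassPoint (WithBot ℚ))) :=
  (chosen I C).sections

/-- The probability of a joint outcome; the actions are independent. -/
def outcomeProb (ω : List (MassPoint (WithBot ℚ))) : ℚ := (ω.map MassPoint.prob).prod

/-- The agent's utility `u^A = max_i u_i^A` from their favorite action. -/
def agentUtility (ω : List (MassPoint (WithBot ℚ))) : WithBot ℚ :=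
  (ω.map MassPoint.agent).foldr max ⊥

/-- The principal's utility `u^P` from the agent's favorite action; among several favorite actions
the agent picks one that is best for the principal. (Principal utilities are nonnegative, so the
seed `0` of the maximum is harmless.) -/
def principalUtility (ω : List (MassPoint (WithBot ℚ))) : ℚ :=
  ((ω.filter fun x => decide (x.agent = agentUtility ω)).map MassPoint.principal).foldr max 0

/-- The expected principal utility `E[u^P]` under the configuration `C`. -/
def expectedUtility (I : Instance) (C : List ℕ) : ℚ :=
  ((outcomes I C).map fun ω => outcomeProb ω * principalUtility ω).sum

/-- `Pr[u^A ≤ U]` under the configuration `C`. -/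
def probAgentLE (I : Instance) (C : List ℕ) (U : WithBot ℚ) : ℚ :=
  (((outcomes I C).filter fun ω => decide (agentUtility ω ≤ U)).map outcomeProb).sum

/-- The conditional expectation `E[u^P | u^A ≤ U]` under the configuration `C`
(meaningful when `Pr[u^A ≤ U] > 0`). -/
def condUtilityLE (I : Instance) (C : List ℕ) (U : WithBot ℚ) : ℚ :=
  (((outcomes I C).filter fun ω => decide (agentUtility ω ≤ U)).map
    fun ω => outcomeProb ω * principalUtility ω).sum / probAgentLE I C U

/-- `C` maximizes the expected principal utility over all configurations. -/
def IsOptimal (I : Instance) (C : List ℕ) : Prop :=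
  IsConfiguration I C ∧ ∀ C', IsConfiguration I C' → expectedUtility I C' ≤ expectedUtility I C

/-- `f(q)`-utility alignment: in an optimal configuration, for every threshold `U` with
`q = Pr[u^A ≤ U] > 0`, we have `E[u^P | u^A ≤ U] ≤ f(q) E[u^P]`. -/
def IsUtilityAligned (f : ℚ → ℚ) (I : Instance) : Prop :=
  ∃ C, IsOptimal I C ∧ ∀ U : WithBot ℚ, 0 < probAgentLE I C U →
    condUtilityLE I C U ≤ f (probAgentLE I C U) * expectedUtility I C

/-! ### Bit lengths and input size -/

/-- Bit length of a rational number, written as a reduced fraction. -/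
def bits (q : ℚ) : ℕ := Nat.size q.num.natAbs + Nat.size q.den + 1

/-- Bit length of an agent utility. -/
def agentBits : WithBot ℚ → ℕ
  | ⊥ => 1
  | (q : ℚ) => bits q

/-- The input size: the number of actions, configurations and point masses plus the total bit length
of all utilities and probabilities. -/
def Instance.size (I : Instance) : ℕ :=
  (I.map fun A => 1 + (A.map fun D => 1 + (D.map fun x =>
    1 + agentBits x.agent + bits x.principal + bits x.prob).sum).sum).sum

/-! ### Step-counted computations

A computation is a result together with the number of steps spent on it. Sequencing adds steps.
Every pass through a list costs one step per element (plus the steps of what is done there), and every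
arithmetic operation or comparison is charged quadratically in the bit lengths of its operands, as for
schoolbook arithmetic on fractions reduced by Euclid's algorithm. -/

structure Timed (α : Type) where
  val : α
  time : ℕ

instance : Monad Timed where
  pure a := ⟨a, 0⟩
  bind x f := ⟨(f x.val).val, x.time + (f x.val).time⟩

/-- Spend `c` steps. -/
def tick (c : ℕ) : Timed Unit := ⟨(), c⟩

/-- A binary operation on rationals with result `r`. -/
def ratOp {α : Type} (a b : ℚ) (r : α) : Timed α := ⟨r, (bits a + bits b) ^ 2⟩

def addT (a b : ℚ) : Timed ℚ := ratOp a b (a + b)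
def subT (a b : ℚ) : Timed ℚ := ratOp a b (a - b)
def mulT (a b : ℚ) : Timed ℚ := ratOp a b (a * b)
/-- Division, with `a / 0 = 0`. -/
def divT (a b : ℚ) : Timed ℚ := ratOp a b (a / b)
def leT (a b : ℚ) : Timed Bool := ratOp a b (decide (a ≤ b))
def ltT (a b : ℚ) : Timed Bool := ratOp a b (decide (a < b))
/-- `⌊a⌋`, for `a ≥ 0`. -/
def floorT (a : ℚ) : Timed ℕ := ratOp a a ⌊a⌋₊

/-- A binary operation on natural numbers with result `r`. -/
def natOp {α : Type} (a b : ℕ) (r : α) : Timed α := ⟨r, (Nat.size a + Nat.size b + 1) ^ 2⟩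

def natAddT (a b : ℕ) : Timed ℕ := natOp a b (a + b)
def natMulT (a b : ℕ) : Timed ℕ := natOp a b (a * b)
def natEqT (a b : ℕ) : Timed Bool := natOp a b (decide (a = b))

section Lists

variable {α β : Type}

def lengthT (l : List α) : Timed ℕ := ⟨l.length, l.length + 1⟩

/-- Random access into a list, by walking to position `i`. -/
def getT (l : List α) (i : ℕ) (d : α) : Timed α := ⟨l.getD i d, i + 1⟩

/-- `[0, 1, …, k - 1]`. -/
def rangeT (k : ℕ) : Timed (List ℕ) := ⟨List.range k, k + 1⟩

/-- Pair every element with its position. -/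
def enumerateT (l : List α) : Timed (List (α × ℕ)) := ⟨l.zipIdx, l.length + 1⟩

def appendT (l₁ l₂ : List α) : Timed (List α) := ⟨l₁ ++ l₂, l₁.length + 1⟩

def mapT (f : α → Timed β) : List α → Timed (List β)
  | [] => do
    tick 1
    return []
  | a :: l => do
    tick 1
    let b ← f a
    let bs ← mapT f l
    return b :: bs

def filterT (p : α → Timed Bool) : List α → Timed (List α)
  | [] => do
    tick 1
    return []
  | a :: l => do
    tick 1
    let b ← p a
    let r ← filterT p l
    return if b then a :: r else r

def flatMapT (f : α → Timed (List β)) : List α → Timed (List β)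
  | [] => do
    tick 1
    return []
  | a :: l => do
    tick 1
    let b ← f a
    let bs ← flatMapT f l
    appendT b bs

def foldT (f : β → α → Timed β) : β → List α → Timed β
  | b, [] => do
    tick 1
    return b
  | b, a :: l => do
    tick 1
    let b' ← f b a
    foldT f b' l

def allT (p : α → Timed Bool) : List α → Timed Bool
  | [] => do
    tick 1
    return true
  | a :: l => do
    tick 1
    let b ← p a
    if b then allT p l else return false

/-- All lists of length `k` with entries from `S`. -/
def tuplesT (S : List α) : ℕ → Timed (List (List α))
  | 0 => do
    tick 1
    return [[]]
  | k + 1 => do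
    let T ← tuplesT S k
    flatMapT (fun s => mapT (fun t => do
      tick 1
      return s :: t) T) S

end Lists

def sumT (l : List ℚ) : Timed ℚ := foldT addT 0 l

/-- Insertion into a list of point masses that is sorted by principal utility. -/
def insertT {τ U : Type} (x : τ × MassPoint U) :
    List (τ × MassPoint U) → Timed (List (τ × MassPoint U))
  | [] => do
    tick 1
    return [x]
  | y :: l => do
    tick 1
    let b ← leT x.2.principal y.2.principal
    if b then
      return x :: y :: l
    else
      let r ← insertT x l
      return y :: r

/-- Insertion sort: non-decreasing order of principal utility. -/
def sortT {τ U : Type} : List (τ × MassPoint U) → Timed (List (τ × MassPoint U))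
  | [] => do
    tick 1
    return []
  | x :: l => do
    let r ← sortT l
    insertT x r

/-! ### Preprocessing -/

/-- A distribution after preprocessing: its agent utilities are finite. -/
abbrev FDist := List (MassPoint ℚ)

/-- The list of all point masses, tagged with their action and configuration. -/
def allPoints (I : Instance) : Timed (List ((ℕ × ℕ) × MassPoint (WithBot ℚ))) := do
  let actions ← enumerateT I
  flatMapT (fun Ai => do
    let configs ← enumerateT Ai.1
    flatMapT (fun Dj => mapT (fun x => do
      tick 1
      return ((Ai.2, Dj.2), x)) Dj.1) configs) actions

/-- A finite number below all finite agent utilities; it takes the place of `-∞`. -/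
def bottomT {τ : Type} (L : List (τ × MassPoint (WithBot ℚ))) : Timed ℚ := do
  let low ← foldT (fun (acc : ℚ) x => match x.2.agent with
    | ⊥ => do
      tick 1
      return acc
    | (a : ℚ) => do
      let b ← ltT a acc
      return if b then a else acc) 0 L
  subT low 1

/-- The least positive difference of two entries (or `1`, if that is smaller). -/
def minGapT (S : List ℚ) : Timed ℚ :=
  foldT (fun g a => foldT (fun (g : ℚ) b => do
    let d ← subT b a
    let pos ← ltT 0 d
    let small ← ltT d g
    return if pos && small then d else g) g S) 1 S

/-- Split a point mass of probability `p` into `⌊p M²⌋` masses of size `1/M²` and one that carries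
the remainder, adding `δ ℓ` to the agent utility, with a new `ℓ` for every piece. Returns the next
unused `ℓ` and the pieces. -/
def splitPoint (M : ℕ) (δ : ℚ) (l : ℕ) (x : MassPoint ℚ) : Timed (ℕ × FDist) := do
  let unit : ℚ := 1 / (M : ℚ) ^ 2
  let scaled ← divT x.prob unit
  let k ← floorT scaled
  let ks ← rangeT k
  let whole ← mapT (fun k' => do
    let l' ← natAddT l k'
    let shift ← mulT δ l'
    let a ← addT x.agent shift
    return (⟨a, x.principal, unit⟩ : MassPoint ℚ)) ks
  let l' ← natAddT l k
  let shift ← mulT δ l'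
  let a ← addT x.agent shift
  let used ← mulT k unit
  let rest ← subT x.prob used
  let l'' ← natAddT l' 1
  let pieces ← appendT whole [⟨a, x.principal, rest⟩]
  return (l'', pieces)

/-- Preprocessing: break all point masses into masses of size at most `1/M²` with distinct agent
utilities, starting with the lowest principal utility. The perturbation `δ` is so small that strict
preferences of the agent do not change. -/
def preprocess (M : ℕ) (I : Instance) : Timed (List (List FDist)) := do
  let L₀ ← allPoints I
  let bot ← bottomT L₀
  let L₁ ← mapT (fun x => do
    tick 1
    return (x.1, (⟨x.2.agent.unbotD bot, x.2.principal, x.2.prob⟩ : MassPoint ℚ))) L₀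
  let L ← sortT L₁
  let agents ← mapT (fun x => do
    tick 1
    return x.2.agent) L
  let gap ← minGapT agents
  let len ← lengthT L
  let maxPieces ← natMulT len (M ^ 2 + 1)
  let δ ← divT gap maxPieces
  let split ← foldT (fun (acc : ℕ × List ((ℕ × ℕ) × MassPoint ℚ)) x => do
    let r ← splitPoint M δ acc.1 x.2
    let tagged ← mapT (fun y => do
      tick 1
      return (x.1, y)) r.2
    let out ← appendT acc.2 tagged
    return (r.1, out)) ((0 : ℕ), ([] : List ((ℕ × ℕ) × MassPoint ℚ))) L
  let actions ← enumerateT I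
  mapT (fun Ai => do
    let configs ← enumerateT Ai.1
    mapT (fun Dj => do
      let mine ← filterT (fun y => do
        let b₁ ← natEqT y.1.1 Ai.2
        let b₂ ← natEqT y.1.2 Dj.2
        return b₁ && b₂) split.2
      mapT (fun y => do
        tick 1
        return y.2) mine) configs) actions

/-! ### Bins and the additive estimates

A guess is a list `û = [û_1, …, û_M]`; with `û_0 = -∞` it defines the bins `B_j = [û_{j-1}, û_j)` for
`1 ≤ j < M` and `B_M = [û_{M-1}, û_M]`, and `B_{≤ j} = B_1 ∪ … ∪ B_j`. -/

/-- Whether the agent utility `x` lies in `B_{≤ j}`, for `1 ≤ j ≤ M`. -/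
def inCumBin (M : ℕ) (û : List ℚ) (j : ℕ) (x : ℚ) : Timed Bool := do
  let u ← getT û (j - 1) 0
  if j = M then leT x u else ltT x u

/-- Whether the agent utility `x` lies in `B_j`, for `1 ≤ j ≤ M`. -/
def inBin (M : ℕ) (û : List ℚ) (j : ℕ) (x : ℚ) : Timed Bool := do
  let upper ← inCumBin M û j x
  if j = 1 then
    return upper
  else
    let u ← getT û (j - 2) 0
    let lower ← leT u x
    return lower && upper

/-- For one configuration of one action, with distribution `D`: the pair of
`q = Pr[u_i^A ∈ B_j | u_i^A ∈ B_{≤ j}]` and `E[u_i^P | u_i^A ∈ B_j] q`. -/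
def binStats (M : ℕ) (û : List ℚ) (D : FDist) (j : ℕ) : Timed (ℚ × ℚ) := do
  let cum ← filterT (fun x => inCumBin M û j x.agent) D
  let bin ← filterT (fun x => inBin M û j x.agent) D
  let cumProbs ← mapT (fun x => do
    tick 1
    return x.prob) cum
  let binProbs ← mapT (fun x => do
    tick 1
    return x.prob) bin
  let binUtils ← mapT (fun x => mulT x.prob x.principal) bin
  let pCum ← sumT cumProbs
  let pBin ← sumT binProbs
  let eBin ← sumT binUtils
  let q ← divT pBin pCum
  let e ← divT eBin pBin
  let u ← mulT e q
  return (q, u)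

/-- For one configuration of one action: the numbers `k_j = ⌊q_j M² n⌋` of increments `1/(M² n)` for
`j = 1, …, M`, and the contribution `ψ = ∑_{j = 6}^M c_j u_j` to the approximate objective, where
`c_j = (j - 5)/(M - 1)`. Here `N = M² n`. -/
def summary (M N : ℕ) (û : List ℚ) (D : FDist) : Timed (List ℕ × ℚ) := do
  let idx ← rangeT M
  let stats ← mapT (fun i => do
    let s ← binStats M û D (i + 1)
    return (i + 1, s)) idx
  let ks ← mapT (fun s => do
    let r ← mulT s.2.1 N
    floorT r) stats
  let terms ← mapT (fun s =>
    if 6 ≤ s.1 then mulT (((s.1 : ℚ) - 5) / ((M : ℚ) - 1)) s.2.2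
    else do
      tick 1
      return 0) stats
  let ψ ← sumT terms
  return (ks, ψ)

/-! ### The dynamic program for one guess of the bins -/

/-- The constraints `k_j / N ∈ [(1 - 1/M)/j - 1/M², (1 + 1/M)/(j - 1)]` for `j = 1, …, M`
(the upper bound for `j = 1` is `∞`). -/
def feasible (M N : ℕ) (k : List ℕ) : Timed Bool := do
  let ks ← enumerateT k
  allT (fun kj => do
    let j : ℚ := (kj.2 : ℚ) + 1
    let est ← divT kj.1 N
    let lower ← leT ((1 - 1 / (M : ℚ)) / j - 1 / (M : ℚ) ^ 2) est
    let upper ← if kj.2 = 0 then (do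
      tick 1
      return true) else leT est ((1 + 1 / (M : ℚ)) / (j - 1))
    return lower && upper) ks

/-- Componentwise sum. -/
def addVecT : List ℕ → List ℕ → Timed (List ℕ)
  | a :: v, b :: w => do
    let c ← natAddT a b
    let r ← addVecT v w
    return c :: r
  | _, _ => do
    tick 1
    return []

def eqVecT : List ℕ → List ℕ → Timed Bool
  | [], [] => do
    tick 1
    return true
  | a :: v, b :: w => do
    let e ← natEqT a b
    if e then eqVecT v w else return false
  | _, _ => do
    tick 1
    return false

/-- A memo table: for each vector `k` the optimal value with a configuration of the remaining actions
that attains it, or `none` for the value `-∞`. -/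
abbrev Table := List (List ℕ × Option (ℚ × List ℕ))

def lookupT (k : List ℕ) : Table → Timed (Option (ℚ × List ℕ))
  | [] => do
    tick 1
    return none
  | e :: t => do
    tick 1
    let b ← eqVecT k e.1
    if b then return e.2 else lookupT k t

/-- The better one of two optional solutions (the first one, if they are equally good). -/
def betterT (a b : Option (ℚ × List ℕ)) : Timed (Option (ℚ × List ℕ)) :=
  match a, b with
  | some x, some y => do
    let lt ← ltT x.1 y.1
    return if lt then some y else some x
  | some x, none => do
    tick 1
    return some x
  | none, y => do
    tick 1
    return y

/-- The table of `OPT(i, k)` over all `k` in `keys`, for the actions `i, …, n` given by the summaries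
of their configurations: `OPT(n + 1, k)` is `0` if `k` satisfies the constraints and `-∞` otherwise,
and `OPT(i, k) = max_ℓ (ψ_i(ℓ) + OPT(i + 1, k + k^{i,ℓ}))`. -/
def optTable (M N : ℕ) (keys : List (List ℕ)) : List (List (List ℕ × ℚ)) → Timed Table
  | [] => mapT (fun k => do
      let b ← feasible M N k
      return (k, if b then some (0, []) else none)) keys
  | s :: rest => do
    let next ← optTable M N keys rest
    let configs ← enumerateT s
    mapT (fun k => do
      let best ← foldT (fun (best : Option (ℚ × List ℕ)) c => do
        let k' ← addVecT k c.1.1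
        let r ← lookupT k' next
        match r with
        | none => do
          tick 1
          return best
        | some x => do
          let v ← addT c.1.2 x.1
          betterT best (some (v, c.2 :: x.2))) none configs
      return (k, best)) keys

/-- For one guess `û` of the bins: a configuration that maximizes the approximate objective subject to
the constraints, if there is one. -/
def solve (M : ℕ) (J : List (List FDist)) (û : List ℚ) : Timed (Option (List ℕ)) := do
  let n ← lengthT J
  let N ← natMulT (M ^ 2) n
  let summaries ← mapT (fun A => mapT (fun D => summary M N û D) A) J
  let top ← natMulT n N
  let values ← rangeT (top + 1)
  let keys ← tuplesT values M
  let table ← optTable M N keys summaries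
  let start ← mapT (fun _ => do
    tick 1
    return 0) û
  let r ← lookupT start table
  match r with
  | none => return none
  | some x => return some x.2

/-! ### The expected principal utility of a configuration -/

/-- `Pr[u^A < a]` for a preprocessed distribution. -/
def probBelow (F : FDist) (a : ℚ) : Timed ℚ := do
  let below ← filterT (fun x => ltT x.agent a) F
  let probs ← mapT (fun x => do
    tick 1
    return x.prob) below
  sumT probs

/-- The utilities from the agent's favorite one of two independent options with distributions `F` and
`G` whose agent utilities are all distinct. -/
def combine (F G : FDist) : Timed FDist := do
  let F' ← mapT (fun x => do
    let b ← probBelow G x.agent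
    let p ← mulT x.prob b
    return (⟨x.agent, x.principal, p⟩ : MassPoint ℚ)) F
  let G' ← mapT (fun y => do
    let b ← probBelow F y.agent
    let p ← mulT y.prob b
    return (⟨y.agent, y.principal, p⟩ : MassPoint ℚ)) G
  appendT F' G'

/-- The distribution of the utilities from the agent's favorite action under a configuration. -/
def favorite : List (List FDist) → List ℕ → Timed FDist
  | [A], [c] => getT A c []
  | A :: J, c :: C => do
    let F ← favorite J C
    let D ← getT A c []
    combine D F
  | _, _ => do
    tick 1
    return []

/-- The expected principal utility of a configuration of a preprocessed instance. -/
def evaluate (J : List (List FDist)) (C : List ℕ) : Timed ℚ := do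
  let F ← favorite J C
  let terms ← mapT (fun x => mulT x.prob x.principal) F
  sumT terms

/-! ### The algorithm -/

/-- Whether a list is non-decreasing. -/
def isMonotoneT : List ℚ → Timed Bool
  | a :: b :: l => do
    let h ← leT a b
    if h then isMonotoneT (b :: l) else return false
  | _ => do
    tick 1
    return true

/-- All non-decreasing profiles `û_1 ≤ … ≤ û_M` from the union of the supports of all agent utility
distributions. -/
def guesses (M : ℕ) (J : List (List FDist)) : Timed (List (List ℚ)) := do
  let support ← flatMapT (fun A => flatMapT (fun D => mapT (fun x => do
    tick 1
    return x.agent) D) A) J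
  let all ← tuplesT support M
  filterT isMonotoneT all

/-- The algorithm with fineness parameter `M`: preprocess; solve the dynamic program for every guess of
the bins; among the configurations found, return one with the largest expected principal utility. If
no guess is feasible, return the configuration that picks the first configuration of every action. -/
def algorithm (M : ℕ) (I : Instance) : Timed (List ℕ) := do
  let J ← preprocess M I
  let profiles ← guesses M J
  let best ← foldT (fun (best : Option (ℚ × List ℕ)) û => do
    let r ← solve M J û
    match r with
    | none => return best
    | some C => do
      let v ← evaluate J C
      betterT best (some (v, C))) none profiles
  match best with
  | some x => return x.2
  | none => mapT (fun _ => do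
      tick 1
      return 0) I

/-! ### Approximation and running time -/

/-- On every valid instance in the class `𝒦`, the output of `A` is a configuration whose expected
principal utility is at least `α` times that of any configuration. -/
def IsApproximation (α : ℝ) (A : Instance → Timed (List ℕ)) (𝒦 : Instance → Prop) : Prop :=
  ∀ I : Instance, I.Valid → 𝒦 I →
    IsConfiguration I (A I).val ∧
      ∀ C, IsConfiguration I C →
        α * (expectedUtility I C : ℝ) ≤ (expectedUtility I (A I).val : ℝ)

/-- The number of steps of `A` on a valid instance is at most a polynomial in the input size. -/
def RunsInPolynomialTime (A : Instance → Timed (List ℕ)) : Prop :=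
  ∃ p : Polynomial ℕ, ∀ I : Instance, I.Valid → (A I).time ≤ p.eval I.size

/-- The family `A ε` is a polynomial-time approximation scheme for the class `𝒦`: for every fixed
`ε > 0`, it is a polynomial-time `(1 - ε)`-approximation. -/
def IsPTAS (A : ℝ → Instance → Timed (List ℕ)) (𝒦 : Instance → Prop) : Prop :=
  ∀ ε : ℝ, 0 < ε → IsApproximation (1 - ε) (A ε) 𝒦 ∧ RunsInPolynomialTime (A ε)

end UtilityConfiguration

/-!
# A polynomial-time approximation scheme for utility-aligned instances

The favorite action `max_i u_i^A` is analysed through its cumulative distribution function, which is a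
product over the actions. Fix bins `B_1, …, B_M` and put `q_ij = Pr[u_i^A ∈ B_j | u_i^A ∈ B_{≤ j}]`.
Then `Pr[u^A ∈ B_{≤ j-1}] = Pr[u^A ∈ B_{≤ j}] · ∏_i (1 - q_ij)` (`mass_best_step`), so constraints on
the sums `∑_i q_ij` control the quantiles of `u^A`. Likewise, the principal's expected utility from the
event that the favorite action lies in `B_j` is, up to a factor between `Pr[u^A ∈ B_{≤ j-1}]` and
`Pr[u^A ∈ B_{≤ j}]`, the sum `∑_i E[u_i^P | u_i^A ∈ B_j] q_ij` (`le_share_best`, `share_best_le`).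
Objective and constraints thus become additive over the actions, and a dynamic program optimizes them
exactly (`solve_spec`).

*Approximation.* Preprocessing splits the point masses so that `u^A` has no atom above `1 / M²`, and
removes ties without changing the joint distribution of the original utilities (`exists_isRefinement`,
`expectation_eq_mean_best`). Hence some guess of the bins is within `1 / M²` of the `M`-quantiles of an
aligned optimal configuration (`exists_guess`). That configuration satisfies the constraints: the union
bound gives the lower ones, and `∏ (1 - q) ≤ exp (-∑ q)` the upper ones (`constraints_of_quantiles`).
Every configuration that satisfies the constraints has `Pr[u^A ∈ B_{≤ j}] ≥ (j - 4) / (M - 1)`, by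
downward induction on `j` (`le_mass_best_of_constraints`), so its additive objective, whose
coefficients are `(j - 5) / (M - 1)`, is at most its expected utility (`contribution_le`). For the
aligned optimal configuration, on the other hand, the objective loses at most the fraction `5 / j` of
the utility in bin `B_j`. Alignment bounds the utility in `B_{≤ j}` by `2 (j / M)` times the total;
summation by parts turns this into a total loss of `O(log M / M)` (`le_contribution_of_quantiles`).
For `M < 6` the claimed factor is negative.

*Running time.* `Within s k x P` says that the computation `x` takes at most `s ^ k` steps and that its
result satisfies `P`; here `s` is the input size plus a constant. Every primitive, and every
combinator for lists, has a rule for this predicate, in which `P` records the lengths of lists and the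
bit lengths of numbers. Recursions over the actions need an accounting of their own. In the dynamic
program, the values are sums of at most `n` numbers, so their bit lengths add up. In the combination
of distributions, each mass is multiplied by a sum of masses of another distribution; there the bit
lengths stay polynomial because all masses of a distribution have a common denominator
(`Commensurable`), and common denominators just multiply.
-/

namespace UtilityConfiguration

/-! ### Results of step-counted computations -/

section Values

variable {α β : Type}

@[simp] theorem val_pure (a : α) : (pure a : Timed α).val = a := rfl

@[simp] theorem val_bind (x : Timed α) (f : α → Timed β) : (x >>= f).val = (f x.val).val := rfl

@[simp] theorem val_ite (p : Prop) [Decidable p] (x y : Timed α) :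
    (if p then x else y).val = if p then x.val else y.val := by
  split <;> rfl

@[simp] theorem val_natAddT (a b : ℕ) : (natAddT a b).val = a + b := rfl
@[simp] theorem val_natMulT (a b : ℕ) : (natMulT a b).val = a * b := rfl
@[simp] theorem val_natEqT (a b : ℕ) : (natEqT a b).val = decide (a = b) := rfl
@[simp] theorem val_addT (a b : ℚ) : (addT a b).val = a + b := rfl
@[simp] theorem val_subT (a b : ℚ) : (subT a b).val = a - b := rfl
@[simp] theorem val_mulT (a b : ℚ) : (mulT a b).val = a * b := rfl
@[simp] theorem val_divT (a b : ℚ) : (divT a b).val = a / b := rfl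
@[simp] theorem val_leT (a b : ℚ) : (leT a b).val = decide (a ≤ b) := rfl
@[simp] theorem val_ltT (a b : ℚ) : (ltT a b).val = decide (a < b) := rfl
@[simp] theorem val_floorT (a : ℚ) : (floorT a).val = ⌊a⌋₊ := rfl
@[simp] theorem val_lengthT (l : List α) : (lengthT l).val = l.length := rfl
@[simp] theorem val_getT (l : List α) (i : ℕ) (d : α) : (getT l i d).val = l.getD i d := rfl
@[simp] theorem val_rangeT (k : ℕ) : (rangeT k).val = List.range k := rfl
@[simp] theorem val_enumerateT (l : List α) : (enumerateT l).val = l.zipIdx := rfl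
@[simp] theorem val_appendT (l₁ l₂ : List α) : (appendT l₁ l₂).val = l₁ ++ l₂ := rfl

@[simp] theorem val_mapT (f : α → Timed β) (l : List α) :
    (mapT f l).val = l.map fun a => (f a).val := by
  induction l with
  | nil => rfl
  | cons a l ih => simp [mapT, ih]

@[simp] theorem val_filterT (p : α → Timed Bool) (l : List α) :
    (filterT p l).val = l.filter fun a => (p a).val := by
  induction l with
  | nil => rfl
  | cons a l ih => simp [filterT, ih, List.filter_cons]

@[simp] theorem val_flatMapT (f : α → Timed (List β)) (l : List α) :
    (flatMapT f l).val = l.flatMap fun a => (f a).val := by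
  induction l with
  | nil => rfl
  | cons a l ih => simp [flatMapT, ih]

@[simp] theorem val_foldT (f : β → α → Timed β) (b : β) (l : List α) :
    (foldT f b l).val = l.foldl (fun b a => (f b a).val) b := by
  induction l generalizing b with
  | nil => rfl
  | cons a l ih => simp [foldT, ih]

@[simp] theorem val_allT (p : α → Timed Bool) (l : List α) :
    (allT p l).val = l.all fun a => (p a).val := by
  induction l with
  | nil => rfl
  | cons a l ih => simp only [allT, val_bind, List.all_cons, val_ite, val_pure, ih]; split <;> simp_all

theorem mem_tuplesT (S : List α) (k : ℕ) (t : List α) :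
    t ∈ (tuplesT S k).val ↔ t.length = k ∧ ∀ a ∈ t, a ∈ S := by
  induction k generalizing t with
  | zero => simp +contextual [tuplesT]
  | succ k ih =>
    cases t with
    | nil => simp [tuplesT]
    | cons a t => simp [tuplesT, ih]; tauto

@[simp] theorem val_sumT (l : List ℚ) : (sumT l).val = l.sum := by
  have h : ∀ (l : List ℚ) (b : ℚ), l.foldl (fun b a => b + a) b = b + l.sum := by
    intro l
    induction l with
    | nil => simp
    | cons a l ih => intro b; simp [ih, add_assoc]
  simp [sumT, h]

theorem val_isMonotoneT (l : List ℚ) : (isMonotoneT l).val = true ↔ l.IsChain (· ≤ ·) := by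
  induction l with
  | nil => simp [isMonotoneT]
  | cons a l ih =>
    cases l with
    | nil => simp [isMonotoneT]
    | cons b l =>
      simp only [isMonotoneT, val_bind, val_leT, decide_eq_true_eq, val_ite, val_pure,
        List.isChain_cons_cons]
      by_cases h : a ≤ b <;> simp [h, ih]

@[simp] theorem val_addVecT (v w : List ℕ) : (addVecT v w).val = List.zipWith (· + ·) v w := by
  induction v generalizing w with
  | nil => simp [addVecT]
  | cons a v ih => cases w <;> simp [addVecT, ih]

@[simp] theorem val_eqVecT (v w : List ℕ) : (eqVecT v w).val = decide (v = w) := by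
  induction v generalizing w with
  | nil => cases w <;> simp [eqVecT]
  | cons a v ih =>
    cases w with
    | nil => simp [eqVecT]
    | cons b w => by_cases h : a = b <;> simp [eqVecT, ih, h]

section SortByPrincipal

variable {τ U : Type}

theorem insertT_perm (x : τ × MassPoint U) (l : List (τ × MassPoint U)) :
    (insertT x l).val.Perm (x :: l) := by
  induction l with
  | nil => simp [insertT]
  | cons y l ih =>
    by_cases h : x.2.principal ≤ y.2.principal
    · simp [insertT, h]
    · simpa [insertT, h] using (ih.cons y).trans (.swap _ _ _)

theorem sortT_perm (l : List (τ × MassPoint U)) : (sortT l).val.Perm l := by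
  induction l with
  | nil => simp [sortT]
  | cons x l ih => exact (insertT_perm x _).trans (ih.cons x)

theorem insertT_sorted (x : τ × MassPoint U) (l : List (τ × MassPoint U))
    (hl : l.Pairwise fun y z => y.2.principal ≤ z.2.principal) :
    (insertT x l).val.Pairwise fun y z => y.2.principal ≤ z.2.principal := by
  induction l with
  | nil => simp [insertT]
  | cons y l ih =>
    rw [List.pairwise_cons] at hl
    by_cases h : x.2.principal ≤ y.2.principal
    · simp only [insertT, val_bind, val_leT, val_pure, h, decide_true, if_true]
      refine List.pairwise_cons.2 ⟨fun z hz => ?_, List.pairwise_cons.2 hl⟩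
      rcases List.mem_cons.1 hz with rfl | hz
      · exact h
      · exact h.trans (hl.1 z hz)
    · simp only [insertT, val_bind, val_leT, val_pure, h, decide_false, Bool.false_eq_true, if_false]
      refine List.pairwise_cons.2 ⟨fun z hz => ?_, ih hl.2⟩
      rcases List.mem_cons.1 ((insertT_perm x l).mem_iff.1 hz) with rfl | hz
      · exact (not_le.1 h).le
      · exact hl.1 z hz

theorem sortT_sorted (l : List (τ × MassPoint U)) :
    (sortT l).val.Pairwise fun y z => y.2.principal ≤ z.2.principal := by
  induction l with
  | nil => simp [sortT]
  | cons x l ih => exact insertT_sorted x _ ih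

end SortByPrincipal

end Values

/-! ### Expectations over lists of point masses -/

/-- The integral of `g` with respect to the masses in `D`. -/
def mean {U : Type} (D : List (MassPoint U)) (g : MassPoint U → ℚ) : ℚ :=
  (D.map fun x => x.prob * g x).sum

/-- The mass that `D` puts on agent utilities with the property `P`. -/
def mass (P : ℚ → Prop) [DecidablePred P] (D : FDist) : ℚ :=
  mean D fun x => if P x.agent then 1 else 0

section Mean

variable {U V : Type}

@[simp] theorem mean_nil (g : MassPoint U → ℚ) : mean [] g = 0 := rfl

@[simp] theorem mean_cons (x : MassPoint U) (D : List (MassPoint U)) (g : MassPoint U → ℚ) :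
    mean (x :: D) g = x.prob * g x + mean D g := by simp [mean]

theorem mean_append (D G : List (MassPoint U)) (g : MassPoint U → ℚ) :
    mean (D ++ G) g = mean D g + mean G g := by simp [mean]

theorem mean_congr {D : List (MassPoint U)} {g h : MassPoint U → ℚ} (H : ∀ x ∈ D, g x = h x) :
    mean D g = mean D h := by
  unfold mean
  congr 1
  exact List.map_congr_left fun x hx => by rw [H x hx]

theorem mean_add (D : List (MassPoint U)) (g h : MassPoint U → ℚ) :
    mean D (fun x => g x + h x) = mean D g + mean D h := by
  induction D with
  | nil => simp
  | cons x D ih => simp only [mean_cons, ih]; ring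

theorem mean_sub (D : List (MassPoint U)) (g h : MassPoint U → ℚ) :
    mean D (fun x => g x - h x) = mean D g - mean D h := by
  induction D with
  | nil => simp
  | cons x D ih => simp only [mean_cons, ih]; ring

theorem mean_mul_left (D : List (MassPoint U)) (c : ℚ) (g : MassPoint U → ℚ) :
    mean D (fun x => c * g x) = c * mean D g := by
  induction D with
  | nil => simp
  | cons x D ih => simp only [mean_cons, ih]; ring

theorem mean_mul_right (D : List (MassPoint U)) (c : ℚ) (g : MassPoint U → ℚ) :
    mean D (fun x => g x * c) = mean D g * c := by
  induction D with
  | nil => simp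
  | cons x D ih => simp only [mean_cons, ih]; ring

theorem mean_zero (D : List (MassPoint U)) : mean D (fun _ => 0) = 0 := by
  simpa using mean_mul_left D 0 fun _ => 0

theorem mean_mono {D : List (MassPoint U)} {g h : MassPoint U → ℚ} (hD : ∀ x ∈ D, 0 ≤ x.prob)
    (H : ∀ x ∈ D, g x ≤ h x) : mean D g ≤ mean D h :=
  List.sum_le_sum fun x hx => mul_le_mul_of_nonneg_left (H x hx) (hD x hx)

theorem mean_nonneg {D : List (MassPoint U)} {g : MassPoint U → ℚ} (hD : ∀ x ∈ D, 0 ≤ x.prob)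
    (H : ∀ x ∈ D, 0 ≤ g x) : 0 ≤ mean D g := by
  rw [← mean_zero D]
  exact mean_mono hD H

theorem mean_comm (D : List (MassPoint U)) (G : List (MassPoint V))
    (f : MassPoint U → MassPoint V → ℚ) :
    mean D (fun x => mean G fun y => f x y) = mean G fun y => mean D fun x => f x y := by
  induction D with
  | nil => simp [mean_zero]
  | cons x D ih => simp only [mean_cons, ih, mean_add, mean_mul_left]

theorem sum_filter_map {α : Type} (p : α → Prop) [DecidablePred p] (f : α → ℚ) (l : List α) :
    ((l.filter fun a => decide (p a)).map f).sum = (l.map fun a => if p a then f a else 0).sum := by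
  induction l with
  | nil => simp
  | cons a l ih => by_cases h : p a <;> simp [h, ih]

theorem mass_nonneg (P : ℚ → Prop) [DecidablePred P] {D : FDist} (hD : ∀ x ∈ D, 0 ≤ x.prob) :
    0 ≤ mass P D :=
  mean_nonneg hD fun x _ => by split <;> norm_num

theorem mass_mono {P Q : ℚ → Prop} [DecidablePred P] [DecidablePred Q] {D : FDist}
    (hD : ∀ x ∈ D, 0 ≤ x.prob) (H : ∀ x ∈ D, P x.agent → Q x.agent) : mass P D ≤ mass Q D :=
  mean_mono hD fun x hx => by
    by_cases hP : P x.agent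
    · simp [hP, H x hx hP]
    · simp only [hP, if_false]; split <;> norm_num

theorem mass_congr {P Q : ℚ → Prop} [DecidablePred P] [DecidablePred Q] {D : FDist}
    (H : ∀ x ∈ D, P x.agent ↔ Q x.agent) : mass P D = mass Q D :=
  mean_congr fun x hx => by simp [H x hx]

end Mean

/-! ### The agent's favorite action -/

/-- The distribution of the utilities from the better one (for the agent) of two independent options
without ties. -/
def better (F G : FDist) : FDist :=
  (F.map fun x => ⟨x.agent, x.principal, x.prob * mass (· < x.agent) G⟩) ++
    G.map fun y => ⟨y.agent, y.principal, y.prob * mass (· < y.agent) F⟩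

/-- The distribution of the utilities from the agent's favorite one of independent options without
ties. -/
def best : List FDist → FDist
  | [] => []
  | [D] => D
  | D :: E :: L => better D (best (E :: L))

/-- No agent utility occurs in both distributions. -/
def Apart (F G : FDist) : Prop := ∀ x ∈ F, ∀ y ∈ G, x.agent ≠ y.agent

/-- All weights and all principal utilities are nonnegative. -/
def FDist.Nonneg (D : FDist) : Prop := ∀ x ∈ D, 0 ≤ x.prob ∧ 0 ≤ x.principal

/-- The principal's share of the region between two down-closed sets `P ⊆ Q` of agent utilities. -/
def share (P Q : ℚ → Prop) [DecidablePred P] [DecidablePred Q] (D : FDist) : ℚ :=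
  mean D fun x => if Q x.agent ∧ ¬ P x.agent then x.principal else 0

theorem val_combine (F G : FDist) : (combine F G).val = better F G := by
  simp [combine, better, probBelow, mass, mean, sum_filter_map]

/-- Of each pair of independent outcomes, the agent's preferred one counts. -/
theorem mean_better {F G : FDist} (h : Apart F G) (g : ℚ → ℚ → ℚ) :
    mean (better F G) (fun z => g z.agent z.principal) =
      mean F fun x => mean G fun y =>
        if y.agent < x.agent then g x.agent x.principal else g y.agent y.principal := by
  have h₁ : ∀ (F G : FDist), mean (F.map fun x => (⟨x.agent, x.principal,
      x.prob * mass (· < x.agent) G⟩ : MassPoint ℚ)) (fun z => g z.agent z.principal) =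
      mean F fun x => mean G fun y => if y.agent < x.agent then g x.agent x.principal else 0 := by
    intro F G
    unfold mean
    rw [List.map_map]
    congr 1
    refine List.map_congr_left fun x _ => ?_
    simp only [Function.comp, mul_assoc]
    congr 1
    change mass _ G * _ = mean G _
    rw [mass, ← mean_mul_right]
    exact mean_congr fun y _ => by split <;> simp
  rw [better, mean_append, h₁ F G, h₁ G F, mean_comm G F, ← mean_add]
  refine mean_congr fun x hx => ?_
  rw [← mean_add]
  refine mean_congr fun y hy => ?_
  rcases lt_or_gt_of_ne (h x hx y hy) with hlt | hlt
  · simp [hlt, not_lt_of_gt hlt]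
  · simp [hlt, not_lt_of_gt hlt]

theorem mem_better {F G : FDist} {z : MassPoint ℚ} (hz : z ∈ better F G) :
    ∃ x, (x ∈ F ∨ x ∈ G) ∧ x.agent = z.agent ∧ x.principal = z.principal := by
  simp only [better, List.mem_append, List.mem_map] at hz
  rcases hz with ⟨x, hx, rfl⟩ | ⟨x, hx, rfl⟩
  · exact ⟨x, .inl hx, rfl, rfl⟩
  · exact ⟨x, .inr hx, rfl, rfl⟩

theorem mem_best {L : List FDist} {z : MassPoint ℚ} (hz : z ∈ best L) :
    ∃ D ∈ L, ∃ x ∈ D, x.agent = z.agent ∧ x.principal = z.principal := by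
  induction L generalizing z with
  | nil => simp [best] at hz
  | cons D L ih =>
    cases L with
    | nil => exact ⟨D, by simp, z, hz, rfl, rfl⟩
    | cons E L =>
      obtain ⟨x, hx | hx, h₁, h₂⟩ := mem_better hz
      · exact ⟨D, by simp, x, hx, h₁, h₂⟩
      · obtain ⟨D', hD', x', hx', h₁', h₂'⟩ := ih hx
        exact ⟨D', List.mem_cons_of_mem _ hD', x', hx', h₁'.trans h₁, h₂'.trans h₂⟩

theorem apart_best {D : FDist} {L : List FDist} (h : ∀ E ∈ L, Apart D E) : Apart D (best L) := by
  intro x hx y hy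
  obtain ⟨E, hE, y', hy', h₁, -⟩ := mem_best hy
  rw [← h₁]
  exact h E hE x hx y' hy'

theorem FDist.Nonneg.better {F G : FDist} (hF : F.Nonneg) (hG : G.Nonneg) :
    (better F G).Nonneg := by
  intro z hz
  simp only [UtilityConfiguration.better, List.mem_append, List.mem_map] at hz
  rcases hz with ⟨x, hx, rfl⟩ | ⟨x, hx, rfl⟩
  · exact ⟨mul_nonneg (hF x hx).1 (mass_nonneg _ fun y hy => (hG y hy).1), (hF x hx).2⟩
  · exact ⟨mul_nonneg (hG x hx).1 (mass_nonneg _ fun y hy => (hF y hy).1), (hG x hx).2⟩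

theorem best_nonneg {L : List FDist} (h : ∀ D ∈ L, D.Nonneg) : (best L).Nonneg := by
  induction L with
  | nil => intro z hz; simp [best] at hz
  | cons D L ih =>
    cases L with
    | nil => exact h D (by simp)
    | cons E L => exact (h D (by simp)).better (ih fun D' hD' => h D' (List.mem_cons_of_mem _ hD'))

/-- The favorite utility lies in a down-closed set if and only if the utilities of all actions do, so
the probabilities multiply. -/
theorem mass_best (P : ℚ → Prop) [DecidablePred P] (hP : ∀ a b, a ≤ b → P b → P a)
    {L : List FDist} (hL : L ≠ []) (hA : L.Pairwise Apart) :
    mass P (best L) = (L.map (mass P)).prod := by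
  induction L with
  | nil => exact absurd rfl hL
  | cons D L ih =>
    cases L with
    | nil => simp [best]
    | cons E L =>
      rw [List.pairwise_cons] at hA
      rw [List.map_cons, List.prod_cons, ← ih (by simp) hA.2]
      change mean (better D (best (E :: L))) _ = _
      rw [mean_better (apart_best hA.1) (fun a _ => if P a then 1 else 0), mass, ← mean_mul_right]
      refine mean_congr fun x _ => ?_
      rw [mass, ← mean_mul_left]
      refine mean_congr fun y _ => ?_
      by_cases hlt : y.agent < x.agent
      · by_cases hx : P x.agent
        · simp [hlt, hx, hP _ _ hlt.le hx]
        · simp [hlt, hx]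
      · by_cases hy : P y.agent
        · simp [hlt, hy, hP _ _ (not_lt.1 hlt) hy]
        · simp [hlt, hy]

section Share

variable (P Q : ℚ → Prop) [DecidablePred P] [DecidablePred Q]

theorem share_nonneg {D : FDist} (hD : D.Nonneg) : 0 ≤ share P Q D :=
  mean_nonneg (fun x hx => (hD x hx).1) fun x hx => by
    split
    · exact (hD x hx).2
    · exact le_rfl

/-- A region without mass contributes nothing. -/
theorem share_eq_zero {D : FDist} (hD : D.Nonneg) (h : mass Q D = 0) : share P Q D = 0 := by
  induction D with
  | nil => rfl
  | cons x D ih =>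
    have hD' : FDist.Nonneg D := fun y hy => hD y (List.mem_cons_of_mem _ hy)
    have hx := (hD x (by simp)).1
    have hm := mass_nonneg Q fun y hy => (hD' y hy).1
    rw [mass, mean_cons] at h
    change x.prob * _ + mass Q D = 0 at h
    have h₁ : 0 ≤ x.prob * (if Q x.agent then (1 : ℚ) else 0) := by split <;> simp [hx]
    rw [share, mean_cons]
    change _ + share P Q D = 0
    rw [ih hD' (by linarith), add_zero]
    by_cases hQ : Q x.agent
    · simp only [hQ, if_true, mul_one] at h
      have : x.prob = 0 := by linarith
      simp [this]
    · simp [hQ]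

/-- An outcome of one option counts if the other option has a lower agent utility. -/
theorem share_better {F G : FDist} (h : Apart F G) :
    share P Q (better F G) =
      mean F (fun x => (if Q x.agent ∧ ¬ P x.agent then x.principal else 0) *
        mass (· < x.agent) G) +
      mean G (fun y => (if Q y.agent ∧ ¬ P y.agent then y.principal else 0) *
        mass (· < y.agent) F) := by
  have h₁ : ∀ (F G : FDist) (g : MassPoint ℚ → ℚ),
      mean F (fun x => g x * mass (· < x.agent) G) =
      mean F fun x => mean G fun y => if y.agent < x.agent then g x else 0 := by
    intro F G g
    refine mean_congr fun x _ => ?_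
    rw [mass, ← mean_mul_left]
    exact mean_congr fun y _ => by split <;> simp
  unfold share
  rw [mean_better h (fun a u => if Q a ∧ ¬ P a then u else 0), h₁ F G, h₁ G F, mean_comm G F,
    ← mean_add]
  refine mean_congr fun x hx => ?_
  rw [← mean_add]
  refine mean_congr fun y hy => ?_
  rcases lt_or_gt_of_ne (h x hx y hy) with hlt | hlt
  · simp [hlt, not_lt_of_gt hlt]
  · simp [hlt, not_lt_of_gt hlt]

variable {P Q}

theorem share_better_le (hQ : ∀ a b, a ≤ b → Q b → Q a) {F G : FDist} (h : Apart F G)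
    (hF : F.Nonneg) (hG : G.Nonneg) :
    share P Q (better F G) ≤ share P Q F * mass Q G + share P Q G * mass Q F := by
  have h₁ : ∀ (F G : FDist), F.Nonneg → G.Nonneg →
      mean F (fun x => (if Q x.agent ∧ ¬ P x.agent then x.principal else 0) *
        mass (· < x.agent) G) ≤ share P Q F * mass Q G := by
    intro F G hF hG
    rw [share, ← mean_mul_right]
    refine mean_mono (fun x hx => (hF x hx).1) fun x hx => ?_
    split
    · next hx' =>
      exact mul_le_mul_of_nonneg_left
        (mass_mono (fun y hy => (hG y hy).1) fun y _ hy => hQ _ _ hy.le hx'.1) (hF x hx).2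
    · simp
  rw [share_better P Q h]
  exact add_le_add (h₁ F G hF hG) (h₁ G F hG hF)

theorem le_share_better (hP : ∀ a b, a ≤ b → P b → P a) {F G : FDist} (h : Apart F G)
    (hF : F.Nonneg) (hG : G.Nonneg) :
    share P Q F * mass P G + share P Q G * mass P F ≤ share P Q (better F G) := by
  have h₁ : ∀ (F G : FDist), F.Nonneg → G.Nonneg →
      share P Q F * mass P G ≤
      mean F (fun x => (if Q x.agent ∧ ¬ P x.agent then x.principal else 0) *
        mass (· < x.agent) G) := by
    intro F G hF hG
    rw [share, ← mean_mul_right]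
    refine mean_mono (fun x hx => (hF x hx).1) fun x hx => ?_
    split
    · next hx' =>
      exact mul_le_mul_of_nonneg_left
        (mass_mono (fun y hy => (hG y hy).1) fun y _ hy => not_le.1 fun hle => hx'.2 (hP _ _ hle hy))
        (hF x hx).2
    · simp
  rw [share_better P Q h]
  exact add_le_add (h₁ F G hF hG) (h₁ G F hG hF)

/-- If the favorite action has a utility in the region, then all others lie in `Q`: the additive
estimate, scaled by the probability of `Q`, is an upper bound. -/
theorem share_best_le (hQ : ∀ a b, a ≤ b → Q b → Q a) {L : List FDist} (hL : L ≠ [])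
    (hA : L.Pairwise Apart) (hN : ∀ D ∈ L, D.Nonneg) :
    share P Q (best L) ≤
      (L.map (mass Q)).prod * (L.map fun D => share P Q D / mass Q D).sum := by
  have key : ∀ D : FDist, D.Nonneg → share P Q D = mass Q D * (share P Q D / mass Q D) := by
    intro D hD
    by_cases h : mass Q D = 0
    · simp [h, share_eq_zero P Q hD h]
    · field_simp
  induction L with
  | nil => exact absurd rfl hL
  | cons D L ih =>
    cases L with
    | nil => simpa [best] using (key D (hN D (by simp))).le
    | cons E L =>
      rw [List.pairwise_cons] at hA
      have hN' : ∀ D' ∈ E :: L, D'.Nonneg := fun D' h => hN D' (List.mem_cons_of_mem _ h)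
      have hD := hN D (by simp)
      refine (share_better_le hQ (apart_best hA.1) hD (best_nonneg hN')).trans ?_
      rw [mass_best Q hQ (by simp) hA.2, List.map_cons (l := E :: L) (f := mass Q),
        List.prod_cons, List.map_cons (l := E :: L) (f := fun D => share P Q D / mass Q D),
        List.sum_cons]
      have := mul_le_mul_of_nonneg_right (ih (by simp) hA.2 hN')
        (mass_nonneg Q fun x hx => (hD x hx).1)
      have h₂ := congrArg (· * ((E :: L).map (mass Q)).prod) (key D hD)
      rw [h₂]
      linarith

/-- If the favorite action has a utility in the region, then it is enough that all others lie in `P`: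
the additive estimate, scaled by the probability of `P`, is a lower bound. -/
theorem le_share_best (hP : ∀ a b, a ≤ b → P b → P a) (hPQ : ∀ a, P a → Q a)
    {L : List FDist} (hL : L ≠ []) (hA : L.Pairwise Apart) (hN : ∀ D ∈ L, D.Nonneg) :
    (L.map (mass P)).prod * (L.map fun D => share P Q D / mass Q D).sum ≤
      share P Q (best L) := by
  have key : ∀ D : FDist, D.Nonneg → mass P D * (share P Q D / mass Q D) ≤ share P Q D := by
    intro D hD
    have h₁ : mass P D ≤ mass Q D := mass_mono (fun x hx => (hD x hx).1) fun x _ => hPQ _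
    have h₂ := mass_nonneg Q fun x hx => (hD x hx).1
    have h₃ := share_nonneg P Q hD
    rw [← mul_div_assoc]
    exact div_le_of_le_mul₀ h₂ h₃ (by nlinarith)
  induction L with
  | nil => exact absurd rfl hL
  | cons D L ih =>
    cases L with
    | nil => simpa [best] using key D (hN D (by simp))
    | cons E L =>
      rw [List.pairwise_cons] at hA
      have hN' : ∀ D' ∈ E :: L, D'.Nonneg := fun D' h => hN D' (List.mem_cons_of_mem _ h)
      have hD := hN D (by simp)
      refine le_trans ?_ (le_share_better hP (apart_best hA.1) hD (best_nonneg hN'))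
      rw [mass_best P hP (by simp) hA.2, List.map_cons (l := E :: L) (f := mass P),
        List.prod_cons, List.map_cons (l := E :: L) (f := fun D => share P Q D / mass Q D),
        List.sum_cons]
      have h₁ := mul_le_mul_of_nonneg_right (ih (by simp) hA.2 hN')
        (mass_nonneg P fun x hx => (hD x hx).1)
      have h₂ : 0 ≤ ((E :: L).map (mass P)).prod := by
        refine List.prod_nonneg fun a ha => ?_
        obtain ⟨D', hD', rfl⟩ := List.mem_map.1 ha
        exact mass_nonneg P fun x hx => (hN' D' hD' x hx).1
      nlinarith [mul_le_mul_of_nonneg_right (key D hD) h₂]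

end Share

/-! ### Splitting and perturbing point masses -/

section Pieces

variable {τ : Type}

/-- The pieces of the point masses in a list, the successive ones numbered from `l` on: a piece is its
point mass of origin, its number, and its probability. -/
def piecesFrom (M : ℕ) : ℕ → List (τ × MassPoint ℚ) → List ((τ × MassPoint ℚ) × ℕ × ℚ)
  | _, [] => []
  | l, x :: L =>
    ((List.range ⌊x.2.prob / (1 / (M : ℚ) ^ 2)⌋₊).map fun k => (x, l + k, 1 / (M : ℚ) ^ 2)) ++
      (x, l + ⌊x.2.prob / (1 / (M : ℚ) ^ 2)⌋₊,
        x.2.prob - ⌊x.2.prob / (1 / (M : ℚ) ^ 2)⌋₊ * (1 / (M : ℚ) ^ 2)) ::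
      piecesFrom M (l + ⌊x.2.prob / (1 / (M : ℚ) ^ 2)⌋₊ + 1) L

/-- The perturbed point mass that a piece stands for. -/
def perturbed (δ : ℚ) (e : (τ × MassPoint ℚ) × ℕ × ℚ) : τ × MassPoint ℚ :=
  (e.1.1, ⟨e.1.2.agent + δ * (e.2.1 : ℚ), e.1.2.principal, e.2.2⟩)

theorem val_splitPoints (M : ℕ) (δ : ℚ) (L : List (τ × MassPoint ℚ)) (l : ℕ)
    (out : List (τ × MassPoint ℚ)) :
    (L.foldl (fun (acc : ℕ × List (τ × MassPoint ℚ)) x =>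
      ((splitPoint M δ acc.1 x.2).val.1,
        acc.2 ++ (splitPoint M δ acc.1 x.2).val.2.map fun y => (x.1, y))) (l, out)).2 =
      out ++ (piecesFrom M l L).map (perturbed δ) := by
  induction L generalizing l out with
  | nil => simp [piecesFrom]
  | cons x L ih =>
    rw [List.foldl_cons, ih]
    simp [piecesFrom, splitPoint, perturbed, Function.comp_def]

variable {M : ℕ}

theorem le_of_mem_piecesFrom {L : List (τ × MassPoint ℚ)} {l : ℕ}
    {e : (τ × MassPoint ℚ) × ℕ × ℚ} (he : e ∈ piecesFrom M l L) : e.1 ∈ L ∧ l ≤ e.2.1 := by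
  induction L generalizing l with
  | nil => simp [piecesFrom] at he
  | cons x L ih =>
    simp only [piecesFrom, List.mem_append, List.mem_map, List.mem_range, List.mem_cons] at he
    rcases he with ⟨k, -, rfl⟩ | rfl | he
    · simp
    · simp
    · obtain ⟨h₁, h₂⟩ := ih he
      exact ⟨List.mem_cons_of_mem _ h₁, by omega⟩

theorem floor_pieces_le (hM : 1 ≤ M) {p : ℚ} (hp : p ≤ 1) : ⌊p / (1 / (M : ℚ) ^ 2)⌋₊ ≤ M ^ 2 := by
  have hM' : (0 : ℚ) < (M : ℚ) ^ 2 := by positivity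
  refine Nat.floor_le_of_le ?_
  push_cast
  rw [div_div_eq_mul_div, div_one]
  nlinarith

/-- At most `M² + 1` pieces arise from each point mass. -/
theorem lt_of_mem_piecesFrom (hM : 1 ≤ M) {L : List (τ × MassPoint ℚ)} {l : ℕ}
    (hL : ∀ x ∈ L, x.2.prob ≤ 1) {e : (τ × MassPoint ℚ) × ℕ × ℚ} (he : e ∈ piecesFrom M l L) :
    e.2.1 < l + L.length * (M ^ 2 + 1) := by
  induction L generalizing l with
  | nil => simp [piecesFrom] at he
  | cons x L ih =>
    have hk := floor_pieces_le hM (hL x (by simp))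
    rw [List.length_cons, add_mul]
    simp only [piecesFrom, List.mem_append, List.mem_map, List.mem_range, List.mem_cons] at he
    rcases he with ⟨k, h, rfl⟩ | rfl | he
    · simp only; omega
    · simp only; omega
    · have := ih (fun y hy => hL y (List.mem_cons_of_mem _ hy)) he
      omega

theorem prob_of_mem_piecesFrom (hM : 1 ≤ M) {L : List (τ × MassPoint ℚ)} {l : ℕ}
    (hL : ∀ x ∈ L, 0 ≤ x.2.prob) {e : (τ × MassPoint ℚ) × ℕ × ℚ} (he : e ∈ piecesFrom M l L) :
    0 ≤ e.2.2 ∧ e.2.2 ≤ 1 / (M : ℚ) ^ 2 := by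
  have hM' : (0 : ℚ) < 1 / (M : ℚ) ^ 2 := by positivity
  induction L generalizing l with
  | nil => simp [piecesFrom] at he
  | cons x L ih =>
    simp only [piecesFrom, List.mem_append, List.mem_map, List.mem_range, List.mem_cons] at he
    rcases he with ⟨k, h, rfl⟩ | rfl | he
    · exact ⟨hM'.le, le_rfl⟩
    · have h₁ := Nat.floor_le (div_nonneg (hL x (by simp)) hM'.le)
      have h₂ := (Nat.lt_floor_add_one (x.2.prob / (1 / (M : ℚ) ^ 2))).le
      rw [le_div_iff₀ hM'] at h₁
      rw [div_le_iff₀ hM'] at h₂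
      constructor <;> simp only <;> linarith
    · exact ih (fun y hy => hL y (List.mem_cons_of_mem _ hy)) he

theorem piecesFrom_pairwise {L : List (τ × MassPoint ℚ)} {l : ℕ}
    (hL : L.Pairwise fun y z => y.2.principal ≤ z.2.principal) :
    (piecesFrom M l L).Pairwise fun e f =>
      e.2.1 < f.2.1 ∧ e.1.2.principal ≤ f.1.2.principal := by
  induction L generalizing l with
  | nil => simp [piecesFrom]
  | cons x L ih =>
    rw [List.pairwise_cons] at hL
    rw [piecesFrom, List.pairwise_append, List.pairwise_cons]
    refine ⟨?_, ⟨fun f hf => ?_, ih hL.2⟩, fun e he f hf => ?_⟩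
    · rw [List.pairwise_map]
      exact List.pairwise_lt_range.imp fun h => ⟨by simpa using h, le_rfl⟩
    · obtain ⟨h₁, h₂⟩ := le_of_mem_piecesFrom hf
      exact ⟨by simp only; omega, hL.1 _ h₁⟩
    · obtain ⟨k, hk, rfl⟩ := List.mem_map.1 he
      rw [List.mem_range] at hk
      rcases List.mem_cons.1 hf with rfl | hf
      · exact ⟨by simp only; omega, le_rfl⟩
      · obtain ⟨h₁, h₂⟩ := le_of_mem_piecesFrom hf
        exact ⟨by simp only; omega, hL.1 _ h₁⟩

theorem sum_piecesFrom (L : List (τ × MassPoint ℚ)) (l : ℕ) (g : τ × MassPoint ℚ → ℚ) :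
    ((piecesFrom M l L).map fun e => e.2.2 * g e.1).sum = (L.map fun x => x.2.prob * g x).sum := by
  induction L generalizing l with
  | nil => simp [piecesFrom]
  | cons x L ih =>
    simp only [piecesFrom, List.map_append, List.map_map, Function.comp_def, List.map_cons,
      List.sum_append, List.sum_cons, ih, List.map_const', List.sum_replicate, List.length_range,
      nsmul_eq_mul]
    ring

end Pieces

/-! ### The preprocessed instance -/

/-- All point masses of an instance, tagged with their action and configuration. -/
def points (I : Instance) : List ((ℕ × ℕ) × MassPoint (WithBot ℚ)) :=
  I.zipIdx.flatMap fun Ai => Ai.1.zipIdx.flatMap fun Dj => Dj.1.map fun x => ((Ai.2, Dj.2), x)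

theorem val_allPoints (I : Instance) : (allPoints I).val = points I := by
  simp [allPoints, points]

theorem sum_map_flatMap {α β : Type} (l : List α) (f : α → List β) (g : β → ℚ) :
    ((l.flatMap f).map g).sum = (l.map fun a => ((f a).map g).sum).sum := by
  induction l with
  | nil => simp
  | cons a l ih => simp [ih]

theorem sum_zipIdx_ite {α : Type} (l : List α) (m i : ℕ) (f : α → ℚ) {a : α}
    (h : l[i]? = some a) :
    ((l.zipIdx m).map fun b => if b.2 = m + i then f b.1 else 0).sum = f a := by
  induction l generalizing m i with
  | nil => simp at h
  | cons b l ih =>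
    cases i with
    | zero =>
      have hz : ((l.zipIdx (m + 1)).map fun c => if c.2 = m + 0 then f c.1 else 0).sum = 0 := by
        refine List.sum_eq_zero fun c hc => ?_
        obtain ⟨d, hd, rfl⟩ := List.mem_map.1 hc
        have := List.le_snd_of_mem_zipIdx hd
        rw [if_neg (by omega)]
      rw [List.zipIdx_cons, List.map_cons, List.sum_cons, hz]
      simp at h
      simp [h]
    | succ i =>
      rw [List.zipIdx_cons, List.map_cons, List.sum_cons, if_neg (by simp), zero_add]
      have := ih (m + 1) i (by simpa using h)
      rw [show m + 1 + i = m + (i + 1) by ring] at this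
      exact this

theorem sum_points (I : Instance) {i j : ℕ} {A : List Dist} {D : Dist} (hA : I[i]? = some A)
    (hD : A[j]? = some D) (g : MassPoint (WithBot ℚ) → ℚ) :
    ((points I).map fun x => if x.1 = (i, j) then g x.2 else 0).sum = (D.map g).sum := by
  rw [points, sum_map_flatMap]
  have h₁ : ∀ Ai : List Dist × ℕ, ((Ai.1.zipIdx.flatMap fun Dj => Dj.1.map fun x =>
      ((Ai.2, Dj.2), x)).map fun x => if x.1 = (i, j) then g x.2 else 0).sum =
      if Ai.2 = 0 + i then
        (Ai.1.zipIdx.map fun Dj => if Dj.2 = 0 + j then (Dj.1.map g).sum else 0).sum else 0 := by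
    intro Ai
    rw [sum_map_flatMap]
    by_cases h : Ai.2 = i
    · simp only [h, zero_add, if_true, List.map_map, Function.comp_def, Prod.mk.injEq, true_and]
      congr 1
      refine List.map_congr_left fun Dj _ => ?_
      by_cases h' : Dj.2 = j <;> simp [h']
    · simp [h, Function.comp_def]
  simp only [h₁]
  rw [sum_zipIdx_ite I 0 i
    (fun A => (A.zipIdx.map fun Dj => if Dj.2 = 0 + j then (Dj.1.map g).sum else 0).sum) hA,
    sum_zipIdx_ite A 0 j (fun D => (D.map g).sum) hD]

theorem mem_points {I : Instance} {x : (ℕ × ℕ) × MassPoint (WithBot ℚ)} (hx : x ∈ points I) :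
    ∃ A ∈ I, ∃ D ∈ A, x.2 ∈ D := by
  simp only [points, List.mem_flatMap, List.mem_map] at hx
  obtain ⟨Ai, hAi, Dj, hDj, y, hy, rfl⟩ := hx
  exact ⟨Ai.1, List.fst_mem_of_mem_zipIdx hAi, Dj.1, List.fst_mem_of_mem_zipIdx hDj, hy⟩

/-- The replacement of `-∞` is below every finite agent utility. -/
theorem val_bottomT {τ : Type} (L : List (τ × MassPoint (WithBot ℚ)))
    {x : τ × MassPoint (WithBot ℚ)} (hx : x ∈ L) {a : ℚ} (ha : x.2.agent = a) :
    (bottomT L).val < a := by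
  have key : ∀ (L : List (τ × MassPoint (WithBot ℚ))) (b : ℚ),
      (foldT (fun (acc : ℚ) x => match x.2.agent with
        | ⊥ => do
          tick 1
          return acc
        | (a : ℚ) => do
          let b ← ltT a acc
          return if b then a else acc) b L).val ≤ b ∧
      ∀ x ∈ L, ∀ a : ℚ, x.2.agent = a → (foldT (fun (acc : ℚ) x => match x.2.agent with
        | ⊥ => do
          tick 1
          return acc
        | (a : ℚ) => do
          let b ← ltT a acc
          return if b then a else acc) b L).val ≤ a := by
    intro L
    induction L with
    | nil => intro b; simp
    | cons y L ih =>
      intro b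
      rw [val_foldT, List.foldl_cons, ← val_foldT]
      have hstep := ih (match y.2.agent with
        | ⊥ => do
          tick 1
          return b
        | (a : ℚ) => do
          let b' ← ltT a b
          return if b' then a else b : Timed ℚ).val
      rcases y with ⟨t, ⟨ya, yp, yq⟩⟩
      cases ya with
      | bot =>
        refine ⟨hstep.1, fun x hx a ha => ?_⟩
        rcases List.mem_cons.1 hx with rfl | hx
        · simp at ha
        · exact hstep.2 x hx a ha
      | coe c =>
        have hc : (match ((c : WithBot ℚ)) with
          | ⊥ => do
            tick 1
            return b
          | (a : ℚ) => do
            let b' ← ltT a b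
            return if b' then a else b : Timed ℚ).val = min c b := by
          change (if decide (c < b) = true then c else b) = min c b
          rcases lt_or_ge c b with h | h
          · simp [h, h.le]
          · simp [h, not_lt.2 h]
        refine ⟨hstep.1.trans (hc.le.trans (min_le_right _ _)), fun x hx a ha => ?_⟩
        rcases List.mem_cons.1 hx with rfl | hx
        · have : c = a := WithBot.coe_injective ha
          exact hstep.1.trans (hc.le.trans (this ▸ min_le_left _ _))
        · exact hstep.2 x hx a ha
  have h := (key L 0).2 x hx a ha
  simp only [bottomT, val_bind, val_subT]
  exact (sub_one_lt _).trans_le h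

theorem val_minGapT (S : List ℚ) :
    0 < (minGapT S).val ∧ ∀ a ∈ S, ∀ b ∈ S, a < b → (minGapT S).val ≤ b - a := by
  have h₁ : ∀ (a : ℚ) (T : List ℚ) (g : ℚ), 0 < g →
      let r := T.foldl (fun g b => if decide (0 < b - a) && decide (b - a < g) then b - a else g) g
      0 < r ∧ r ≤ g ∧ ∀ b ∈ T, a < b → r ≤ b - a := by
    intro a T
    induction T with
    | nil => intro g hg; simpa using hg
    | cons b T ih =>
      intro g hg
      simp only [List.foldl_cons]
      by_cases hb : 0 < b - a ∧ b - a < g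
      · simp only [hb, decide_true, Bool.and_self, if_true]
        obtain ⟨h₁, h₂, h₃⟩ := ih _ hb.1
        refine ⟨h₁, h₂.trans hb.2.le, fun c hc hac => ?_⟩
        rcases List.mem_cons.1 hc with rfl | hc
        · exact h₂
        · exact h₃ c hc hac
      · have hb' : (decide (0 < b - a) && decide (b - a < g)) = false := by
          simpa using hb
        simp only [hb', Bool.false_eq_true, if_false]
        obtain ⟨h₁, h₂, h₃⟩ := ih _ hg
        refine ⟨h₁, h₂, fun c hc hac => ?_⟩
        rcases List.mem_cons.1 hc with rfl | hc
        · exact h₂.trans (not_lt.1 fun h => hb ⟨by linarith, h⟩)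
        · exact h₃ c hc hac
  have h₂ : ∀ (T : List ℚ) (g : ℚ), 0 < g →
      let r := T.foldl (fun g a => S.foldl
        (fun g b => if decide (0 < b - a) && decide (b - a < g) then b - a else g) g) g
      0 < r ∧ r ≤ g ∧ ∀ a ∈ T, ∀ b ∈ S, a < b → r ≤ b - a := by
    intro T
    induction T with
    | nil => intro g hg; simpa using hg
    | cons a T ih =>
      intro g hg
      simp only [List.foldl_cons]
      obtain ⟨h₁, h₂, h₃⟩ := h₁ a S g hg
      obtain ⟨k₁, k₂, k₃⟩ := ih _ h₁
      refine ⟨k₁, k₂.trans h₂, fun c hc b hb hcb => ?_⟩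
      rcases List.mem_cons.1 hc with rfl | hc
      · exact k₂.trans (h₃ b hb hcb)
      · exact k₃ c hc b hb hcb
  obtain ⟨k₁, -, k₃⟩ := h₂ S 1 one_pos
  simp only [minGapT, val_foldT, val_bind, val_subT, val_ltT, val_pure]
  exact ⟨k₁, k₃⟩

/-- `F` is a refinement of the distribution `D`: the label `β` recovers the original agent utility of
each of its pieces, the pieces of each point mass add up to it, and no agent utility has a probability
above `1 / M²`. -/
structure Refines (M : ℕ) (β : ℚ → WithBot ℚ) (D : Dist) (F : FDist) : Prop where
  mean_eq : ∀ g : WithBot ℚ → ℚ → ℚ,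
    mean D (fun x => g x.agent x.principal) = mean F fun y => g (β y.agent) y.principal
  nonneg : F.Nonneg
  mass_le : ∀ s, mass (· = s) F ≤ 1 / (M : ℚ) ^ 2

/-- All distributions of `J` refine those of `I` in such a way that strict preferences are respected,
ties are broken in favor of the principal, and no two actions share an agent utility. -/
structure IsRefinement (M : ℕ) (β : ℚ → WithBot ℚ) (I : Instance) (J : List (List FDist)) :
    Prop where
  refines : List.Forall₂ (List.Forall₂ (Refines M β)) I J
  mono : Monotone β
  ties : ∀ A ∈ J, ∀ D ∈ A, ∀ x ∈ D, ∀ A' ∈ J, ∀ D' ∈ A', ∀ y ∈ D',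
    x.agent < y.agent → β x.agent = β y.agent → x.principal ≤ y.principal
  apart : J.Pairwise fun A A' => ∀ D ∈ A, ∀ D' ∈ A', Apart D D'

theorem foldr_max_le {α : Type} [LinearOrder α] (l : List α) (c b : α) :
    l.foldr max c ≤ b ↔ c ≤ b ∧ ∀ a ∈ l, a ≤ b := by
  induction l with
  | nil => simp
  | cons a l ih => simp [ih]; tauto

theorem Dist.Valid.prob_le_one {D : Dist} (hD : D.Valid) {x : MassPoint (WithBot ℚ)} (hx : x ∈ D) :
    x.prob ≤ 1 := by
  rw [← hD.2]
  refine List.single_le_sum (fun p hp => ?_) _ (List.mem_map_of_mem hx)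
  obtain ⟨y, hy, rfl⟩ := List.mem_map.1 hp
  exact (hD.1 y hy).1.le

theorem eq_or_of_pairwise {α : Type} {R : α → α → Prop} {l : List α} (h : l.Pairwise R) {a b : α}
    (ha : a ∈ l) (hb : b ∈ l) : a = b ∨ R a b ∨ R b a := by
  induction l with
  | nil => simp at ha
  | cons c l ih =>
    rw [List.pairwise_cons] at h
    rcases List.mem_cons.1 ha with ha | ha <;> rcases List.mem_cons.1 hb with hb | hb
    · exact .inl (ha.trans hb.symm)
    · exact .inr (.inl (ha ▸ h.1 _ hb))
    · exact .inr (.inr (hb ▸ h.1 _ ha))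
    · exact ih h.2 ha hb

theorem forall₂_zipIdx_map {α β : Type} {R : α → β → Prop} (l : List α) (f : α × ℕ → β)
    (h : ∀ (i : ℕ) (a : α), l[i]? = some a → R a (f (a, i))) :
    List.Forall₂ R l (l.zipIdx.map f) := by
  refine List.forall₂_iff_get.2 ⟨by simp, fun i h₁ h₂ => ?_⟩
  simpa using h i l[i] (List.getElem?_eq_getElem h₁)

/-- If the agent utilities are distinct, then an atom is a single point mass. -/
theorem mass_eq_le {D : FDist} {c : ℚ} (hc : 0 ≤ c) (h : ∀ x ∈ D, x.prob ≤ c)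
    (hD : D.Pairwise fun x y => x.agent ≠ y.agent) (s : ℚ) : mass (· = s) D ≤ c := by
  induction D with
  | nil => simpa [mass] using hc
  | cons x D ih =>
    rw [List.pairwise_cons] at hD
    rw [mass, mean_cons]
    by_cases hx : x.agent = s
    · have h₀ : mean D (fun y => if y.agent = s then (1 : ℚ) else 0) = 0 :=
        (mean_congr fun y hy => if_neg fun hy' : y.agent = s =>
          hD.1 y hy (hx.trans hy'.symm)).trans (mean_zero D)
      rw [h₀]
      simpa [hx] using h x (by simp)
    · simpa [hx, mass] using ih (fun y hy => h y (List.mem_cons_of_mem _ hy)) hD.2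

/-- Sorting pieces by their tags yields a refinement, if the pieces are small, have distinct agent
utilities that respect the tie-breaking, and carry the masses of the original instance under a
monotone labelling `β` with original agent utilities. -/
theorem isRefinement_of_pieces {M : ℕ} {β : ℚ → WithBot ℚ} {I : Instance}
    {out : List ((ℕ × ℕ) × MassPoint ℚ)} (hβ : Monotone β)
    (hprob : ∀ e ∈ out, 0 ≤ e.2.prob ∧ e.2.prob ≤ 1 / (M : ℚ) ^ 2)
    (hprin : ∀ e ∈ out, 0 ≤ e.2.principal)
    (hne : out.Pairwise fun e f => e.2.agent ≠ f.2.agent)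
    (hties : out.Pairwise fun e f => β e.2.agent = β f.2.agent →
      e.2.agent < f.2.agent ∧ e.2.principal ≤ f.2.principal)
    (hsum : ∀ g : ℕ × ℕ → WithBot ℚ → ℚ → ℚ,
      (out.map fun e => e.2.prob * g e.1 (β e.2.agent) e.2.principal).sum =
        ((points I).map fun x => x.2.prob * g x.1 x.2.agent x.2.principal).sum) :
    IsRefinement M β I (I.zipIdx.map fun Ai => Ai.1.zipIdx.map fun Dj =>
      (out.filter fun y => decide (y.1.1 = Ai.2) && decide (y.1.2 = Dj.2)).map fun y => y.2) := by
  have hmem : ∀ A ∈ (I.zipIdx.map fun Ai => Ai.1.zipIdx.map fun Dj =>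
      (out.filter fun y => decide (y.1.1 = Ai.2) && decide (y.1.2 = Dj.2)).map fun y => y.2),
      ∀ D ∈ A, ∀ x ∈ D, ∃ e ∈ out, e.2 = x := by
    intro A hA D hD x hx
    obtain ⟨Ai, -, rfl⟩ := List.mem_map.1 hA
    obtain ⟨Dj, -, rfl⟩ := List.mem_map.1 hD
    obtain ⟨e, he, rfl⟩ := List.mem_map.1 hx
    exact ⟨e, (List.mem_filter.1 he).1, rfl⟩
  refine ⟨?_, hβ, ?_, ?_⟩
  · refine forall₂_zipIdx_map I _ fun i A hA => forall₂_zipIdx_map A _ fun j D hD => ⟨?_, ?_, ?_⟩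
    · intro g
      have h := hsum fun t a u => if t = (i, j) then g a u else 0
      simp only [mul_ite, mul_zero] at h
      rw [sum_points I hA hD fun x => x.prob * g x.agent x.principal] at h
      rw [mean, ← h, mean, List.map_map, ← sum_filter_map]
      congr 2
      refine List.filter_congr fun y _ => ?_
      simp [Prod.ext_iff]
    · intro x hx
      obtain ⟨e, he, rfl⟩ := List.mem_map.1 hx
      have he' := (List.mem_filter.1 he).1
      exact ⟨(hprob e he').1, hprin e he'⟩
    · refine mass_eq_le (by positivity) (fun x hx => ?_) ?_
      · obtain ⟨e, he, rfl⟩ := List.mem_map.1 hx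
        exact (hprob e (List.mem_filter.1 he).1).2
      · exact List.pairwise_map.2 (hne.filter _)
  · intro A hA D hD x hx A' hA' D' hD' y hy
    obtain ⟨e, he, rfl⟩ := hmem A hA D hD x hx
    obtain ⟨f, hf, rfl⟩ := hmem A' hA' D' hD' y hy
    intro hlt hβ
    rcases eq_or_of_pairwise hties he hf with rfl | h | h
    · exact absurd hlt (lt_irrefl _)
    · exact (h hβ).2
    · exact absurd (h hβ.symm).1 hlt.asymm
  · rw [List.pairwise_map]
    refine (List.pairwise_iff_getElem.2 fun i i' hi hi' hlt => ?_)
    intro D hD D' hD' x hx y hy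
    simp only [List.getElem_zipIdx, zero_add] at hD hD'
    obtain ⟨Dj, -, rfl⟩ := List.mem_map.1 hD
    obtain ⟨Dj', -, rfl⟩ := List.mem_map.1 hD'
    obtain ⟨e, he, rfl⟩ := List.mem_map.1 hx
    obtain ⟨f, hf, rfl⟩ := List.mem_map.1 hy
    simp only [List.mem_filter, Bool.and_eq_true, decide_eq_true_eq] at he hf
    rcases eq_or_of_pairwise hne he.1 hf.1 with rfl | h | h
    · have := he.2.1.symm.trans hf.2.1
      omega
    · exact h
    · exact h.symm

/-- Preprocessing yields a refinement: the perturbations `δ r` stay below the least gap between two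
distinct agent utilities, and they increase with the principal utility. -/
theorem exists_isRefinement {M : ℕ} (hM : 1 ≤ M) {I : Instance} (hI : I.Valid) :
    ∃ β, IsRefinement M β I (preprocess M I).val := by
  have hvalid : ∀ x ∈ points I, 0 < x.2.prob ∧ x.2.prob ≤ 1 ∧ 0 ≤ x.2.principal := by
    intro x hx
    obtain ⟨A, hA, D, hD, hx⟩ := mem_points hx
    have hD := (hI.2 A hA).2 D hD
    exact ⟨(hD.1 _ hx).1, hD.prob_le_one hx, (hD.1 _ hx).2⟩
  obtain ⟨bot, hbot⟩ : ∃ bot, (bottomT (points I)).val = bot := ⟨_, rfl⟩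
  have hbot' : ∀ x ∈ points I, ∀ a : ℚ, x.2.agent = a → bot < a := fun x hx a ha =>
    hbot ▸ val_bottomT _ hx ha
  set fin : (ℕ × ℕ) × MassPoint (WithBot ℚ) → (ℕ × ℕ) × MassPoint ℚ := fun x =>
    (x.1, ⟨x.2.agent.unbotD bot, x.2.principal, x.2.prob⟩) with hfin
  obtain ⟨L, hL⟩ : ∃ L, (sortT ((points I).map fin)).val = L := ⟨_, rfl⟩
  have hperm : L.Perm ((points I).map fin) := hL ▸ sortT_perm _
  have hsorted := hL ▸ sortT_sorted ((points I).map fin)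
  obtain ⟨gap, hgap⟩ : ∃ gap, (minGapT (L.map fun x : (ℕ × ℕ) × MassPoint ℚ => x.2.agent)).val = gap := ⟨_, rfl⟩
  obtain ⟨hgap₀, hgap'⟩ := val_minGapT (L.map fun x : (ℕ × ℕ) × MassPoint ℚ => x.2.agent)
  rw [hgap] at hgap₀ hgap'
  obtain ⟨δ, hδ⟩ : ∃ δ : ℚ, gap / ((L.length * (M ^ 2 + 1) : ℕ) : ℚ) = δ := ⟨_, rfl⟩
  -- the label of an agent utility: the largest original utility below it
  set β : ℚ → WithBot ℚ := fun t =>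
    (((points I).map fun x => x.2.agent).filter fun w => decide (w.unbotD bot ≤ t)).foldr max ⊥
    with hβ
  set out := (piecesFrom M 0 L).map (perturbed δ) with hout
  have hval : (preprocess M I).val = I.zipIdx.map fun Ai => Ai.1.zipIdx.map fun Dj =>
      (out.filter fun y => decide (y.1.1 = Ai.2) && decide (y.1.2 = Dj.2)).map fun y => y.2 := by
    have h := val_splitPoints M δ L 0 []
    rw [List.nil_append] at h
    simp only [preprocess, val_bind, val_mapT, val_enumerateT, val_filterT, val_natEqT, val_pure,
      val_foldT, val_allPoints, hbot, val_divT, val_natMulT, val_lengthT, val_appendT]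
    rw [show (sortT ((points I).map fun x => (x.1, (⟨x.2.agent.unbotD bot, x.2.principal,
      x.2.prob⟩ : MassPoint ℚ)))).val = L from hL, hgap, hδ, h]
  have hmono : Monotone β := by
    intro s t hst
    simp only [hβ]
    rw [foldr_max_le]
    refine ⟨bot_le, fun w hw => ?_⟩
    rw [List.mem_filter, decide_eq_true_eq] at hw
    exact ((foldr_max_le _ _ _).1 le_rfl).2 w
      (List.mem_filter.2 ⟨hw.1, decide_eq_true (hw.2.trans hst)⟩)
  have hmemL : ∀ y ∈ L, ∃ x ∈ points I, fin x = y := fun y hy =>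
    List.mem_map.1 (hperm.mem_iff.1 hy)
  have hstrict : ∀ x ∈ points I, ∀ y ∈ points I,
      x.2.agent < y.2.agent → x.2.agent.unbotD bot < y.2.agent.unbotD bot := by
    intro x hx y hy hlt
    have h₁ := hbot' y hy
    cases hx' : x.2.agent with
    | bot =>
      cases hy' : y.2.agent with
      | bot => rw [hx', hy'] at hlt; exact absurd hlt (lt_irrefl _)
      | coe b => simpa using h₁ b hy'
    | coe a =>
      cases hy' : y.2.agent with
      | bot => rw [hx', hy'] at hlt; exact absurd hlt (not_lt_bot)
      | coe b => rw [hx', hy'] at hlt; simpa using hlt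
  have hinj : ∀ x ∈ points I, ∀ y ∈ points I,
      x.2.agent.unbotD bot ≤ y.2.agent.unbotD bot → x.2.agent ≤ y.2.agent := fun x hx y hy h =>
    not_lt.1 fun hlt => (hstrict y hy x hx hlt).not_ge h
  have hgap'' : ∀ x ∈ points I, ∀ y ∈ points I,
      x.2.agent.unbotD bot < y.2.agent.unbotD bot →
      gap ≤ y.2.agent.unbotD bot - x.2.agent.unbotD bot := by
    intro x hx y hy hlt
    have hm : ∀ x ∈ points I, x.2.agent.unbotD bot ∈ L.map fun x => x.2.agent := fun x hx =>
      List.mem_map.2 ⟨fin x, hperm.mem_iff.2 (List.mem_map_of_mem hx), rfl⟩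
    exact hgap' _ (hm x hx) _ (hm y hy) hlt
  have hprob1 : ∀ y ∈ L, y.2.prob ≤ 1 := fun y hy => by
    obtain ⟨x, hx, rfl⟩ := hmemL y hy
    exact (hvalid x hx).2.1
  have hprob0 : ∀ y ∈ L, 0 ≤ y.2.prob := fun y hy => by
    obtain ⟨x, hx, rfl⟩ := hmemL y hy
    exact (hvalid x hx).1.le
  have hshift : ∀ e ∈ piecesFrom M 0 L, 0 < δ ∧ δ * (e.2.1 : ℚ) < gap := by
    intro e he
    have h := lt_of_mem_piecesFrom hM hprob1 he
    rw [zero_add] at h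
    have hpos : (0 : ℚ) < ((L.length * (M ^ 2 + 1) : ℕ) : ℚ) := by exact_mod_cast (by omega)
    have hδ₀ : 0 < δ := hδ ▸ div_pos hgap₀ hpos
    refine ⟨hδ₀, ?_⟩
    calc δ * (e.2.1 : ℚ) < δ * ((L.length * (M ^ 2 + 1) : ℕ) : ℚ) :=
          mul_lt_mul_of_pos_left (by exact_mod_cast h) hδ₀
      _ = gap := by rw [← hδ, div_mul_cancel₀ _ hpos.ne']
  have hlabel : ∀ e ∈ piecesFrom M 0 L, ∀ x ∈ points I, fin x = e.1 →
      β (perturbed δ e).2.agent = x.2.agent := by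
    intro e he x hx hxe
    obtain ⟨h₁, h₂⟩ := hshift e he
    have h₃ : 0 ≤ δ * (e.2.1 : ℚ) := by positivity
    have hag : (perturbed δ e).2.agent = x.2.agent.unbotD bot + δ * (e.2.1 : ℚ) := by
      simp [perturbed, ← hxe, hfin]
    rw [hag]
    refine le_antisymm ?_ ?_
    · simp only [hβ]
      rw [foldr_max_le]
      refine ⟨bot_le, fun w hw => ?_⟩
      rw [List.mem_filter, decide_eq_true_eq, List.mem_map] at hw
      obtain ⟨⟨y, hy, rfl⟩, hle⟩ := hw
      refine hinj y hy x hx (not_lt.1 fun hlt => ?_)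
      have := hgap'' x hx y hy hlt
      linarith
    · exact ((foldr_max_le _ _ _).1 le_rfl).2 _ (List.mem_filter.2
        ⟨List.mem_map_of_mem (f := fun x : (ℕ × ℕ) × MassPoint (WithBot ℚ) => x.2.agent) hx,
          decide_eq_true (by linarith)⟩)
  have hpieces := piecesFrom_pairwise (M := M) (l := 0) hsorted
  have hsources := fun e (he : e ∈ piecesFrom M 0 L) => hmemL e.1 (le_of_mem_piecesFrom he).1
  refine ⟨β, hval ▸ isRefinement_of_pieces hmono ?_ ?_ ?_ ?_ ?_⟩
  · intro e he
    obtain ⟨f, hf, rfl⟩ := List.mem_map.1 he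
    exact prob_of_mem_piecesFrom hM hprob0 hf
  · intro e he
    obtain ⟨f, hf, rfl⟩ := List.mem_map.1 he
    obtain ⟨x, hx, hxe⟩ := hsources f hf
    simpa [perturbed, ← hxe] using (hvalid x hx).2.2
  · rw [hout, List.pairwise_map]
    refine hpieces.imp_of_mem fun {e f} he hf hef => ?_
    obtain ⟨x, hx, hxe⟩ := hsources e he
    obtain ⟨y, hy, hyf⟩ := hsources f hf
    obtain ⟨h₁, h₂⟩ := hshift e he
    obtain ⟨-, h₃⟩ := hshift f hf
    have h₄ : δ * (e.2.1 : ℚ) < δ * (f.2.1 : ℚ) :=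
      mul_lt_mul_of_pos_left (by exact_mod_cast hef.1) h₁
    have h₅ : 0 ≤ δ * (e.2.1 : ℚ) := by positivity
    simp only [perturbed, ← hxe, ← hyf, hfin]
    intro heq
    rcases lt_trichotomy (x.2.agent.unbotD bot) (y.2.agent.unbotD bot) with h | h | h
    · have := hgap'' x hx y hy h
      linarith
    · linarith
    · have := hgap'' y hy x hx h
      linarith
  · rw [hout, List.pairwise_map]
    refine hpieces.imp_of_mem fun {e f} he hf hef hlab => ?_
    obtain ⟨x, hx, hxe⟩ := hsources e he
    obtain ⟨y, hy, hyf⟩ := hsources f hf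
    rw [hlabel e he x hx hxe, hlabel f hf y hy hyf] at hlab
    refine ⟨?_, hef.2⟩
    have h₄ : δ * (e.2.1 : ℚ) < δ * (f.2.1 : ℚ) :=
      mul_lt_mul_of_pos_left (by exact_mod_cast hef.1) (hshift e he).1
    simpa [perturbed, ← hxe, ← hyf, hfin, hlab] using h₄
  · intro g
    have h₁ : ∀ e ∈ piecesFrom M 0 L,
        (perturbed δ e).2.prob * g (perturbed δ e).1 (β (perturbed δ e).2.agent)
          (perturbed δ e).2.principal =
        e.2.2 * g e.1.1 (β e.1.2.agent) e.1.2.principal := by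
      intro e he
      obtain ⟨x, hx, hxe⟩ := hsources e he
      have h₀ : β e.1.2.agent = x.2.agent := by
        have h₂ := hshift e he
        refine le_antisymm ?_ ?_
        · rw [← hlabel e he x hx hxe]
          refine hmono ?_
          simp only [perturbed]
          have : 0 ≤ δ * (e.2.1 : ℚ) := mul_nonneg h₂.1.le (Nat.cast_nonneg _)
          linarith
        · exact ((foldr_max_le _ _ _).1 le_rfl).2 _ (List.mem_filter.2
            ⟨List.mem_map_of_mem (f := fun x : (ℕ × ℕ) × MassPoint (WithBot ℚ) => x.2.agent) hx,
              decide_eq_true (by simp [← hxe, hfin])⟩)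
      rw [hlabel e he x hx hxe, h₀]
      rfl
    have h₂ : ∀ x ∈ points I, β (fin x).2.agent = x.2.agent := by
      intro x hx
      refine le_antisymm ?_ ?_
      · simp only [hβ]
        rw [foldr_max_le]
        refine ⟨bot_le, fun w hw => ?_⟩
        rw [List.mem_filter, decide_eq_true_eq, List.mem_map] at hw
        obtain ⟨⟨y, hy, rfl⟩, hle⟩ := hw
        exact hinj y hy x hx hle
      · exact ((foldr_max_le _ _ _).1 le_rfl).2 _ (List.mem_filter.2
          ⟨List.mem_map_of_mem (f := fun x : (ℕ × ℕ) × MassPoint (WithBot ℚ) => x.2.agent) hx,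
            decide_eq_true le_rfl⟩)
    rw [hout, List.map_map]
    have h₃ := List.map_congr_left h₁
    simp only [Function.comp_def]
    rw [h₃, sum_piecesFrom L 0 fun x => g x.1 (β x.2.agent) x.2.principal,
      (hperm.map _).sum_eq, List.map_map]
    congr 1
    refine List.map_congr_left fun x hx => ?_
    simp only [Function.comp_def, h₂ x hx]
    rfl

/-! ### From joint outcomes to the favorite action -/

/-- The expectation of a function of `(u^A, u^P)` over the joint outcomes of independent actions. -/
def expectation (L : List Dist) (h : WithBot ℚ → ℚ → ℚ) : ℚ :=
  (L.sections.map fun ω => outcomeProb ω * h (agentUtility ω) (principalUtility ω)).sum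

theorem agentUtility_cons (x : MassPoint (WithBot ℚ)) (ω : List (MassPoint (WithBot ℚ))) :
    agentUtility (x :: ω) = max x.agent (agentUtility ω) := rfl

theorem le_agentUtility {x : MassPoint (WithBot ℚ)} {ω : List (MassPoint (WithBot ℚ))}
    (hx : x ∈ ω) : x.agent ≤ agentUtility ω :=
  ((foldr_max_le _ _ _).1 le_rfl).2 _ (List.mem_map_of_mem hx)

/-- The utility from the favorite action after one more action is added. The seed `0` of the maximum
appears where the new action is strictly better. -/
theorem principalUtility_cons (x : MassPoint (WithBot ℚ)) (ω : List (MassPoint (WithBot ℚ))) :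
    principalUtility (x :: ω) =
      if agentUtility ω < x.agent then max x.principal 0
      else if x.agent < agentUtility ω then principalUtility ω
      else max x.principal (principalUtility ω) := by
  rw [principalUtility, agentUtility_cons]
  rcases lt_trichotomy (agentUtility ω) x.agent with h | h | h
  · have hf : (ω.filter fun y => decide (y.agent = x.agent)) = [] := by
      refine List.filter_eq_nil_iff.2 fun y hy => ?_
      simpa using ((le_agentUtility hy).trans_lt h).ne
    simp [h, max_eq_left h.le, hf]
  · simp [h, principalUtility]
  · simp [h, not_lt_of_gt h, max_eq_right h.le, h.ne, principalUtility]

theorem expectation_cons (D : Dist) (L : List Dist) (h : WithBot ℚ → ℚ → ℚ) :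
    expectation (D :: L) h = expectation L fun a u => mean D fun x =>
      h (max x.agent a) (if a < x.agent then max x.principal 0
        else if x.agent < a then u else max x.principal u) := by
  rw [expectation, List.sections]
  rw [sum_map_flatMap, expectation]
  congr 1
  refine List.map_congr_left fun ω _ => ?_
  rw [mean, ← List.sum_map_mul_left, List.map_map]
  congr 1
  refine List.map_congr_left fun x _ => ?_
  simp only [Function.comp, agentUtility_cons, principalUtility_cons]
  simp only [outcomeProb, List.map_cons, List.prod_cons]
  ring

/-- The favorite action of a refinement, where no ties occur, has the utilities of the favorite action
of the original instance, where ties are broken in favor of the principal. -/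
theorem expectation_eq_mean_best {M : ℕ} {β : ℚ → WithBot ℚ} (hβ : Monotone β) {L : List Dist}
    {L' : List FDist} (hL : List.Forall₂ (Refines M β) L L') (hne : L ≠ [])
    (hN : ∀ D ∈ L, ∀ x ∈ D, 0 ≤ x.principal) (hA : L'.Pairwise Apart)
    (hT : ∀ D ∈ L', ∀ x ∈ D, ∀ D' ∈ L', ∀ y ∈ D',
      x.agent < y.agent → β x.agent = β y.agent → x.principal ≤ y.principal)
    (h : WithBot ℚ → ℚ → ℚ) :
    expectation L h = mean (best L') fun z => h (β z.agent) z.principal := by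
  induction hL generalizing h with
  | nil => exact absurd rfl hne
  | @cons D F L L' hD hL ih =>
    rw [expectation_cons]
    cases hL with
    | nil =>
      simp only [expectation, List.sections, agentUtility, principalUtility, outcomeProb, best]
      rw [← hD.mean_eq]
      simp only [List.map_cons, List.map_nil, List.prod_nil, List.sum_cons, List.sum_nil, one_mul,
        add_zero, List.foldr_nil, List.filter_nil]
      refine mean_congr fun x hx => ?_
      have := hN D (by simp) x hx
      by_cases hb : x.agent = ⊥
      · simp [hb, this]
      · simp [bot_lt_iff_ne_bot.2 hb, this]
    | @cons E G L L' hE hL =>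
      rw [List.pairwise_cons] at hA
      rw [ih (by simp) (fun D hD => hN D (List.mem_cons_of_mem _ hD)) hA.2
        fun D hD x hx D' hD' => hT D (List.mem_cons_of_mem _ hD) x hx D' (List.mem_cons_of_mem _ hD')]
      change _ = mean (better F (best (G :: L'))) _
      rw [mean_better (apart_best hA.1) fun a u => h (β a) u, mean_comm F]
      refine mean_congr fun z hz => ?_
      rw [hD.mean_eq fun b v => h (max b (β z.agent)) (if β z.agent < b then max v 0
        else if b < β z.agent then z.principal else max v z.principal)]
      refine mean_congr fun x hx => ?_
      obtain ⟨D', hD', z', hz', h₁, h₂⟩ := mem_best hz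
      have hx₀ := (hD.nonneg x hx).2
      rcases lt_or_gt_of_ne (apart_best hA.1 x hx z hz) with hlt | hlt
      · rw [if_neg hlt.asymm]
        have hle := hβ hlt.le
        rw [max_eq_right hle]
        congr 1
        rcases hle.lt_or_eq with hlt' | heq
        · simp [hlt', hlt'.asymm]
        · have := hT F (by simp) x hx D' (List.mem_cons_of_mem _ hD') z' hz'
          rw [h₁, h₂] at this
          simp [heq, this hlt heq]
      · rw [if_pos hlt]
        have hle := hβ hlt.le
        rw [max_eq_left hle]
        congr 1
        rcases hle.lt_or_eq with hlt' | heq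
        · simp [hlt', hx₀]
        · have := hT D' (List.mem_cons_of_mem _ hD') z' hz' F (by simp) x hx
          rw [h₁, h₂] at this
          simp [heq, this hlt heq]

/-- The preprocessed distributions, one for each action, that the configuration `C` picks. -/
def picked (J : List (List FDist)) (C : List ℕ) : List FDist :=
  List.zipWith (fun A c => A.getD c []) J C

/-- Independent distributions of nonnegative utilities without ties and without large masses. -/
structure Regular (M : ℕ) (L : List FDist) : Prop where
  ne_nil : L ≠ []
  nonneg : ∀ D ∈ L, D.Nonneg
  total : ∀ D ∈ L, mass (fun _ => True) D = 1
  apart : L.Pairwise Apart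
  mass_le : ∀ D ∈ L, ∀ s, mass (· = s) D ≤ 1 / (M : ℚ) ^ 2

theorem chosen_valid {I : Instance} (hI : I.Valid) {C : List ℕ} (hC : IsConfiguration I C) :
    chosen I C ≠ [] ∧ ∀ D ∈ chosen I C, D.Valid := by
  constructor
  · have h₁ := List.Forall₂.length_eq hC
    have h₂ := List.length_pos_iff.2 hI.1
    rw [← List.length_pos_iff, chosen, List.length_zipWith]
    omega
  · replace hI := hI.2
    induction hC with
    | nil => simp [chosen]
    | @cons A c I C hc hC ih =>
      intro D hD
      rw [chosen, List.zipWith_cons_cons, List.mem_cons] at hD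
      rcases hD with rfl | hD
      · rw [List.getD_eq_getElem _ _ hc]
        exact (hI A (by simp)).2 _ (List.getElem_mem hc)
      · exact ih (fun A hA => hI A (List.mem_cons_of_mem _ hA)) D hD

section Refinement

variable {M : ℕ} {β : ℚ → WithBot ℚ} {I : Instance} {J : List (List FDist)} {C : List ℕ}

theorem mem_picked (hC : List.Forall₂ (fun (A : List FDist) (c : ℕ) => c < A.length) J C)
    {D : FDist} (hD : D ∈ picked J C) : ∃ A ∈ J, D ∈ A := by
  induction hC with
  | nil => simp [picked] at hD
  | @cons A c J C hc hC ih =>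
    rw [picked, List.zipWith_cons_cons, List.mem_cons] at hD
    rcases hD with rfl | hD
    · rw [List.getD_eq_getElem _ _ hc]
      exact ⟨A, by simp, List.getElem_mem hc⟩
    · obtain ⟨A, hA, hD⟩ := ih hD
      exact ⟨A, List.mem_cons_of_mem _ hA, hD⟩

theorem picked_apart (hJ : J.Pairwise fun A A' => ∀ D ∈ A, ∀ D' ∈ A', Apart D D')
    (hC : List.Forall₂ (fun (A : List FDist) (c : ℕ) => c < A.length) J C) :
    (picked J C).Pairwise Apart := by
  induction hC with
  | nil => simp [picked]
  | @cons A c J C hc hC ih =>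
    rw [List.pairwise_cons] at hJ
    rw [picked, List.zipWith_cons_cons, List.pairwise_cons, List.getD_eq_getElem _ _ hc]
    refine ⟨fun D hD => ?_, ih hJ.2⟩
    obtain ⟨A', hA', hD⟩ := mem_picked hC hD
    exact hJ.1 A' hA' _ (List.getElem_mem hc) _ hD

theorem IsRefinement.isConfiguration_iff (h : IsRefinement M β I J) :
    IsConfiguration I C ↔
      List.Forall₂ (fun (A : List FDist) (c : ℕ) => c < A.length) J C := by
  replace h := h.refines
  induction h generalizing C with
  | nil => simp [IsConfiguration]
  | @cons A B I J hAB h ih =>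
    cases C with
    | nil => simp [IsConfiguration]
    | cons c C => simpa [IsConfiguration, hAB.length_eq] using fun _ => ih

theorem IsRefinement.refines_picked (h : IsRefinement M β I J) (hC : IsConfiguration I C) :
    List.Forall₂ (Refines M β) (chosen I C) (picked J C) := by
  replace h := h.refines
  induction h generalizing C with
  | nil => cases hC; simp [chosen, picked]
  | @cons A B I J hAB h ih =>
    cases hC with
    | @cons _ c _ C hc hC =>
      rw [chosen, List.zipWith_cons_cons, picked, List.zipWith_cons_cons]
      refine List.Forall₂.cons ?_ (ih hC)
      rw [List.getD_eq_getElem _ _ hc, List.getD_eq_getElem _ _ (hAB.length_eq ▸ hc)]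
      exact hAB.get hc (hAB.length_eq ▸ hc)

theorem IsRefinement.regular (h : IsRefinement M β I J) (hI : I.Valid) (hC : IsConfiguration I C) :
    Regular M (picked J C) := by
  have hR := h.refines_picked hC
  obtain ⟨h₁, h₂⟩ := chosen_valid hI hC
  have key : ∀ F ∈ picked J C, ∃ D ∈ chosen I C, Refines M β D F := by
    intro F hF
    obtain ⟨i, hi, rfl⟩ := List.getElem_of_mem hF
    have hi' : i < (chosen I C).length := hR.length_eq ▸ hi
    exact ⟨_, List.getElem_mem hi', hR.get hi' hi⟩
  refine ⟨fun h₀ => ?_, fun F hF => ?_, fun F hF => ?_,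
    picked_apart h.apart (h.isConfiguration_iff.1 hC), fun F hF => ?_⟩
  · rw [h₀] at hR
    exact h₁ (List.forall₂_nil_right_iff.1 hR)
  all_goals obtain ⟨D, hD, hDF⟩ := key F hF
  · exact hDF.nonneg
  · have h₃ := hDF.mean_eq fun _ _ => 1
    rw [← (h₂ D hD).2]
    simpa [mass, mean] using h₃.symm
  · exact hDF.mass_le

theorem IsRefinement.expectation_eq (h : IsRefinement M β I J) (hI : I.Valid)
    (hC : IsConfiguration I C) (g : WithBot ℚ → ℚ → ℚ) :
    expectation (chosen I C) g =
      mean (best (picked J C)) fun z => g (β z.agent) z.principal := by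
  obtain ⟨h₁, h₂⟩ := chosen_valid hI hC
  have hC' := h.isConfiguration_iff.1 hC
  refine expectation_eq_mean_best h.mono (h.refines_picked hC) h₁
    (fun D hD x hx => ((h₂ D hD).1 x hx).2) (picked_apart h.apart hC') ?_ g
  intro D hD x hx D' hD' y hy
  obtain ⟨A, hA, hD⟩ := mem_picked hC' hD
  obtain ⟨A', hA', hD'⟩ := mem_picked hC' hD'
  exact h.ties A hA D hD x hx A' hA' D' hD' y hy

theorem IsRefinement.expectedUtility_eq (h : IsRefinement M β I J) (hI : I.Valid)
    (hC : IsConfiguration I C) :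
    expectedUtility I C = mean (best (picked J C)) fun z => z.principal :=
  h.expectation_eq hI hC fun _ u => u

theorem val_favorite (hC : List.Forall₂ (fun (A : List FDist) (c : ℕ) => c < A.length) J C) :
    (favorite J C).val = best (picked J C) := by
  induction hC with
  | nil => rfl
  | @cons A c J C hc hC ih =>
    cases hC with
    | nil => rfl
    | @cons A' c' J C hc' hC =>
      simp only [favorite, val_bind, val_getT, val_combine, ih]
      rfl

theorem val_evaluate (hC : List.Forall₂ (fun (A : List FDist) (c : ℕ) => c < A.length) J C) :
    (evaluate J C).val = mean (best (picked J C)) fun z => z.principal := by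
  simp [evaluate, val_favorite hC, mean]

/-- Alignment survives the perturbation of the agent utilities: below a threshold that separates the
pieces of one original agent utility lie those with the lowest principal utilities. -/
theorem IsRefinement.share_le_of_aligned (h : IsRefinement M β I J) (hI : I.Valid)
    (hC : IsConfiguration I C)
    (hal : ∀ U : WithBot ℚ, 0 < probAgentLE I C U →
      condUtilityLE I C U ≤ 2 * expectedUtility I C) (t : ℚ) :
    mean (best (picked J C)) (fun z => if z.agent < t then z.principal else 0) ≤
      2 * expectedUtility I C * mass (· < t) (best (picked J C)) := by
  have hreg := h.regular hI hC
  have hN := best_nonneg hreg.nonneg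
  have hties : ∀ x ∈ best (picked J C), ∀ y ∈ best (picked J C),
      x.agent < y.agent → β x.agent = β y.agent → x.principal ≤ y.principal := by
    intro x hx y hy
    have hC' := h.isConfiguration_iff.1 hC
    obtain ⟨D, hD, x', hx', h₁, h₂⟩ := mem_best hx
    obtain ⟨E, hE, y', hy', h₃, h₄⟩ := mem_best hy
    obtain ⟨A, hA, hD⟩ := mem_picked hC' hD
    obtain ⟨B, hB, hE⟩ := mem_picked hC' hE
    rw [← h₁, ← h₂, ← h₃, ← h₄]
    exact h.ties A hA D hD x' hx' B hB E hE y' hy'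
  obtain ⟨K, hK⟩ : ∃ K, 2 * expectedUtility I C = K := ⟨_, rfl⟩
  have hK₀ : 0 ≤ K := by
    rw [← hK, h.expectedUtility_eq hI hC]
    exact mul_nonneg (by norm_num)
      (mean_nonneg (fun x hx => (hN x hx).1) fun x hx => (hN x hx).2)
  -- the original condition, with the conditional expectation multiplied out
  have hU : ∀ U : WithBot ℚ, mean (best (picked J C))
      (fun z => if β z.agent ≤ U then z.principal - K else 0) ≤ 0 := by
    intro U
    have h₁ : probAgentLE I C U = mean (best (picked J C)) fun z => if β z.agent ≤ U then 1 else 0 := by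
      rw [← h.expectation_eq hI hC fun a _ => if a ≤ U then 1 else 0, probAgentLE, sum_filter_map,
        expectation, outcomes]
      simp only [mul_ite, mul_one, mul_zero]
    have h₂ : condUtilityLE I C U * probAgentLE I C U = if probAgentLE I C U = 0 then 0 else
        mean (best (picked J C)) fun z => if β z.agent ≤ U then z.principal else 0 := by
      split
      · next h₀ => rw [h₀, mul_zero]
      · next h₀ =>
        rw [← h.expectation_eq hI hC fun a u => if a ≤ U then u else 0, condUtilityLE,
          sum_filter_map, expectation, outcomes, div_mul_cancel₀ _ h₀]
        simp only [mul_ite, mul_zero]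
    have h₃ : (fun z : MassPoint ℚ => if β z.agent ≤ U then z.principal - K else 0) =
        fun z => (if β z.agent ≤ U then z.principal else 0) -
          K * (if β z.agent ≤ U then 1 else 0) := by
      funext z; split <;> ring
    have h₄ : 0 ≤ probAgentLE I C U := h₁ ▸ mean_nonneg (fun x hx => (hN x hx).1)
      fun x _ => by split <;> norm_num
    rw [h₃, mean_sub, mean_mul_left, ← h₁]
    rcases h₄.lt_or_eq with h₅ | h₅
    · rw [if_neg h₅.ne'] at h₂
      rw [← h₂, ← hK]
      have := mul_le_mul_of_nonneg_right (hal U h₅) h₄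
      linarith
    · -- a null event carries no utility
      have h₆ : mean (best (picked J C)) (fun z => if β z.agent ≤ U then z.principal else 0) = 0 := by
        rw [mean]
        refine List.sum_eq_zero fun a ha => ?_
        obtain ⟨z, hz, rfl⟩ := List.mem_map.1 ha
        by_cases hz' : β z.agent ≤ U
        · have h₇ : z.prob * (if β z.agent ≤ U then (1 : ℚ) else 0) ≤ probAgentLE I C U := by
            rw [h₁, mean]
            refine List.single_le_sum (fun b hb => ?_) _ (List.mem_map_of_mem
              (f := fun x : MassPoint ℚ => x.prob * (if β x.agent ≤ U then (1 : ℚ) else 0)) hz)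
            obtain ⟨y, hy, rfl⟩ := List.mem_map.1 hb
            have := (hN y hy).1
            split <;> simp [this]
          rw [if_pos hz', mul_one, ← h₅] at h₇
          rw [le_antisymm h₇ (hN z hz).1, zero_mul]
        · simp [hz']
      rw [h₆, ← h₅]
      simp
  have hgoal : mean (best (picked J C)) (fun z => if z.agent < t then z.principal - K else 0) ≤ 0 := by
    -- the label of the pieces next to the threshold
    obtain ⟨U, hU'⟩ : ∃ U, (((best (picked J C)).filter fun z => decide (z.agent < t)).map
      fun z => β z.agent).foldr max ⊥ = U := ⟨_, rfl⟩
    have hle : ∀ z ∈ best (picked J C), z.agent < t → β z.agent ≤ U := fun z hz hzt =>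
      ((foldr_max_le _ _ _).1 hU'.le).2 _ (List.mem_map_of_mem (f := fun z : MassPoint ℚ => β z.agent)
        (List.mem_filter.2 ⟨hz, decide_eq_true hzt⟩))
    have hge : ∀ z : MassPoint ℚ, ¬ z.agent < t → U ≤ β z.agent := by
      intro z hz
      rw [← hU', foldr_max_le]
      refine ⟨bot_le, fun w hw => ?_⟩
      obtain ⟨y, hy, rfl⟩ := List.mem_map.1 hw
      rw [List.mem_filter, decide_eq_true_eq] at hy
      exact h.mono (hy.2.le.trans (not_lt.1 hz))
    by_cases hlow : ∀ z ∈ best (picked J C), z.agent < t → β z.agent = U → z.principal ≤ K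
    · refine le_trans (mean_mono (h := fun z => if β z.agent < U then z.principal - K else 0)
        (fun x hx => (hN x hx).1) fun z hz => ?_) ?_
      · by_cases hzt : z.agent < t
        · rcases (hle z hz hzt).lt_or_eq with hlt | heq
          · simp [hzt, hlt]
          · simp [hzt, heq, hlow z hz hzt heq]
        · simp [hzt, not_lt.2 (hge z hzt)]
      · by_cases hbot : U = ⊥
        · simp [hbot, mean_zero]
        · obtain ⟨U₁, hU₁⟩ : ∃ U₁, (((best (picked J C)).filter fun z => decide (β z.agent < U)).map
            fun z => β z.agent).foldr max ⊥ = U₁ := ⟨_, rfl⟩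
          have hlt : U₁ < U := by
            rw [← hU₁]
            refine List.foldrRecOn (motive := fun u => u < U) _ _ (bot_lt_iff_ne_bot.2 hbot)
              fun b hb a ha => max_lt ?_ hb
            obtain ⟨y, hy, rfl⟩ := List.mem_map.1 ha
            exact of_decide_eq_true (List.mem_filter.1 hy).2
          refine le_of_eq_of_le (mean_congr fun z hz => ?_) (hU U₁)
          refine if_congr ⟨fun hz' => ?_, fun hz' => hz'.trans_lt hlt⟩ rfl rfl
          exact ((foldr_max_le _ _ _).1 hU₁.le).2 _ (List.mem_map_of_mem
            (f := fun z : MassPoint ℚ => β z.agent) (List.mem_filter.2 ⟨hz, decide_eq_true hz'⟩))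
    · push Not at hlow
      obtain ⟨x, hx, hxt, hxU, hxK⟩ := hlow
      refine le_trans (mean_mono (fun x hx => (hN x hx).1) fun z hz => ?_) (hU U)
      by_cases hzt : z.agent < t
      · simp [hzt, hle z hz hzt]
      · rw [if_neg hzt]
        split
        · next hzU =>
          have := hties x hx z hz (hxt.trans_le (not_lt.1 hzt))
            (hxU.trans (le_antisymm hzU (hge z hzt)).symm)
          linarith
        · exact le_rfl
  have h₃ : (fun z : MassPoint ℚ => if z.agent < t then z.principal - K else 0) =
      fun z => (if z.agent < t then z.principal else 0) -
        K * (if z.agent < t then 1 else 0) := by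
    funext z; split <;> ring
  rw [h₃, mean_sub, mean_mul_left] at hgoal
  rw [hK, mass]
  linarith

end Refinement

/-! ### Bins and increments -/

/-- Whether the agent utility `x` lies in the cumulative bin `B_{≤ j}`; the bin `B_{≤ 0}` is empty. -/
def InCum (M : ℕ) (û : List ℚ) (j : ℕ) (x : ℚ) : Prop :=
  j ≠ 0 ∧ if j = M then x ≤ û.getD (j - 1) 0 else x < û.getD (j - 1) 0

instance (M : ℕ) (û : List ℚ) (j : ℕ) : DecidablePred (InCum M û j) := fun _ => by
  unfold InCum; infer_instance

/-- The conditional probability `q = Pr[u^A ∈ B_j | u^A ∈ B_{≤ j}]`. -/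
def increment (M : ℕ) (û : List ℚ) (j : ℕ) (D : FDist) : ℚ :=
  mass (fun x => InCum M û j x ∧ ¬ InCum M û (j - 1) x) D / mass (InCum M û j) D

/-- The coefficient `c_j = (j - 5) / (M - 1)` of the additive objective, and `0` for `j ≤ 5`. -/
def coeff (M j : ℕ) : ℚ := if 6 ≤ j then ((j : ℚ) - 5) / ((M : ℚ) - 1) else 0

/-- The contribution of one configuration of one action to the additive objective. -/
def contribution (M : ℕ) (û : List ℚ) (D : FDist) : ℚ :=
  ((List.range M).map fun i => coeff M (i + 1) *
    (share (InCum M û i) (InCum M û (i + 1)) D / mass (InCum M û (i + 1)) D)).sum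

theorem val_inCumBin (M : ℕ) (û : List ℚ) (j : ℕ) (x : ℚ) :
    (inCumBin M û (j + 1) x).val = decide (InCum M û (j + 1) x) := by
  by_cases h : j + 1 = M
  · subst h
    simp [inCumBin, InCum]
  · simp [inCumBin, InCum, h]

theorem val_inBin {M : ℕ} (û : List ℚ) {j : ℕ} (hj : j < M) (x : ℚ) :
    (inBin M û (j + 1) x).val = decide (InCum M û (j + 1) x ∧ ¬ InCum M û j x) := by
  rw [inBin, val_bind, val_inCumBin]
  cases j with
  | zero => simp [InCum]
  | succ j =>
    have : j + 1 ≠ M := hj.ne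
    simp [InCum, this, Bool.and_comm]

/-- The conditional expectation of the bin times its conditional probability is the principal's share of
the bin over the mass of the cumulative bin; for a null bin both are `0`. -/
theorem val_binStats {M : ℕ} (û : List ℚ) {D : FDist} (hD : D.Nonneg) {j : ℕ} (hj : j < M) :
    (binStats M û D (j + 1)).val = (increment M û (j + 1) D,
      share (InCum M û j) (InCum M û (j + 1)) D / mass (InCum M û (j + 1)) D) := by
  have h₁ : ∀ (P : ℚ → Prop) [DecidablePred P],
      ((D.filter fun x => decide (P x.agent)).map fun x => x.prob).sum = mass P D := by
    intro P _
    rw [sum_filter_map, mass, mean]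
    simp
  have h₂ : ((D.filter fun x => decide (InCum M û (j + 1) x.agent ∧ ¬ InCum M û j x.agent)).map
      fun x => x.prob * x.principal).sum = share (InCum M û j) (InCum M û (j + 1)) D := by
    rw [sum_filter_map, share, mean]
    simp
  simp only [binStats, val_bind, val_filterT, val_mapT, val_sumT, val_mulT, val_divT, val_pure,
    val_inCumBin, val_inBin û hj]
  rw [h₁, h₁ fun x => InCum M û (j + 1) x ∧ ¬ InCum M û j x, h₂, increment, add_tsub_cancel_right]
  congr 1
  by_cases h : mass (fun x => InCum M û (j + 1) x ∧ ¬ InCum M û j x) D = 0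
  · have h₃ : share (InCum M û j) (fun x => InCum M û (j + 1) x ∧ ¬ InCum M û j x) D = 0 :=
      share_eq_zero _ _ hD h
    have h₄ : share (InCum M û j) (InCum M û (j + 1)) D = 0 := by
      rw [← h₃]
      exact mean_congr fun x _ => by simp
    simp [h, h₄]
  · field_simp

theorem val_summary {M : ℕ} (N : ℕ) (û : List ℚ) {D : FDist} (hD : D.Nonneg) :
    (summary M N û D).val =
      ((List.range M).map fun i => ⌊increment M û (i + 1) D * N⌋₊, contribution M û D) := by
  have h : (List.range M).map (fun i => (i + 1, (binStats M û D (i + 1)).val)) =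
      (List.range M).map fun i => (i + 1, (increment M û (i + 1) D,
        share (InCum M û i) (InCum M û (i + 1)) D / mass (InCum M û (i + 1)) D)) :=
    List.map_congr_left fun i hi => by rw [val_binStats û hD (List.mem_range.1 hi)]
  simp only [summary, val_bind, val_rangeT, val_mapT, val_pure, val_mulT, val_floorT, val_sumT,
    val_ite, h, List.map_map, Function.comp_def]
  congr 2
  refine List.map_congr_left fun i _ => ?_
  by_cases hi : 6 ≤ i + 1 <;> simp [coeff, hi]

/-! ### The dynamic program -/

theorem val_feasible (M N : ℕ) (k : List ℕ) :
    (feasible M N k).val = true ↔ ∀ i < k.length,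
      (1 - 1 / (M : ℚ)) / ((i : ℚ) + 1) - 1 / (M : ℚ) ^ 2 ≤ (k.getD i 0 : ℚ) / N ∧
      (i ≠ 0 → (k.getD i 0 : ℚ) / N ≤ (1 + 1 / (M : ℚ)) / i) := by
  simp only [feasible, val_bind, val_enumerateT, val_allT, val_divT, val_leT, val_pure,
    List.all_eq_true, val_ite]
  constructor
  · intro h i hi
    have := h (k[i], i) (List.mem_zipIdx_iff_getElem?.2 (by simp [hi]))
    rw [List.getD_eq_getElem _ _ hi]
    by_cases h₀ : i = 0
    · simpa [h₀] using this
    · simpa [h₀] using this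
  · rintro h ⟨a, i⟩ ha
    have ha' := List.mem_zipIdx_iff_getElem?.1 ha
    obtain ⟨hi, hia⟩ := List.getElem?_eq_some_iff.1 ha'
    have := h i hi
    rw [List.getD_eq_getElem _ _ hi, hia] at this
    by_cases h₀ : i = 0
    · simpa [h₀] using this
    · simpa [h₀] using this

theorem val_lookupT (k : List ℕ) (keys : List (List ℕ)) (g : List ℕ → Option (ℚ × List ℕ)) :
    (lookupT k (keys.map fun k => (k, g k))).val = if k ∈ keys then g k else none := by
  induction keys with
  | nil => simp [lookupT]
  | cons k' keys ih =>
    by_cases h : k = k'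
    · subst h
      simp [lookupT]
    · simp [lookupT, h, ih]

/-- Scanning candidates with `betterT` yields a best one. -/
theorem foldl_betterT {α : Type} (f : α → Option (ℚ × List ℕ)) (l : List α)
    (b : Option (ℚ × List ℕ)) :
    (∀ x, l.foldl (fun b a => (betterT b (f a)).val) b = some x →
      b = some x ∨ ∃ a ∈ l, f a = some x) ∧
    ∀ y, (b = some y ∨ ∃ a ∈ l, f a = some y) →
      ∃ x, l.foldl (fun b a => (betterT b (f a)).val) b = some x ∧ y.1 ≤ x.1 := by
  have hbetter : ∀ b c : Option (ℚ × List ℕ), ((betterT b c).val = b ∨ (betterT b c).val = c) ∧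
      ∀ y, (b = some y ∨ c = some y) → ∃ x, (betterT b c).val = some x ∧ y.1 ≤ x.1 := by
    intro b c
    rcases b with _ | b <;> rcases c with _ | c
    · simp [betterT]
    · simp [betterT]
    · simp [betterT]
    · by_cases h : b.1 < c.1
      · refine ⟨.inr (by simp [betterT, h]), fun y hy => ⟨c, by simp [betterT, h], ?_⟩⟩
        rcases hy with hy | hy <;> cases hy
        exacts [h.le, le_rfl]
      · refine ⟨.inl (by simp [betterT, h]), fun y hy => ⟨b, by simp [betterT, h], ?_⟩⟩
        rcases hy with hy | hy <;> cases hy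
        exacts [le_rfl, not_lt.1 h]
  induction l generalizing b with
  | nil =>
    refine ⟨fun x hx => .inl hx, fun y hy => ⟨y, ?_, le_rfl⟩⟩
    simpa using hy
  | cons a l ih =>
    obtain ⟨h₁, h₂⟩ := ih (betterT b (f a)).val
    obtain ⟨h₃, h₄⟩ := hbetter b (f a)
    rw [List.foldl_cons]
    constructor
    · intro x hx
      rcases h₁ x hx with h | ⟨c, hc, h⟩
      · rcases h₃ with h₃ | h₃
        · exact .inl (h₃ ▸ h)
        · exact .inr ⟨a, by simp, h₃ ▸ h⟩
      · exact .inr ⟨c, List.mem_cons_of_mem _ hc, h⟩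
    · intro y hy
      have hfirst : (b = some y ∨ f a = some y) → ∃ x, l.foldl
          (fun b a => (betterT b (f a)).val) (betterT b (f a)).val = some x ∧ y.1 ≤ x.1 := by
        intro h
        obtain ⟨z, hz, hyz⟩ := h₄ y h
        obtain ⟨x, hx, hzx⟩ := h₂ z (.inl hz)
        exact ⟨x, hx, hyz.trans hzx⟩
      rcases hy with hy | ⟨c, hc, hy⟩
      · exact hfirst (.inl hy)
      · rcases List.mem_cons.1 hc with rfl | hc
        · exact hfirst (.inr hy)
        · exact h₂ y (.inr ⟨c, hc, hy⟩)

/-- The summaries that the configuration `C` picks. -/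
def pickedSummaries (S : List (List (List ℕ × ℚ))) (C : List ℕ) : List (List ℕ × ℚ) :=
  List.zipWith (fun s c => s.getD c ([], 0)) S C

/-- The memo table holds, for every key, an optimal completion: a configuration that reaches a feasible
vector, with a value that no other completion within the keys exceeds. -/
theorem optTable_spec (M N : ℕ) (keys : List (List ℕ)) (S : List (List (List ℕ × ℚ))) :
    ∃ g : List ℕ → Option (ℚ × List ℕ),
      (optTable M N keys S).val = keys.map (fun k => (k, g k)) ∧
      (∀ k x, g k = some x →
        List.Forall₂ (fun (s : List (List ℕ × ℚ)) (c : ℕ) => c < s.length) S x.2 ∧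
        x.1 = ((pickedSummaries S x.2).map Prod.snd).sum ∧
        (feasible M N (((pickedSummaries S x.2).map Prod.fst).foldl
          (List.zipWith (· + ·)) k)).val = true) ∧
      ∀ k C, List.Forall₂ (fun (s : List (List ℕ × ℚ)) (c : ℕ) => c < s.length) S C →
        (∀ m, (((pickedSummaries S C).map Prod.fst).take m).foldl (List.zipWith (· + ·)) k ∈ keys) →
        (feasible M N (((pickedSummaries S C).map Prod.fst).foldl
          (List.zipWith (· + ·)) k)).val = true →
        ∃ x, g k = some x ∧ ((pickedSummaries S C).map Prod.snd).sum ≤ x.1 := by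
  induction S with
  | nil =>
    refine ⟨fun k => if (feasible M N k).val then some (0, []) else none, by simp [optTable],
      fun k x hx => ?_, fun k C hC _ hf => ?_⟩
    · by_cases h : (feasible M N k).val = true
      · simp only [h, if_true, Option.some.injEq] at hx
        subst hx
        simp [pickedSummaries, h]
      · simp [h] at hx
    · cases hC
      simp only [pickedSummaries, List.zipWith_nil_left, List.map_nil, List.foldl_nil] at hf ⊢
      simp [hf]
  | cons s S ih =>
    obtain ⟨g, hg, hsound, hcomplete⟩ := ih
    set f : List ℕ → (List ℕ × ℚ) × ℕ → Option (ℚ × List ℕ) := fun k c =>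
      (if List.zipWith (· + ·) k c.1.1 ∈ keys then g (List.zipWith (· + ·) k c.1.1) else none).map
        fun x => (c.1.2 + x.1, c.2 :: x.2) with hf
    have hf' : ∀ k c x, f k c = some x ↔ List.zipWith (· + ·) k c.1.1 ∈ keys ∧
        ∃ y, g (List.zipWith (· + ·) k c.1.1) = some y ∧ (c.1.2 + y.1, c.2 :: y.2) = x := by
      intro k c x
      simp only [hf]
      split <;> simp [*]
    refine ⟨fun k => s.zipIdx.foldl (fun b c => (betterT b (f k c)).val) none, ?_, ?_, ?_⟩
    · simp only [optTable, val_bind, val_enumerateT, val_mapT, val_foldT, val_pure, val_addVecT, hg,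
        val_lookupT]
      refine List.map_congr_left fun k _ => ?_
      congr 2
      funext b c
      simp only [hf]
      cases (if List.zipWith (· + ·) k c.1.1 ∈ keys then g (List.zipWith (· + ·) k c.1.1)
        else none) with
      | none => cases b <;> simp [betterT]
      | some x => simp
    · intro k x hx
      rcases (foldl_betterT (f k) s.zipIdx none).1 x hx with h | ⟨c, hc, h⟩
      · simp at h
      · obtain ⟨-, y, hy, rfl⟩ := (hf' k c x).1 h
        obtain ⟨h₁, h₂, h₃⟩ := hsound _ y hy
        obtain ⟨hlt, hc⟩ := List.getElem?_eq_some_iff.1 (List.mem_zipIdx_iff_getElem?.1 hc)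
        refine ⟨.cons hlt h₁, ?_, ?_⟩
        · simp [pickedSummaries, hlt, hc, h₂]
        · simpa [pickedSummaries, hlt, hc] using h₃
    · intro k C hC hkeys hfeas
      cases hC with
      | @cons _ c _ C hc hC =>
        have hget : s.getD c ([], 0) = s[c] := List.getD_eq_getElem _ _ hc
        simp only [pickedSummaries, List.zipWith_cons_cons, List.map_cons, List.foldl_cons, hget,
          List.sum_cons] at hkeys hfeas ⊢
        obtain ⟨y, hy, hle⟩ := hcomplete _ C hC (fun m => hkeys (m + 1)) hfeas
        have hk : List.zipWith (· + ·) k s[c].1 ∈ keys := by simpa using hkeys 1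
        obtain ⟨x, hx, hxle⟩ := (foldl_betterT (f k) s.zipIdx none).2 (s[c].2 + y.1, c :: y.2)
          (.inr ⟨(s[c], c), List.mem_zipIdx_iff_getElem?.2 (by simp [hc]),
            (hf' k _ _).2 ⟨hk, y, hy, rfl⟩⟩)
        exact ⟨x, hx, le_trans (by simpa [pickedSummaries] using hle) hxle⟩

theorem foldl_zipWith_add {M : ℕ} (V : List (List ℕ)) (hV : ∀ v ∈ V, v.length = M) (k : List ℕ)
    (hk : k.length = M) :
    (V.foldl (List.zipWith (· + ·)) k).length = M ∧
      ∀ i < M, (V.foldl (List.zipWith (· + ·)) k).getD i 0 =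
        k.getD i 0 + (V.map fun v => v.getD i 0).sum := by
  induction V generalizing k with
  | nil => simp [hk]
  | cons v V ih =>
    have hv := hV v (by simp)
    have hlen : (List.zipWith (· + ·) k v).length = M := by simp [hk, hv]
    obtain ⟨h₁, h₂⟩ := ih (fun v hv => hV v (List.mem_cons_of_mem _ hv)) _ hlen
    refine ⟨h₁, fun i hi => ?_⟩
    rw [List.foldl_cons, h₂ i hi, List.getD_eq_getElem _ _ (hlen ▸ hi), List.getElem_zipWith,
      List.map_cons, List.sum_cons, List.getD_eq_getElem _ _ (hk ▸ hi),
      List.getD_eq_getElem _ _ (hv ▸ hi), add_assoc]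

/-- The constraints of the dynamic program, for the distributions that a configuration picks. -/
def Constraints (M N : ℕ) (û : List ℚ) (L : List FDist) : Prop :=
  ∀ i < M,
    (1 - 1 / (M : ℚ)) / ((i : ℚ) + 1) - 1 / (M : ℚ) ^ 2 ≤
      ((L.map fun D => ⌊increment M û (i + 1) D * N⌋₊).sum : ℕ) / (N : ℚ) ∧
    (i ≠ 0 → ((L.map fun D => ⌊increment M û (i + 1) D * N⌋₊).sum : ℕ) / (N : ℚ) ≤
      (1 + 1 / (M : ℚ)) / i)

theorem increment_mem (M : ℕ) (û : List ℚ) (j : ℕ) {D : FDist} (hD : D.Nonneg) :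
    0 ≤ increment M û j D ∧ increment M û j D ≤ 1 := by
  have h₁ : ∀ x ∈ D, 0 ≤ x.prob := fun x hx => (hD x hx).1
  exact ⟨div_nonneg (mass_nonneg _ h₁) (mass_nonneg _ h₁),
    div_le_one_of_le₀ (mass_mono h₁ fun x _ h => h.1) (mass_nonneg _ h₁)⟩

/-- For one guess of the bins, the dynamic program is exact: it finds a configuration that satisfies the
constraints, and it finds one whose additive objective is the largest possible. -/
theorem solve_spec {M : ℕ} {J : List (List FDist)} (hJ : ∀ A ∈ J, ∀ D ∈ A, D.Nonneg) {û : List ℚ}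
    (hû : û.length = M) :
    (∀ C, (solve M J û).val = some C →
      List.Forall₂ (fun (A : List FDist) (c : ℕ) => c < A.length) J C ∧
      Constraints M (M ^ 2 * J.length) û (picked J C)) ∧
    ∀ C, List.Forall₂ (fun (A : List FDist) (c : ℕ) => c < A.length) J C →
      Constraints M (M ^ 2 * J.length) û (picked J C) →
      ∃ C', (solve M J û).val = some C' ∧
        ((picked J C).map (contribution M û)).sum ≤
          ((picked J C').map (contribution M û)).sum := by
  obtain ⟨N, hN⟩ : ∃ N, M ^ 2 * J.length = N := ⟨_, rfl⟩
  rw [hN]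
  set sm : FDist → List ℕ × ℚ := fun D =>
    ((List.range M).map fun i => ⌊increment M û (i + 1) D * N⌋₊, contribution M û D) with hsm
  set S := J.map fun A => A.map sm with hS
  set keys := (tuplesT (List.range (J.length * N + 1)) M).val with hkeys
  obtain ⟨g, hg, hsound, hcomplete⟩ := optTable_spec M N keys S
  have hsumm : J.map (fun A => A.map fun D => (summary M N û D).val) = S :=
    List.map_congr_left fun A hA => List.map_congr_left fun D hD => val_summary N û (hJ A hA D hD)
  have hval : (solve M J û).val =
      (if List.replicate M 0 ∈ keys then g (List.replicate M 0) else none).map Prod.snd := by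
    simp only [solve, val_bind, val_lengthT, val_natMulT, val_mapT, val_rangeT, hN, hsumm, hg,
      val_lookupT, val_pure, List.map_const', hû, ← hkeys]
    cases (if List.replicate M 0 ∈ keys then g (List.replicate M 0) else none) <;> rfl
  have hconf : ∀ C, List.Forall₂ (fun (s : List (List ℕ × ℚ)) (c : ℕ) => c < s.length) S C ↔
      List.Forall₂ (fun (A : List FDist) (c : ℕ) => c < A.length) J C := by
    intro C
    simp [hS, List.forall₂_map_left_iff]
  have hpick : ∀ C, List.Forall₂ (fun (A : List FDist) (c : ℕ) => c < A.length) J C →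
      pickedSummaries S C = (picked J C).map sm := by
    intro C hC
    rw [hS]
    clear_value sm
    clear hJ hN hS hkeys hg hsound hcomplete hsumm hval hconf keys
    induction hC with
    | nil => rfl
    | @cons A c J C hc hC ih =>
      simp only [pickedSummaries, picked, List.map_cons, List.zipWith_cons_cons] at ih ⊢
      rw [ih, List.getD_eq_getElem _ _ hc, List.getD_eq_getElem _ _ (by simpa using hc),
        List.getElem_map]
  have hvec : ∀ L : List FDist, ∀ v ∈ (L.map sm).map Prod.fst, v.length = M := by
    intro L v hv
    simp only [List.map_map, List.mem_map, Function.comp, hsm] at hv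
    obtain ⟨D, -, rfl⟩ := hv
    simp
  have hfeas : ∀ L : List FDist, (feasible M N (((L.map sm).map Prod.fst).foldl
      (List.zipWith (· + ·)) (List.replicate M 0))).val = true ↔ Constraints M N û L := by
    intro L
    obtain ⟨h₁, h₂⟩ := foldl_zipWith_add (M := M) _ (hvec L) (List.replicate M 0)
      (by simp)
    rw [val_feasible, h₁, Constraints]
    refine forall₂_congr fun i hi => ?_
    have h₃ : (((L.map sm).map Prod.fst).map fun v => v.getD i 0) =
        L.map fun D => ⌊increment M û (i + 1) D * N⌋₊ := by
      rw [List.map_map, List.map_map]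
      refine List.map_congr_left fun D _ => ?_
      simp [hsm, hi]
    rw [h₂ i hi, h₃, List.getD_eq_getElem _ _ (by simpa using hi), List.getElem_replicate, zero_add]
  constructor
  · intro C hC
    rw [hval] at hC
    obtain ⟨x, hx, rfl⟩ := Option.map_eq_some_iff.1 hC
    by_cases hk : List.replicate M 0 ∈ keys
    · rw [if_pos hk] at hx
      obtain ⟨h₁, -, h₃⟩ := hsound _ x hx
      rw [hconf] at h₁
      rw [hpick _ h₁, hfeas] at h₃
      exact ⟨h₁, h₃⟩
    · simp [hk] at hx
  · intro C hC hcon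
    have hmem : ∀ m, ((((picked J C).map sm).map Prod.fst).take m).foldl
        (List.zipWith (· + ·)) (List.replicate M 0) ∈ keys := by
      intro m
      rw [← List.map_take, ← List.map_take]
      obtain ⟨h₁, h₂⟩ := foldl_zipWith_add (M := M) _ (hvec ((picked J C).take m))
        (List.replicate M 0) (by simp)
      rw [hkeys, mem_tuplesT]
      refine ⟨h₁, fun a ha => ?_⟩
      obtain ⟨i, hi, rfl⟩ := List.getElem_of_mem ha
      have hi' : i < M := h₁ ▸ hi
      have h₃ := h₂ i hi'
      rw [List.getD_eq_getElem _ _ hi] at h₃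
      rw [List.mem_range, h₃, List.getD_eq_getElem _ _ (by simpa using hi'),
        List.getElem_replicate, zero_add, List.map_map, List.map_map]
      refine Nat.lt_succ_of_le ((List.sum_le_card_nsmul _ N fun a ha => ?_).trans ?_)
      · obtain ⟨D, hD, rfl⟩ := List.mem_map.1 ha
        obtain ⟨A, hA, hD⟩ := mem_picked hC (List.mem_of_mem_take hD)
        have h := (increment_mem M û (i + 1) (hJ A hA D hD)).2
        simp only [hsm, Function.comp, List.getD_eq_getElem?_getD, List.getElem?_map,
          List.getElem?_range hi', Option.map_some, Option.getD_some]
        refine Nat.floor_le_of_le ?_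
        have : (0 : ℚ) ≤ N := Nat.cast_nonneg N
        nlinarith
      · rw [smul_eq_mul, List.length_map]
        refine Nat.mul_le_mul_right _ ?_
        simp only [picked, List.length_take, List.length_zipWith]
        omega
    obtain ⟨x, hx, hle⟩ := hcomplete (List.replicate M 0) C ((hconf C).2 hC)
      (by rw [hpick C hC]; exact hmem) (by rw [hpick C hC, hfeas]; exact hcon)
    obtain ⟨h₁, h₂, -⟩ := hsound _ x hx
    have hk : List.replicate M 0 ∈ keys := by simpa using hmem 0
    refine ⟨x.2, by rw [hval, if_pos hk, hx]; rfl, ?_⟩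
    rw [hpick C hC] at hle
    rw [hpick _ ((hconf _).1 h₁)] at h₂
    simp only [List.map_map, Function.comp_def, hsm] at hle h₂
    exact hle.trans h₂.le

/-! ### The additive estimates -/

/-- The union bound for independent events. -/
theorem one_sub_sum_le_prod {α : Type} (L : List α) (q : α → ℚ) (hq : ∀ a ∈ L, 0 ≤ q a ∧ q a ≤ 1) :
    1 - (L.map q).sum ≤ (L.map fun a => 1 - q a).prod ∧
      0 ≤ (L.map fun a => 1 - q a).prod ∧ (L.map fun a => 1 - q a).prod ≤ 1 := by
  induction L with
  | nil => simp
  | cons a L ih =>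
    obtain ⟨h₁, h₂, h₃⟩ := ih fun b hb => hq b (List.mem_cons_of_mem _ hb)
    obtain ⟨h₄, h₅⟩ := hq a (by simp)
    simp only [List.map_cons, List.sum_cons, List.prod_cons]
    refine ⟨?_, by nlinarith, by nlinarith⟩
    have : 0 ≤ (L.map q).sum := by
      refine List.sum_nonneg fun b hb => ?_
      obtain ⟨c, hc, rfl⟩ := List.mem_map.1 hb
      exact (hq c (List.mem_cons_of_mem _ hc)).1
    nlinarith

theorem prod_le_exp_neg_sum {α : Type} (L : List α) (q : α → ℚ) (hq : ∀ a ∈ L, q a ≤ 1) :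
    (((L.map fun a => 1 - q a).prod : ℚ) : ℝ) ≤ Real.exp (-((L.map q).sum : ℚ)) := by
  induction L with
  | nil => simp
  | cons a L ih =>
    simp only [List.map_cons, List.sum_cons, List.prod_cons]
    rw [Rat.cast_mul, Rat.cast_sub, Rat.cast_one, Rat.cast_add, neg_add, Real.exp_add]
    have h₁ : (0 : ℝ) ≤ 1 - (q a : ℝ) := by
      have := hq a (by simp)
      exact_mod_cast sub_nonneg.2 this
    refine mul_le_mul ?_ (ih fun b hb => hq b (List.mem_cons_of_mem _ hb)) ?_ (Real.exp_pos _).le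
    · have := Real.add_one_le_exp (-(q a : ℝ))
      linarith
    · have : (0 : ℚ) ≤ (L.map fun a => 1 - q a).prod := by
        refine List.prod_nonneg fun b hb => ?_
        obtain ⟨c, hc, rfl⟩ := List.mem_map.1 hb
        exact sub_nonneg.2 (hq c (List.mem_cons_of_mem _ hc))
      exact_mod_cast this

/-- Rounding the increments of `n` actions down to multiples of `1 / (M² n)` changes their sum by at
most `1 / M²`. -/
theorem sum_floor_div (L : List FDist) (q : FDist → ℚ) (hq : ∀ D ∈ L, 0 ≤ q D) {M : ℕ} (hM : 1 ≤ M)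
    (hL : L ≠ []) :
    ((L.map fun D => ⌊q D * ((M ^ 2 * L.length : ℕ) : ℚ)⌋₊).sum : ℕ) /
        ((M ^ 2 * L.length : ℕ) : ℚ) ≤ (L.map q).sum ∧
      (L.map q).sum ≤ ((L.map fun D => ⌊q D * ((M ^ 2 * L.length : ℕ) : ℚ)⌋₊).sum : ℕ) /
        ((M ^ 2 * L.length : ℕ) : ℚ) + 1 / (M : ℚ) ^ 2 := by
  have hn : 0 < L.length := List.length_pos_iff.2 hL
  have hN : (0 : ℚ) < ((M ^ 2 * L.length : ℕ) : ℚ) := by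
    have : 0 < M ^ 2 * L.length := by positivity
    exact_mod_cast this
  have key : ∀ (N : ℚ), 0 ≤ N → ∀ L : List FDist, (∀ D ∈ L, 0 ≤ q D) →
      (((L.map fun D => ⌊q D * N⌋₊).sum : ℕ) : ℚ) ≤ (L.map q).sum * N ∧
      (L.map q).sum * N ≤ (((L.map fun D => ⌊q D * N⌋₊).sum : ℕ) : ℚ) + L.length := by
    intro N hN L hq
    induction L with
    | nil => simp
    | cons D L ih =>
      obtain ⟨h₁, h₂⟩ := ih fun E hE => hq E (List.mem_cons_of_mem _ hE)
      have h₃ := Nat.floor_le (mul_nonneg (hq D (by simp)) hN)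
      have h₄ := Nat.lt_floor_add_one (q D * N)
      simp only [List.map_cons, List.sum_cons, List.length_cons]
      push_cast at *
      constructor <;> linarith
  obtain ⟨h₁, h₂⟩ := key _ hN.le L hq
  constructor
  · rwa [div_le_iff₀ hN]
  · have h₃ : (1 : ℚ) / (M : ℚ) ^ 2 = L.length / ((M ^ 2 * L.length : ℕ) : ℚ) := by
      push_cast
      field_simp
    rw [h₃, ← add_div, le_div_iff₀ hN]
    exact h₂

section Bins

variable {M : ℕ} {û : List ℚ}

/-- The bins of a guess are consecutive: each cumulative bin contains the previous one. -/
def Nested (M : ℕ) (û : List ℚ) : Prop :=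
  ∀ j < M, ∀ x, InCum M û j x → InCum M û (j + 1) x

theorem inCum_of_le {j : ℕ} (a b : ℚ) (hab : a ≤ b) (hb : InCum M û j b) : InCum M û j a := by
  refine ⟨hb.1, ?_⟩
  have := hb.2
  split
  · next h => rw [if_pos h] at this; exact hab.trans this
  · next h => rw [if_neg h] at this; exact hab.trans_lt this

theorem mass_inCum_zero (D : FDist) : mass (InCum M û 0) D = 0 :=
  (mean_congr fun x _ => by simp [InCum]).trans (mean_zero D)

theorem mass_bin (hû : Nested M û) {j : ℕ} (hj : j < M) (D : FDist) :
    mass (fun x => InCum M û (j + 1) x ∧ ¬ InCum M û j x) D =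
      mass (InCum M û (j + 1)) D - mass (InCum M û j) D := by
  rw [mass, mass, mass, ← mean_sub]
  refine mean_congr fun x _ => ?_
  by_cases h : InCum M û j x.agent
  · simp [h, hû j hj _ h]
  · simp [h]

/-- `1 - q` is the ratio of consecutive values of the cumulative distribution function. If the larger
one vanishes, then so does the smaller one, whatever the junk value of `q`. -/
theorem mass_eq_mul_one_sub (hû : Nested M û) {j : ℕ} (hj : j < M) {D : FDist} (hD : D.Nonneg) :
    mass (InCum M û j) D = mass (InCum M û (j + 1)) D * (1 - increment M û (j + 1) D) := by
  have h₁ : ∀ x ∈ D, 0 ≤ x.prob := fun x hx => (hD x hx).1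
  rw [increment, add_tsub_cancel_right, mass_bin hû hj]
  by_cases h : mass (InCum M û (j + 1)) D = 0
  · have h₂ := mass_mono h₁ fun x _ => hû j hj x.agent
    have h₃ := mass_nonneg (InCum M û j) h₁
    rw [h] at h₂ ⊢
    linarith
  · field_simp
    ring

variable {L : List FDist}

theorem mass_best_inCum (hL : Regular M L) (j : ℕ) :
    mass (InCum M û j) (best L) = (L.map (mass (InCum M û j))).prod :=
  mass_best _ inCum_of_le hL.ne_nil hL.apart

/-- The additive increments determine the quantiles: consecutive values of the cumulative distribution
function of `u^A` have the ratio `∏ (1 - q)`. -/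
theorem mass_best_step (hL : Regular M L) (hû : Nested M û) {j : ℕ} (hj : j < M) :
    mass (InCum M û j) (best L) = mass (InCum M û (j + 1)) (best L) *
      (L.map fun D => 1 - increment M û (j + 1) D).prod := by
  rw [mass_best_inCum hL, mass_best_inCum hL, ← List.prod_map_mul]
  congr 1
  exact List.map_congr_left fun D hD => mass_eq_mul_one_sub hû hj (hL.nonneg D hD)

/-- In every configuration that satisfies the constraints, the quantiles of `u^A` are at least about
as large as intended. The union bound loses one unit per step; the initial slack of three units
absorbs the rounding errors. -/
theorem le_mass_best_of_constraints (hM : 6 ≤ M) (hL : Regular M L) (hû : Nested M û)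
    (hC : Constraints M (M ^ 2 * L.length) û L)
    (htop : mass (InCum M û M) (best L) = 1) {j : ℕ} (h5 : 5 ≤ j) (hj : j ≤ M) :
    ((j : ℚ) - 4) / ((M : ℚ) - 1) ≤ mass (InCum M û j) (best L) := by
  have hM' : (6 : ℚ) ≤ M := by exact_mod_cast hM
  induction hj using Nat.decreasingInduction with
  | self =>
    rw [htop, div_le_one (by linarith)]
    linarith
  | of_succ j hj ih =>
    have ih := ih (by omega)
    have hj5 : (5 : ℚ) ≤ j := by exact_mod_cast h5
    have hjM : (j : ℚ) + 1 ≤ M := by exact_mod_cast hj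
    rw [mass_best_step hL hû hj]
    have hq : ∀ D ∈ L, 0 ≤ increment M û (j + 1) D ∧ increment M û (j + 1) D ≤ 1 := fun D hD =>
      increment_mem M û _ (hL.nonneg D hD)
    have h₁ := (one_sub_sum_le_prod L (increment M û (j + 1)) hq).1
    have h₂ := (sum_floor_div L (increment M û (j + 1)) (fun D hD => (hq D hD).1)
      (by omega : 1 ≤ M) hL.ne_nil).2
    have h₃ := (hC j hj).2 (by omega)
    obtain ⟨e, he⟩ : ∃ e : ℚ, 1 / (M : ℚ) = e := ⟨_, rfl⟩
    have heM : e * M = 1 := by rw [← he]; field_simp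
    have he₀ : 0 < e := by rw [← he]; positivity
    have he₂ : 1 / (M : ℚ) ^ 2 = e ^ 2 := by rw [← he]; ring
    rw [he] at h₃
    rw [he₂] at h₂
    have hr : 1 - ((1 + e) / j + e ^ 2) ≤ (L.map fun D => 1 - increment M û (j + 1) D).prod := by
      linarith
    have hje : (j : ℚ) * e ≤ 1 := by nlinarith
    have h₄ : 0 ≤ 1 - ((1 + e) / j + e ^ 2) := by
      have : (1 + e) / j ≤ 2 / 5 := by
        rw [div_le_div_iff₀ (by linarith) (by norm_num)]
        nlinarith
      nlinarith
    refine le_trans ?_ (mul_le_mul ih hr h₄ (le_trans (by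
      apply div_nonneg <;> push_cast <;> linarith) ih))
    rw [div_mul_eq_mul_div]
    refine div_le_div_of_nonneg_right ?_ (by linarith)
    push_cast
    have h₅ : (1 + e) / (j : ℚ) * j = 1 + e := by field_simp
    obtain ⟨t, ht⟩ : ∃ t, (1 + e) / (j : ℚ) = t := ⟨_, rfl⟩
    rw [ht] at h₅ ⊢
    have h₆ : 0 < t := by rw [← ht]; positivity
    -- `(j - 3) (1 - t - e²) = j - 4 + (3 t - e - (j - 3) e²)`, and `t ≥ e + e²`
    have h₇ : e + e ^ 2 ≤ t := by
      rw [← ht, le_div_iff₀ (by linarith)]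
      nlinarith
    nlinarith [mul_nonneg he₀.le (sub_nonneg.2 hje)]

/-- The principal's shares of the first `m` bins add up to the share of their union. -/
theorem sum_share (hû : Nested M û) (D : FDist) {m : ℕ} (hm : m ≤ M) :
    ∑ i ∈ Finset.range m, share (InCum M û i) (InCum M û (i + 1)) D =
      mean D fun x => if InCum M û m x.agent then x.principal else 0 := by
  induction m with
  | zero =>
    rw [Finset.sum_range_zero]
    exact (mean_zero D).symm.trans (mean_congr fun x _ => by simp [InCum])
  | succ m ih =>
    rw [Finset.sum_range_succ, ih (by omega), share, ← mean_add]
    refine mean_congr fun x _ => ?_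
    by_cases h : InCum M û m x.agent
    · simp [h, hû m (by omega) _ h]
    · simp [h]

theorem sum_list_range (m : ℕ) (f : ℕ → ℚ) :
    ((List.range m).map f).sum = ∑ i ∈ Finset.range m, f i := by
  induction m with
  | zero => simp
  | succ m ih => simp [List.range_succ, Finset.sum_range_succ, ih]

/-- The additive objective, sorted by bins. -/
theorem sum_contribution (L : List FDist) :
    (L.map (contribution M û)).sum = ∑ i ∈ Finset.range M, coeff M (i + 1) *
      (L.map fun D => share (InCum M û i) (InCum M û (i + 1)) D / mass (InCum M û (i + 1)) D).sum := by
  induction L with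
  | nil => simp
  | cons D L ih =>
    simp only [List.map_cons, List.sum_cons, ih, mul_add, Finset.sum_add_distrib]
    rw [contribution, sum_list_range]

theorem sum_share_div_nonneg (hL : Regular M L) (i : ℕ) :
    0 ≤ (L.map fun D =>
      share (InCum M û i) (InCum M û (i + 1)) D / mass (InCum M û (i + 1)) D).sum := by
  refine List.sum_nonneg fun a ha => ?_
  obtain ⟨D, hD, rfl⟩ := List.mem_map.1 ha
  have hN := hL.nonneg D hD
  exact div_nonneg (share_nonneg _ _ hN) (mass_nonneg _ fun x hx => (hN x hx).1)

/-- The additive objective underestimates the principal's utility under every configuration that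
satisfies the constraints. -/
theorem contribution_le (hM : 6 ≤ M) (hL : Regular M L) (hû : Nested M û)
    (hC : Constraints M (M ^ 2 * L.length) û L)
    (htop : mass (InCum M û M) (best L) = 1) :
    (L.map (contribution M û)).sum ≤ mean (best L) fun x => x.principal := by
  have hN := best_nonneg hL.nonneg
  refine le_trans ?_ (mean_mono (g := fun x => if InCum M û M x.agent then x.principal else 0)
    (fun x hx => (hN x hx).1) fun x hx => ?_)
  · rw [← sum_share hû (best L) le_rfl, sum_contribution]
    refine Finset.sum_le_sum fun i hi => ?_
    have hi := Finset.mem_range.1 hi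
    refine le_trans ?_ (le_share_best inCum_of_le (hû i hi) hL.ne_nil hL.apart hL.nonneg)
    refine mul_le_mul_of_nonneg_right ?_ (sum_share_div_nonneg hL i)
    rw [← mass_best_inCum hL]
    by_cases h6 : 6 ≤ i + 1
    · rw [coeff, if_pos h6]
      refine le_trans (le_of_eq ?_) (le_mass_best_of_constraints hM hL hû hC htop
        (by omega : 5 ≤ i) hi.le)
      push_cast
      ring
    · rw [coeff, if_neg h6]
      exact mass_nonneg _ fun x hx => (hN x hx).1
  · split
    · exact le_rfl
    · exact (hN x hx).2

/-- If the bins are about the `M`-quantiles of `u^A` under a configuration, then it satisfies the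
constraints. -/
theorem constraints_of_quantiles (hM : 6 ≤ M) (hL : Regular M L) (hû : Nested M û)
    (hp : ∀ j, 1 ≤ j → j ≤ M → (j : ℚ) / M - 1 / (M : ℚ) ^ 2 ≤ mass (InCum M û j) (best L) ∧
      mass (InCum M û j) (best L) ≤ (j : ℚ) / M) :
    Constraints M (M ^ 2 * L.length) û L := by
  intro i hi
  have hM' : (6 : ℚ) ≤ M := by exact_mod_cast hM
  have hq : ∀ D ∈ L, 0 ≤ increment M û (i + 1) D ∧ increment M û (i + 1) D ≤ 1 := fun D hD =>
    increment_mem M û _ (hL.nonneg D hD)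
  obtain ⟨h₁, h₂, -⟩ := one_sub_sum_le_prod L (increment M û (i + 1)) hq
  obtain ⟨h₃, h₄⟩ := sum_floor_div L (increment M û (i + 1)) (fun D hD => (hq D hD).1)
    (by omega : 1 ≤ M) hL.ne_nil
  have hstep := mass_best_step hL hû hi
  have hexp := prod_le_exp_neg_sum L (increment M û (i + 1)) fun D hD => (hq D hD).2
  obtain ⟨h₅, h₆⟩ := hp (i + 1) (by omega) hi
  obtain ⟨r, hr⟩ : ∃ r, (L.map fun D => 1 - increment M û (i + 1) D).prod = r := ⟨_, rfl⟩
  obtain ⟨e, he⟩ : ∃ e : ℚ, 1 / (M : ℚ) = e := ⟨_, rfl⟩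
  have heM : e * M = 1 := by rw [← he]; field_simp
  have he₀ : 0 < e := by rw [← he]; positivity
  have he₁ : e ≤ 1 / 6 := by rw [← he]; exact one_div_le_one_div_of_le (by norm_num) hM'
  have he₂ : 1 / (M : ℚ) ^ 2 = e ^ 2 := by rw [← he]; ring
  have hdiv : ∀ a : ℚ, a / M = a * e := fun a => by rw [← he]; ring
  rw [hr] at h₁ h₂ hstep hexp
  rw [he₂, hdiv] at h₅
  rw [hdiv] at h₆
  push_cast at h₅ h₆
  have hi₀ : (0 : ℚ) ≤ i := Nat.cast_nonneg i
  obtain ⟨p, hp'⟩ : ∃ p, mass (InCum M û (i + 1)) (best L) = p := ⟨_, rfl⟩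
  rw [hp'] at h₅ h₆ hstep
  rw [he, he₂]
  constructor
  · have hlow : r ≤ 1 - (1 - e) / ((i : ℚ) + 1) := by
      have hpi : p * r ≤ i * e := by
        rw [← hstep]
        rcases Nat.eq_zero_or_pos i with rfl | hpos
        · rw [mass_inCum_zero]; simp
        · rw [← hdiv]
          exact (hp i hpos hi.le).2
      have h₇ : r * ((i : ℚ) + 1 - e) ≤ i := by
        have : e * (r * ((i : ℚ) + 1 - e)) ≤ e * i := by nlinarith
        exact le_of_mul_le_mul_left this he₀
      rw [one_sub_div (by linarith), le_div_iff₀ (by linarith)]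
      have h₈ : 0 < (i : ℚ) + 1 - e := by linarith
      refine le_of_mul_le_mul_right ?_ h₈
      nlinarith
    rw [he₂] at h₄
    linarith
  · intro hi'
    have hi₁ : (1 : ℚ) ≤ i := by exact_mod_cast Nat.one_le_iff_ne_zero.2 hi'
    refine h₃.trans (not_lt.1 fun hlt => ?_)
    have hpi : (i : ℚ) * e - e ^ 2 ≤ p * r := by
      rw [← hstep, ← hdiv, ← he₂]
      exact (hp i (by omega) hi.le).1
    have h₇ : (i : ℚ) - e ≤ (i + 1) * r := by
      have : e * ((i : ℚ) - e) ≤ e * ((i + 1) * r) := by nlinarith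
      exact le_of_mul_le_mul_left this he₀
    obtain ⟨t, ht⟩ : ∃ t, (1 + e) / (i : ℚ) = t := ⟨_, rfl⟩
    rw [ht] at hlt
    have ht₀ : 0 < t := by rw [← ht]; positivity
    have hti : t * i = 1 + e := by rw [← ht]; field_simp
    -- `exp t ≥ 1 + t + t² / 2` contradicts `r ≤ exp (-t)`
    have h₈ : (r : ℝ) * (1 + t + (t : ℝ) ^ 2 / 2) < 1 := by
      have h₉ := Real.quadratic_le_exp_of_nonneg (x := (t : ℝ)) (by exact_mod_cast ht₀.le)
      have h₁₀ : (r : ℝ) < Real.exp (-(t : ℝ)) := by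
        refine hexp.trans_lt (Real.exp_lt_exp.2 (neg_lt_neg ?_))
        exact_mod_cast hlt
      have h₁₁ : (0 : ℝ) ≤ r := by exact_mod_cast h₂
      calc (r : ℝ) * (1 + t + (t : ℝ) ^ 2 / 2) ≤ r * Real.exp t :=
            mul_le_mul_of_nonneg_left h₉ h₁₁
        _ < Real.exp (-(t : ℝ)) * Real.exp t := mul_lt_mul_of_pos_right h₁₀ (Real.exp_pos _)
        _ = 1 := by rw [← Real.exp_add]; simp
    have h₉ : r * (1 + t + t ^ 2 / 2) < 1 := by exact_mod_cast h₈
    have h₁₀ : 0 < 1 + t + t ^ 2 / 2 := by positivity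
    have h₁₁ : ((i : ℚ) - e) * (1 + t + t ^ 2 / 2) < i + 1 := by
      calc ((i : ℚ) - e) * (1 + t + t ^ 2 / 2) ≤ (i + 1) * r * (1 + t + t ^ 2 / 2) :=
            mul_le_mul_of_nonneg_right h₇ h₁₀.le
        _ = (i + 1) * (r * (1 + t + t ^ 2 / 2)) := by ring
        _ < (i + 1) * 1 := mul_lt_mul_of_pos_left h₉ (by linarith)
        _ = i + 1 := mul_one _
    have h₁₂ : t ≤ 1 + e := by nlinarith
    have h₁₃ : ((i : ℚ) - e) * (1 + t + t ^ 2 / 2) =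
        i + 1 + t / 2 * ((1 + e) - 2 * e - e * t) := by
      have : (i : ℚ) * t = 1 + e := by linarith
      calc ((i : ℚ) - e) * (1 + t + t ^ 2 / 2) =
            i + (i * t) + (i * t) * t / 2 - e * (1 + t + t ^ 2 / 2) := by ring
        _ = _ := by rw [this]; ring
    have h₁₄ : 0 ≤ (1 + e) - 2 * e - e * t := by nlinarith
    have : 0 ≤ t / 2 * ((1 + e) - 2 * e - e * t) := by positivity
    linarith

/-- If the bins are about the quantiles of `u^A` and the low bins contribute no more than alignment
permits, then the additive objective captures all but a `log M / M` fraction of the principal's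
utility. -/
theorem le_contribution_of_quantiles (hM : 6 ≤ M) (hL : Regular M L) (hû : Nested M û)
    (hp : ∀ j, 1 ≤ j → j ≤ M → mass (InCum M û j) (best L) ≤ (j : ℚ) / M) {E : ℚ}
    (hE : mean (best L) (fun x => if InCum M û M x.agent then x.principal else 0) = E)
    (hal : ∀ j, 1 ≤ j → j ≤ M →
      mean (best L) (fun x => if InCum M û j x.agent then x.principal else 0) ≤
        2 * E * mass (InCum M û j) (best L)) :
    (1 - 10 / M * (1 + harmonic M)) * E ≤ (L.map (contribution M û)).sum := by
  have hM' : (6 : ℚ) ≤ M := by exact_mod_cast hM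
  have hN := best_nonneg hL.nonneg
  obtain ⟨Y, hY⟩ : ∃ Y : ℕ → ℚ,
      ∀ i, share (InCum M û i) (InCum M û (i + 1)) (best L) = Y i := ⟨_, fun _ => rfl⟩
  have hY₀ : ∀ i, 0 ≤ Y i := fun i => hY i ▸ share_nonneg _ _ hN
  have hcum : ∀ m ≤ M, ∑ i ∈ Finset.range m, Y i =
      mean (best L) fun x => if InCum M û m x.agent then x.principal else 0 := by
    intro m hm
    rw [← sum_share hû (best L) hm]
    exact Finset.sum_congr rfl fun i _ => (hY i).symm
  have hE₀ : 0 ≤ E := by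
    rw [← hE, ← hcum M le_rfl]
    exact Finset.sum_nonneg fun i _ => hY₀ i
  have hcum' : ∀ m, 1 ≤ m → m ≤ M → ∑ i ∈ Finset.range m, Y i ≤ 2 * E * (m / M) := by
    intro m h₁ h₂
    rw [hcum m h₂]
    exact (hal m h₁ h₂).trans (mul_le_mul_of_nonneg_left (hp m h₁ h₂) (by linarith))
  have hterm : ∀ i < M, Y i - 5 * (Y i / (i + 1)) ≤ coeff M (i + 1) * (L.map fun D =>
      share (InCum M û i) (InCum M û (i + 1)) D / mass (InCum M û (i + 1)) D).sum := by
    intro i hi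
    have hX₀ := sum_share_div_nonneg (û := û) hL i
    have hYX := share_best_le (P := InCum M û i) (Q := InCum M û (i + 1)) inCum_of_le hL.ne_nil
      hL.apart hL.nonneg
    rw [hY i, ← mass_best_inCum hL] at hYX
    obtain ⟨X, hX⟩ : ∃ X, (L.map fun D => share (InCum M û i) (InCum M û (i + 1)) D /
      mass (InCum M û (i + 1)) D).sum = X := ⟨_, rfl⟩
    rw [hX] at hX₀ hYX ⊢
    have hYX := hYX.trans (mul_le_mul_of_nonneg_right (hp (i + 1) (by omega) hi) hX₀)
    have hi₀ : (0 : ℚ) ≤ i := Nat.cast_nonneg i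
    have hiM : (i : ℚ) + 1 ≤ M := by exact_mod_cast hi
    push_cast at hYX
    rw [div_mul_eq_mul_div, le_div_iff₀ (by linarith)] at hYX
    have hlhs : Y i - 5 * (Y i / (i + 1)) = ((i : ℚ) - 4) * Y i / (i + 1) := by
      field_simp
      ring
    rw [hlhs, div_le_iff₀ (by linarith)]
    by_cases h6 : 6 ≤ i + 1
    · have hi5 : (5 : ℚ) ≤ i := by exact_mod_cast (by omega : 5 ≤ i)
      rw [coeff, if_pos h6]
      push_cast
      have h₁ : ((i : ℚ) + 1 - 5) / (M - 1) * X * (i + 1) =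
          ((i : ℚ) - 4) * ((i + 1) * X / (M - 1)) := by ring
      rw [h₁]
      refine mul_le_mul_of_nonneg_left ?_ (by linarith)
      rw [le_div_iff₀ (by linarith)]
      nlinarith [hY₀ i]
    · have hi4 : (i : ℚ) ≤ 4 := by exact_mod_cast (by omega : i ≤ 4)
      rw [coeff, if_neg h6]
      nlinarith [hY₀ i]
  -- summation by parts
  have habel : ∀ m ≤ M, ∑ i ∈ Finset.range m, Y i / (i + 1) ≤
      (∑ i ∈ Finset.range m, Y i) / m + 2 * E / M * harmonic m := by
    intro m hm
    induction m with
    | zero => simp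
    | succ m ih =>
      rw [Finset.sum_range_succ, Finset.sum_range_succ, harmonic_succ]
      have ih := ih (by omega)
      have hEM : 0 ≤ 2 * E / M := by positivity
      rcases Nat.eq_zero_or_pos m with rfl | hpos
      · simpa using hEM
      · have h₁ := hcum' m hpos (by omega)
        have hm₀ : (0 : ℚ) < m := by exact_mod_cast hpos
        have h₂ : (∑ i ∈ Finset.range m, Y i) / (m : ℚ) =
            (∑ i ∈ Finset.range m, Y i) / ((m : ℚ) + 1) +
              (∑ i ∈ Finset.range m, Y i) / m * ((m : ℚ) + 1)⁻¹ := by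
          field_simp
        have h₃ : (∑ i ∈ Finset.range m, Y i) / (m : ℚ) ≤ 2 * E / M := by
          rw [div_le_iff₀ hm₀]
          refine h₁.trans (le_of_eq ?_)
          ring
        have h₄ : (0 : ℚ) ≤ ((m : ℚ) + 1)⁻¹ := by positivity
        have h₅ := mul_le_mul_of_nonneg_right h₃ h₄
        push_cast
        rw [add_div, mul_add]
        linarith
  rw [sum_contribution]
  refine le_trans ?_ (Finset.sum_le_sum fun i hi => hterm i (Finset.mem_range.1 hi))
  rw [Finset.sum_sub_distrib, ← Finset.mul_sum, hcum M le_rfl, hE]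
  have h₁ := habel M le_rfl
  rw [hcum M le_rfl, hE] at h₁
  have h₂ : 0 ≤ E / M := by positivity
  have h₃ : 10 / (M : ℚ) * (1 + harmonic M) * E =
      5 * (E / M + 2 * E / M * harmonic M) + 5 * (E / M) := by ring
  linarith

end Bins

/-! ### Quantiles of the agent's utility -/

theorem total_best {L : List FDist} (hne : L ≠ []) (htot : ∀ D ∈ L, mass (fun _ => True) D = 1)
    (hap : L.Pairwise Apart) : mass (fun _ => True) (best L) = 1 := by
  rw [mass_best _ (fun _ _ _ _ => trivial) hne hap]
  refine List.prod_eq_one fun a ha => ?_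
  obtain ⟨D, hD, rfl⟩ := List.mem_map.1 ha
  exact htot D hD

/-- The agent utility from the favorite action has no large atoms, because each of its values comes from
a single action. -/
theorem mass_eq_best_le {M : ℕ} {L : List FDist} (hL : Regular M L) (s : ℚ) :
    mass (· = s) (best L) ≤ 1 / (M : ℚ) ^ 2 := by
  obtain ⟨hne, hnn, htot, hap, hle⟩ := hL
  induction L with
  | nil => exact absurd rfl hne
  | cons D L ih =>
    cases L with
    | nil => exact hle D (by simp) s
    | cons E L =>
      rw [List.pairwise_cons] at hap
      have hnn' : ∀ D' ∈ E :: L, D'.Nonneg := fun D' h => hnn D' (List.mem_cons_of_mem _ h)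
      have htot' : ∀ D' ∈ E :: L, mass (fun _ => True) D' = 1 := fun D' h =>
        htot D' (List.mem_cons_of_mem _ h)
      have ih := ih (by simp) hnn' htot' hap.2 fun D' h => hle D' (List.mem_cons_of_mem _ h)
      have hG := best_nonneg hnn'
      have hGtot := total_best (by simp) htot' hap.2
      have hF := hnn D (by simp)
      have hFtot := htot D (by simp)
      have hFle := hle D (by simp) s
      have hAp := apart_best hap.1
      change mean (better D (best (E :: L))) _ ≤ _
      rw [mean_better hAp (fun a _ => if a = s then 1 else 0)]
      -- the utility `s` occurs in at most one of the two distributions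
      by_cases hs : ∃ y ∈ best (E :: L), y.agent = s
      · obtain ⟨y, hy, hys⟩ := hs
        refine le_trans (mean_mono (h := fun _ => 1 * mass (· = s) (best (E :: L)))
          (fun x hx => (hF x hx).1) fun x hx => ?_) ?_
        · rw [one_mul]
          refine mean_mono (fun z hz => (hG z hz).1) fun z hz => ?_
          have : x.agent ≠ s := hys ▸ hAp x hx y hy
          by_cases hzx : z.agent < x.agent
          · simp only [hzx, if_true, this, if_false]
            split <;> norm_num
          · simp [hzx]
        · rw [mean_mul_right]
          have : mean D (fun _ => 1) = 1 := by simpa [mass] using hFtot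
          rw [this, one_mul]
          exact ih
      · push Not at hs
        refine le_trans (mean_mono (h := fun x => (if x.agent = s then 1 else 0) * 1)
          (fun x hx => (hF x hx).1) fun x hx => ?_) ?_
        · have : mean (best (E :: L)) (fun _ => 1) = 1 := by simpa [mass] using hGtot
          rw [← this, ← mean_mul_left]
          refine mean_mono (fun z hz => (hG z hz).1) fun z hz => ?_
          by_cases hzx : z.agent < x.agent
          · simp [hzx, this]
          · simp only [hzx, if_false, hs z hz, this]
            split <;> norm_num
        · simpa [mass] using hFle

/-- Every level `c ∈ [0, 1]` has a quantile in `S`, up to the largest probability of a single agent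
utility: the largest element of `S` with at most the mass `c` strictly below it. -/
theorem exists_quantile {M : ℕ} {L : List FDist} (hL : Regular M L) {S : List ℚ} (hS : S ≠ [])
    (hLS : ∀ x ∈ best L, x.agent ∈ S) {c : ℚ} (h₀ : 0 ≤ c) (h₁ : c ≤ 1) :
    ∃ u ∈ S, mass (· < u) (best L) ≤ c ∧ c - 1 / (M : ℚ) ^ 2 ≤ mass (· < u) (best L) ∧
      ∀ s ∈ S, mass (· < s) (best L) ≤ c → s ≤ u := by
  have hN := best_nonneg hL.nonneg
  have hS' : S.toFinset.Nonempty := by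
    obtain ⟨s, hs⟩ := List.exists_mem_of_ne_nil _ hS
    exact ⟨s, List.mem_toFinset.2 hs⟩
  have hne : (S.toFinset.filter fun s => mass (· < s) (best L) ≤ c).Nonempty := by
    refine ⟨S.toFinset.min' hS', Finset.mem_filter.2 ⟨Finset.min'_mem _ _, ?_⟩⟩
    refine le_of_eq_of_le ?_ h₀
    refine (mean_congr fun x hx => if_neg ?_).trans (mean_zero _)
    exact not_lt.2 (Finset.min'_le _ _ (List.mem_toFinset.2 (hLS x hx)))
  obtain ⟨u, hu, hmax⟩ := Finset.exists_max_image _ id hne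
  simp only [Finset.mem_filter, List.mem_toFinset, id] at hu hmax
  refine ⟨u, hu.1, hu.2, ?_, fun s hs h => hmax s ⟨hs, h⟩⟩
  have h₂ : c ≤ mass (· ≤ u) (best L) := by
    by_cases hex : (S.toFinset.filter fun s => u < s).Nonempty
    · -- nothing lies between `u` and the next element of `S`
      set v := (S.toFinset.filter fun s => u < s).min' hex with hv
      have hvm : v ∈ S.toFinset.filter fun s => u < s := Finset.min'_mem _ _
      rw [Finset.mem_filter, List.mem_toFinset] at hvm
      have h₃ : ¬ mass (· < v) (best L) ≤ c := fun h => (hmax v ⟨hvm.1, h⟩).not_gt hvm.2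
      refine (not_le.1 h₃).le.trans (mass_mono (fun x hx => (hN x hx).1) fun x hx hxv => ?_)
      by_contra hxu
      exact (Finset.min'_le _ _ (Finset.mem_filter.2
        ⟨List.mem_toFinset.2 (hLS x hx), not_le.1 hxu⟩)).not_gt hxv
    · rw [Finset.not_nonempty_iff_eq_empty, Finset.filter_eq_empty_iff] at hex
      refine h₁.trans (le_of_eq ?_)
      rw [← total_best hL.ne_nil hL.total hL.apart]
      exact mass_congr fun x hx => by simpa using hex (List.mem_toFinset.2 (hLS x hx))
  have h₃ : mass (· ≤ u) (best L) = mass (· < u) (best L) + mass (· = u) (best L) := by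
    rw [mass, mass, mass, ← mean_add]
    refine mean_congr fun x _ => ?_
    rcases lt_trichotomy x.agent u with h | h | h
    · simp [h, h.le, h.ne]
    · simp [h]
    · simp [h.not_ge, h.not_gt, h.ne']
  have h₄ := mass_eq_best_le hL u
  linarith

/-- For every configuration there is a guess of bins that are about the quantiles of its agent utility;
the last bin extends to the largest agent utility of any configuration. -/
theorem exists_guess {M : ℕ} (hM : 1 ≤ M) {L : List FDist} (hL : Regular M L) {S : List ℚ}
    (hLS : ∀ x ∈ best L, x.agent ∈ S) (hS : S ≠ []) :
    ∃ û : List ℚ, û.length = M ∧ (∀ u ∈ û, u ∈ S) ∧ û.IsChain (· ≤ ·) ∧ Nested M û ∧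
      (∀ s ∈ S, InCum M û M s) ∧
      (∀ j, 1 ≤ j → j ≤ M → (j : ℚ) / M - 1 / (M : ℚ) ^ 2 ≤ mass (InCum M û j) (best L) ∧
        mass (InCum M û j) (best L) ≤ (j : ℚ) / M) ∧
      ∀ j, 1 ≤ j → j < M → ∃ t, ∀ x, InCum M û j x ↔ x < t := by
  have hM' : (0 : ℚ) < M := by exact_mod_cast hM
  have hN := best_nonneg hL.nonneg
  have hex : ∀ j : ℕ, ∃ u, j ≤ M → u ∈ S ∧ mass (· < u) (best L) ≤ (j : ℚ) / M ∧
      (j : ℚ) / M - 1 / (M : ℚ) ^ 2 ≤ mass (· < u) (best L) ∧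
      ∀ s ∈ S, mass (· < s) (best L) ≤ (j : ℚ) / M → s ≤ u := by
    intro j
    by_cases hj : j ≤ M
    · obtain ⟨u, h⟩ := exists_quantile hL hS hLS (c := (j : ℚ) / M) (by positivity)
        ((div_le_one hM').2 (by exact_mod_cast hj))
      exact ⟨u, fun _ => h⟩
    · exact ⟨0, fun h => absurd h hj⟩
  choose u hu using hex
  have hmono : ∀ i j, i ≤ j → j ≤ M → u i ≤ u j := by
    intro i j hij hj
    refine (hu j hj).2.2.2 _ (hu i (hij.trans hj)).1 ((hu i (hij.trans hj)).2.1.trans ?_)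
    have : (i : ℚ) ≤ j := by exact_mod_cast hij
    exact div_le_div_of_nonneg_right this hM'.le
  have hmass1 : ∀ t, mass (· < t) (best L) ≤ 1 := by
    intro t
    rw [← total_best hL.ne_nil hL.total hL.apart]
    exact mass_mono (fun x hx => (hN x hx).1) fun _ _ _ => trivial
  have htop : ∀ s ∈ S, s ≤ u M := fun s hs => (hu M le_rfl).2.2.2 s hs (by
    rw [div_self hM'.ne']
    exact hmass1 s)
  set û := (List.range M).map fun i => u (i + 1) with hû
  have hget : ∀ j, j + 1 ≤ M → û.getD j 0 = u (j + 1) := by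
    intro j hj
    rw [List.getD_eq_getElem _ _ (by simp [hû]; omega)]
    simp [hû]
  have hcum : ∀ j, 1 ≤ j → j < M → ∀ x, InCum M û j x ↔ x < u j := by
    intro j h₁ h₂ x
    rw [InCum, if_neg h₂.ne, hget (j - 1) (by omega), Nat.sub_add_cancel h₁]
    exact and_iff_right (by omega)
  have hcumM : ∀ x, InCum M û M x ↔ x ≤ u M := by
    intro x
    rw [InCum, if_pos rfl, hget (M - 1) (by omega), Nat.sub_add_cancel hM]
    exact and_iff_right (by omega)
  refine ⟨û, by simp [hû], fun v hv => ?_, ?_, fun j hj x hx => ?_, fun s hs => (hcumM s).2 (htop s hs),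
    fun j h₁ h₂ => ?_, fun j h₁ h₂ => ⟨u j, hcum j h₁ h₂⟩⟩
  · obtain ⟨i, hi, rfl⟩ := List.mem_map.1 hv
    exact (hu (i + 1) (List.mem_range.1 hi)).1
  · refine List.Pairwise.isChain (List.pairwise_map.2 (List.pairwise_lt_range.imp_of_mem ?_))
    intro i j _ hj hij
    exact hmono _ _ (by omega) (List.mem_range.1 hj)
  · rcases Nat.eq_zero_or_pos j with rfl | hpos
    · exact absurd rfl hx.1
    · rw [hcum j hpos hj] at hx
      have hle := hmono j (j + 1) (by omega) hj
      rcases Nat.lt_or_ge (j + 1) M with h | h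
      · exact (hcum (j + 1) (by omega) h x).2 (hx.trans_le hle)
      · obtain rfl : M = j + 1 := by omega
        exact (hcumM x).2 (hx.le.trans hle)
  · rcases h₂.lt_or_eq with h | rfl
    · rw [mass_congr (Q := (· < u j)) fun x _ => hcum j h₁ h x.agent]
      exact ⟨(hu j h₂).2.2.1, (hu j h₂).2.1⟩
    · have htot : mass (InCum j û j) (best L) = 1 := by
        rw [← total_best hL.ne_nil hL.total hL.apart]
        exact mass_congr fun x hx => by simpa using (hcumM _).2 (htop _ (hLS x hx))
      rw [htot, div_self hM'.ne']
      have : (0 : ℚ) ≤ 1 / (j : ℚ) ^ 2 := by positivity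
      exact ⟨by linarith, le_rfl⟩

/-! ### The approximation guarantee -/

/-- All agent utilities of a preprocessed instance. -/
def support (J : List (List FDist)) : List ℚ :=
  J.flatMap fun A => A.flatMap fun D => D.map fun x => x.agent

theorem mem_guesses (M : ℕ) (J : List (List FDist)) (û : List ℚ) :
    û ∈ (guesses M J).val ↔
      û.length = M ∧ (∀ u ∈ û, u ∈ support J) ∧ û.IsChain (· ≤ ·) := by
  simp [guesses, mem_tuplesT, val_isMonotoneT, support, and_assoc]

theorem isConfiguration_zero {I : Instance} (hI : I.Valid) :
    IsConfiguration I (I.map fun _ => 0) := by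
  replace hI := hI.2
  induction I with
  | nil => exact .nil
  | cons A I ih =>
    exact .cons (List.length_pos_iff.2 (hI A (by simp)).1)
      (ih fun A hA => hI A (List.mem_cons_of_mem _ hA))

theorem IsRefinement.nonneg {M : ℕ} {β : ℚ → WithBot ℚ} {I : Instance} {J : List (List FDist)}
    (h : IsRefinement M β I J) : ∀ A ∈ J, ∀ D ∈ A, D.Nonneg := by
  intro A hA D hD
  obtain ⟨i, hi, rfl⟩ := List.getElem_of_mem hA
  have h₂ := h.refines.get (h.refines.length_eq ▸ hi) hi
  obtain ⟨j, hj, rfl⟩ := List.getElem_of_mem hD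
  exact (h₂.get (h₂.length_eq ▸ hj) hj).nonneg

/-- The output is a configuration, and no worse than what the dynamic program finds for any guess. -/
theorem algorithm_spec {M : ℕ} (hM : 1 ≤ M) {I : Instance} (hI : I.Valid) :
    IsConfiguration I (algorithm M I).val ∧
      ∀ û ∈ (guesses M (preprocess M I).val).val, ∀ C, (solve M (preprocess M I).val û).val = some C →
        expectedUtility I C ≤ expectedUtility I (algorithm M I).val := by
  obtain ⟨β, hJ⟩ := exists_isRefinement hM hI
  obtain ⟨J, hJ'⟩ : ∃ J, (preprocess M I).val = J := ⟨_, rfl⟩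
  rw [hJ'] at hJ ⊢
  have hsolve : ∀ û ∈ (guesses M J).val, ∀ C, (solve M J û).val = some C →
      IsConfiguration I C := fun û hû C hC =>
    hJ.isConfiguration_iff.2 ((solve_spec hJ.nonneg ((mem_guesses M J û).1 hû).1).1 C hC).1
  obtain ⟨f, hf⟩ : ∃ f : List ℚ → Option (ℚ × List ℕ), ∀ û, f û =
      (solve M J û).val.map fun C => ((evaluate J C).val, C) := ⟨_, fun _ => rfl⟩
  have hf' : ∀ û x, f û = some x ↔ (solve M J û).val = some x.2 ∧ (evaluate J x.2).val = x.1 := by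
    intro û x
    rw [hf, Option.map_eq_some_iff]
    constructor
    · rintro ⟨C, hC, rfl⟩
      exact ⟨hC, rfl⟩
    · rintro ⟨h₁, h₂⟩
      exact ⟨x.2, h₁, by rw [h₂]⟩
  have hval : (algorithm M I).val =
      match (guesses M J).val.foldl (fun b û => (betterT b (f û)).val) none with
      | some x => x.2
      | none => I.map fun _ => 0 := by
    simp only [algorithm, val_bind, hJ', val_foldT]
    generalize hr : List.foldl _ none (guesses M J).val = r
    have hr' : r = (guesses M J).val.foldl (fun b û => (betterT b (f û)).val) none := by
      rw [← hr]
      congr 1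
      funext b û
      rw [hf]
      cases (solve M J û).val with
      | none => cases b <;> rfl
      | some C => rfl
    rw [← hr']
    cases r with
    | none => simp
    | some x => rfl
  obtain ⟨h₁, h₂⟩ := foldl_betterT f (guesses M J).val none
  cases hr : (guesses M J).val.foldl (fun b û => (betterT b (f û)).val) none with
  | none =>
    rw [hr] at hval h₂
    rw [hval]
    refine ⟨isConfiguration_zero hI, fun û hû C hC => ?_⟩
    obtain ⟨x, hx, -⟩ := h₂ ((evaluate J C).val, C) (.inr ⟨û, hû, (hf' _ _).2 ⟨hC, rfl⟩⟩)
    exact absurd hx (by simp)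
  | some x =>
    rw [hr] at hval h₁ h₂
    rw [hval]
    obtain h | ⟨û₀, hû₀, h₀⟩ := h₁ x rfl
    · exact absurd h (by simp)
    · rw [hf'] at h₀
      have hx := hsolve û₀ hû₀ _ h₀.1
      refine ⟨hx, fun û hû C hC => ?_⟩
      have hC' := hsolve û hû C hC
      obtain ⟨y, hy, hle⟩ := h₂ ((evaluate J C).val, C) (.inr ⟨û, hû, (hf' _ _).2 ⟨hC, rfl⟩⟩)
      obtain rfl : x = y := by simpa using hy
      rw [hJ.expectedUtility_eq hI hC', hJ.expectedUtility_eq hI hx,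
        ← val_evaluate (hJ.isConfiguration_iff.1 hC'), ← val_evaluate (hJ.isConfiguration_iff.1 hx),
        h₀.2]
      exact hle

theorem IsRefinement.expectedUtility_nonneg {M : ℕ} {β : ℚ → WithBot ℚ} {I : Instance}
    {J : List (List FDist)} (h : IsRefinement M β I J) (hI : I.Valid) {C : List ℕ}
    (hC : IsConfiguration I C) : 0 ≤ expectedUtility I C := by
  have hN := best_nonneg (h.regular hI hC).nonneg
  rw [h.expectedUtility_eq hI hC]
  exact mean_nonneg (fun x hx => (hN x hx).1) fun x hx => (hN x hx).2

/-- The guess of the quantiles under an aligned optimal configuration makes that configuration feasible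
with a large additive objective, while the additive objective of the configuration that is found
instead is at most its utility. -/
theorem algorithm_ge {M : ℕ} (hM : 6 ≤ M) {I : Instance} (hI : I.Valid)
    (hal : IsUtilityAligned (fun _ => 2) I) {C : List ℕ} (hC : IsConfiguration I C) :
    (1 - 10 / M * (1 + harmonic M)) * expectedUtility I C ≤
        expectedUtility I (algorithm M I).val := by
  obtain ⟨Copt, ⟨hCo, hopt⟩, hal⟩ := hal
  obtain ⟨β, hJ⟩ := exists_isRefinement (by omega : 1 ≤ M) hI
  obtain ⟨-, hbest⟩ := algorithm_spec (by omega : 1 ≤ M) hI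
  obtain ⟨J, hJ'⟩ : ∃ J, (preprocess M I).val = J := ⟨_, rfl⟩
  rw [hJ'] at hJ hbest
  have hsupp : ∀ C, IsConfiguration I C → ∀ D ∈ picked J C, ∀ x ∈ D, x.agent ∈ support J := by
    intro C hC D hD x hx
    obtain ⟨A, hA, hD⟩ := mem_picked (hJ.isConfiguration_iff.1 hC) hD
    exact List.mem_flatMap.2 ⟨A, hA, List.mem_flatMap.2 ⟨D, hD, List.mem_map_of_mem hx⟩⟩
  have hL := hJ.regular hI hCo
  have hLS : ∀ x ∈ best (picked J Copt), x.agent ∈ support J := by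
    intro x hx
    obtain ⟨D, hD, y, hy, h, -⟩ := mem_best hx
    exact h ▸ hsupp _ hCo D hD y hy
  have hS : support J ≠ [] := by
    obtain ⟨D, hD⟩ := List.exists_mem_of_ne_nil _ hL.ne_nil
    have h₁ : D ≠ [] := by
      rintro rfl
      simpa [mass] using hL.total [] hD
    obtain ⟨x, hx⟩ := List.exists_mem_of_ne_nil _ h₁
    exact List.ne_nil_of_mem (hsupp _ hCo D hD x hx)
  obtain ⟨û, hlen, hmem, hchain, hnest, htop, hp, ht⟩ := exists_guess (by omega : 1 ≤ M) hL hLS hS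
  have hlenJ : ∀ C, IsConfiguration I C → (picked J C).length = J.length := by
    intro C hC
    have := (hJ.isConfiguration_iff.1 hC).length_eq
    simp only [picked, List.length_zipWith]
    omega
  have htop' : ∀ C, IsConfiguration I C → mass (InCum M û M) (best (picked J C)) = 1 := by
    intro C hC
    have hL := hJ.regular hI hC
    rw [mass_best_inCum hL]
    refine List.prod_eq_one fun a ha => ?_
    obtain ⟨D, hD, rfl⟩ := List.mem_map.1 ha
    rw [← hL.total D hD]
    exact mass_congr fun x hx => by simpa using htop _ (hsupp C hC D hD x hx)
  have hE := hJ.expectedUtility_eq hI hCo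
  have hE' : mean (best (picked J Copt)) (fun x => if InCum M û M x.agent then x.principal else 0) =
      expectedUtility I Copt := by
    rw [hE]
    exact mean_congr fun x hx => if_pos (htop _ (hLS x hx))
  have hE₀ := hJ.expectedUtility_nonneg hI hCo
  have hcon := constraints_of_quantiles hM hL hnest hp
  rw [hlenJ _ hCo] at hcon
  obtain ⟨hs₁, hs₂⟩ := solve_spec hJ.nonneg hlen
  obtain ⟨C', hC', hle⟩ := hs₂ Copt (hJ.isConfiguration_iff.1 hCo) hcon
  obtain ⟨hconf, hcon'⟩ := hs₁ C' hC'
  have hconf' := hJ.isConfiguration_iff.2 hconf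
  have h₁ := contribution_le hM (hJ.regular hI hconf') hnest (by rwa [hlenJ _ hconf'])
    (htop' C' hconf')
  rw [← hJ.expectedUtility_eq hI hconf'] at h₁
  have h₂ := hbest û ((mem_guesses M J û).2 ⟨hlen, hmem, hchain⟩) C' hC'
  have h₃ := le_contribution_of_quantiles hM hL hnest (fun j hj hj' => (hp j hj hj').2) hE' (by
    intro j hj hj'
    rcases hj'.lt_or_eq with h | rfl
    · obtain ⟨t, ht⟩ := ht j hj h
      have := hJ.share_le_of_aligned hI hCo hal t
      rw [mass_congr (Q := (· < t)) fun x _ => ht x.agent]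
      simpa only [ht] using this
    · rw [hE', htop' Copt hCo]
      linarith)
  have h₄ := h₃.trans (hle.trans (h₁.trans h₂))
  have h₅ := hopt C hC
  -- a negative factor is harmless, since utilities are nonnegative
  rcases le_or_gt 0 (1 - 10 / (M : ℚ) * (1 + harmonic M)) with h | h
  · exact (mul_le_mul_of_nonneg_left h₅ h).trans h₄
  · exact (mul_nonpos_of_nonpos_of_nonneg h.le
      (hJ.expectedUtility_nonneg hI hC)).trans
      (hJ.expectedUtility_nonneg hI (algorithm_spec (by omega : 1 ≤ M) hI).1)

theorem isApproximation_algorithm {M : ℕ} (hM : 2 ≤ M) :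
    IsApproximation (1 - 40 * (Real.log M / M)) (algorithm M) (IsUtilityAligned fun _ => 2) := by
  intro I hI hal
  have hM₀ : (2 : ℝ) ≤ M := by exact_mod_cast hM
  have hlog : 0.69 < Real.log M :=
    (by linarith [Real.log_two_gt_d9] : (0.69 : ℝ) < Real.log 2).trans_le
      (Real.log_le_log (by norm_num) hM₀)
  obtain ⟨β, hJ⟩ := exists_isRefinement (by omega : 1 ≤ M) hI
  have hconf := (algorithm_spec (by omega : 1 ≤ M) hI).1
  refine ⟨hconf, fun C hC => ?_⟩
  have hC₀ : (0 : ℝ) ≤ expectedUtility I C := by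
    exact_mod_cast hJ.expectedUtility_nonneg hI hC
  have hA₀ : (0 : ℝ) ≤ expectedUtility I (algorithm M I).val := by
    exact_mod_cast hJ.expectedUtility_nonneg hI hconf
  rcases Nat.lt_or_ge M 6 with h | h
  · have h₁ : (M : ℝ) ≤ 5 := by exact_mod_cast (by omega : M ≤ 5)
    have h₂ : 1 - 40 * (Real.log M / M) ≤ 0 := by
      have : 1 / 40 ≤ Real.log M / M := by
        rw [div_le_div_iff₀ (by norm_num) (by linarith)]
        linarith
      linarith
    exact (mul_nonpos_of_nonpos_of_nonneg h₂ hC₀).trans hA₀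
  · have h₁ : ((1 - 10 / (M : ℝ) * (1 + (harmonic M : ℝ))) * (expectedUtility I C : ℝ)) ≤
        expectedUtility I (algorithm M I).val := by
      have := (Rat.cast_le (K := ℝ)).2 (algorithm_ge h hI hal hC)
      push_cast at this
      exact this
    refine (mul_le_mul_of_nonneg_right ?_ hC₀).trans h₁
    have h₂ := harmonic_le_one_add_log M
    have h₃ : 10 / (M : ℝ) * (1 + (harmonic M : ℝ)) ≤ 40 * (Real.log M / M) := by
      rw [div_mul_eq_mul_div, mul_div_assoc']
      refine div_le_div_of_nonneg_right ?_ (by linarith)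
      linarith
    linarith

set_option linter.unusedSectionVars false

/-! ### Polynomial step bounds -/

/-- The computation takes at most `s ^ k` steps and its result satisfies `P`. -/
def Within (s k : ℕ) {α : Type} (x : Timed α) (P : α → Prop) : Prop :=
  x.time ≤ s ^ k ∧ P x.val

/-- The numerator and the denominator of `r` have `O(s ^ k)` bits. -/
def Small (s k : ℕ) (r : ℚ) : Prop := r.den ≤ 2 ^ s ^ k ∧ |r| ≤ 2 ^ s ^ k

section Rational

theorem add_two_pow_le {a b : ℕ} (ha : 1 ≤ a) (hb : 1 ≤ b) :
    (2 : ℚ) ^ a + 2 ^ b ≤ 2 ^ (a + b) := by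
  have h₁ : (2 : ℚ) ≤ 2 ^ a := by simpa using pow_le_pow_right₀ (by norm_num : (1 : ℚ) ≤ 2) ha
  have h₂ : (2 : ℚ) ≤ 2 ^ b := by simpa using pow_le_pow_right₀ (by norm_num : (1 : ℚ) ≤ 2) hb
  rw [pow_add]
  nlinarith

theorem add_den_le {r r' : ℚ} {a b : ℕ} (h : r.den ≤ 2 ^ a) (h' : r'.den ≤ 2 ^ b) :
    (r + r').den ≤ 2 ^ (a + b) := by
  rw [pow_add]
  exact (Nat.le_of_dvd (Nat.mul_pos r.den_pos r'.den_pos) (Rat.add_den_dvd r r')).trans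
    (Nat.mul_le_mul h h')

theorem add_abs_le {r r' : ℚ} {a b : ℕ} (ha : 1 ≤ a) (hb : 1 ≤ b) (h : |r| ≤ 2 ^ a)
    (h' : |r'| ≤ 2 ^ b) : |r + r'| ≤ 2 ^ (a + b) :=
  (abs_add_le r r').trans ((add_le_add h h').trans (add_two_pow_le ha hb))

theorem mul_den_le {r r' : ℚ} {a b : ℕ} (h : r.den ≤ 2 ^ a) (h' : r'.den ≤ 2 ^ b) :
    (r * r').den ≤ 2 ^ (a + b) := by
  rw [pow_add]
  exact (Nat.le_of_dvd (Nat.mul_pos r.den_pos r'.den_pos) (Rat.mul_den_dvd r r')).trans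
    (Nat.mul_le_mul h h')

theorem abs_num_eq (r : ℚ) : (r.num.natAbs : ℚ) = |r| * r.den := by
  rw [Nat.cast_natAbs, Int.cast_abs]
  conv_rhs => rw [← Rat.num_div_den r, abs_div, Nat.abs_cast]
  rw [Rat.num_div_den, div_mul_cancel₀]
  exact_mod_cast r.den_nz

theorem natAbs_num_le {r : ℚ} {a : ℕ} (h : r.den ≤ 2 ^ a) (h' : |r| ≤ 2 ^ a) :
    r.num.natAbs ≤ 2 ^ (2 * a) := by
  have h₁ : (r.den : ℚ) ≤ 2 ^ a := by exact_mod_cast h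
  have h₂ : (r.num.natAbs : ℚ) ≤ 2 ^ (2 * a) := by
    rw [abs_num_eq, two_mul, pow_add]
    exact mul_le_mul h' h₁ (Nat.cast_nonneg _) (by positivity)
  exact_mod_cast h₂

theorem inv_le {r : ℚ} {a : ℕ} (h : r.den ≤ 2 ^ a) (h' : |r| ≤ 2 ^ a) :
    r⁻¹.den ≤ 2 ^ (2 * a) ∧ |r⁻¹| ≤ 2 ^ a := by
  by_cases h₀ : r = 0
  · subst h₀
    simp [Nat.one_le_two_pow]
  · have hn : r.num ≠ 0 := Rat.num_ne_zero.2 h₀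
    constructor
    · rw [Rat.inv_def, Rat.divInt_eq_div]
      have : ((r.den : ℚ) / (r.num : ℚ)).den ∣ r.num.natAbs := by
        have := Rat.den_dvd (r.den : ℤ) r.num
        rw [Rat.divInt_eq_div] at this
        exact Int.natCast_dvd.1 (by exact_mod_cast this)
      exact (Nat.le_of_dvd (Int.natAbs_pos.2 hn) (by exact_mod_cast this)).trans (natAbs_num_le h h')
    · rw [abs_inv]
      have h₁ : (1 : ℚ) ≤ |r| * r.den := by
        rw [← abs_num_eq]
        exact_mod_cast Int.natAbs_pos.2 hn
      have h₂ : (r.den : ℚ) ≤ 2 ^ a := by exact_mod_cast h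
      have h₃ : 0 < |r| := abs_pos.2 h₀
      rw [inv_le_iff_one_le_mul₀ h₃]
      nlinarith

theorem bits_le {r : ℚ} {a : ℕ} (h : r.den ≤ 2 ^ a) (h' : |r| ≤ 2 ^ a) : bits r ≤ 3 * a + 3 := by
  have h₁ : Nat.size r.num.natAbs ≤ 2 * a + 1 :=
    Nat.size_le.2 ((natAbs_num_le h h').trans_lt (Nat.pow_lt_pow_right (by norm_num) (by omega)))
  have h₂ : Nat.size r.den ≤ a + 1 :=
    Nat.size_le.2 (h.trans_lt (Nat.pow_lt_pow_right (by norm_num) (by omega)))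
  unfold bits
  omega

end Rational

section Bounds

variable {s : ℕ} [hs : Fact (12 ≤ s)]

theorem one_le_pow_base (k : ℕ) : 1 ≤ s ^ k := Nat.one_le_pow _ _ (by have := hs.out; omega)

theorem pow_base_mono {j k : ℕ} (h : j ≤ k) : s ^ j ≤ s ^ k :=
  Nat.pow_le_pow_right (by have := hs.out; omega) h

theorem mul_pow_base_le {c : ℕ} (hc : c ≤ 12) (k : ℕ) : c * s ^ k ≤ s ^ (k + 1) := by
  rw [pow_succ, mul_comm]
  exact Nat.mul_le_mul_left _ (hc.trans hs.out)

namespace Small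

variable {k : ℕ} {r r' : ℚ}

theorem mono {j : ℕ} (h : Small s j r) (hjk : j ≤ k) : Small s k r := by
  have h₁ : s ^ j ≤ s ^ k := pow_base_mono hjk
  exact ⟨h.1.trans (Nat.pow_le_pow_right (by norm_num) h₁),
    h.2.trans (pow_le_pow_right₀ (by norm_num) h₁)⟩

theorem of_le {a : ℕ} (ha : a ≤ s ^ k) (h : r.den ≤ 2 ^ a) (h' : |r| ≤ 2 ^ a) : Small s k r :=
  ⟨h.trans (Nat.pow_le_pow_right (by norm_num) ha), h'.trans (pow_le_pow_right₀ (by norm_num) ha)⟩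

theorem natCast {n : ℕ} (hn : n ≤ s ^ k) : Small s k (n : ℚ) := by
  refine ⟨by simp [Nat.one_le_two_pow], ?_⟩
  rw [Nat.abs_cast]
  exact_mod_cast hn.trans Nat.lt_two_pow_self.le

theorem zero : Small s k 0 := ⟨by simp [Nat.one_le_two_pow], by simp⟩

theorem one : Small s k 1 := by
  simpa using natCast (s := s) (k := k) (n := 1) (one_le_pow_base k)

theorem neg (h : Small s k r) : Small s k (-r) := by simpa [Small] using h

theorem add (h : Small s k r) (h' : Small s k r') : Small s (k + 1) (r + r') := by
  have h₁ : 1 ≤ s ^ k := one_le_pow_base k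
  have h₂ : s ^ k + s ^ k ≤ s ^ (k + 1) := by
    rw [← two_mul]; exact mul_pow_base_le (by norm_num) k
  exact of_le h₂ (add_den_le h.1 h'.1) (add_abs_le h₁ h₁ h.2 h'.2)

theorem sub (h : Small s k r) (h' : Small s k r') : Small s (k + 1) (r - r') := by
  rw [sub_eq_add_neg]
  exact h.add h'.neg

theorem mul (h : Small s k r) (h' : Small s k r') : Small s (k + 1) (r * r') := by
  have h₂ : s ^ k + s ^ k ≤ s ^ (k + 1) := by
    rw [← two_mul]; exact mul_pow_base_le (by norm_num) k
  refine of_le h₂ (mul_den_le h.1 h'.1) ?_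
  rw [abs_mul, pow_add]
  exact mul_le_mul h.2 h'.2 (abs_nonneg _) (by positivity)

theorem div (h : Small s k r) (h' : Small s k r') : Small s (k + 1) (r / r') := by
  have h₂ : s ^ k + 2 * s ^ k ≤ s ^ (k + 1) := by
    rw [← one_add_mul]; exact mul_pow_base_le (by norm_num) k
  obtain ⟨h₃, h₄⟩ := inv_le h'.1 h'.2
  rw [div_eq_mul_inv]
  refine of_le h₂ (mul_den_le h.1 h₃) ?_
  rw [abs_mul, pow_add]
  refine mul_le_mul h.2 (h₄.trans (pow_le_pow_right₀ (by norm_num) (by omega))) (abs_nonneg _)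
    (by positivity)

theorem of_bits (h : bits r ≤ s) : Small s 1 r := by
  rw [bits] at h
  have h₁ : r.den ≤ 2 ^ s := (Nat.size_le.1 (by omega : Nat.size r.den ≤ s)).le
  have h₂ : r.num.natAbs ≤ 2 ^ s := (Nat.size_le.1 (by omega : Nat.size r.num.natAbs ≤ s)).le
  refine ⟨by simpa using h₁, ?_⟩
  rw [pow_one]
  have h₃ : |r| ≤ r.num.natAbs := by
    rw [abs_num_eq]
    exact le_mul_of_one_le_right (abs_nonneg _) (by exact_mod_cast r.den_pos)
  exact h₃.trans (by exact_mod_cast h₂)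

end Small

namespace Within

variable {α β : Type} {j k : ℕ} {x : Timed α} {P : α → Prop}

theorem mono {Q : α → Prop} (h : Within s j x P) (hjk : j ≤ k) (hPQ : ∀ a, P a → Q a) :
    Within s k x Q := ⟨h.1.trans (pow_base_mono hjk), hPQ _ h.2⟩

theorem pure {a : α} (h : P a) : Within s k (Pure.pure a) P := ⟨Nat.zero_le _, h⟩

/-- Composition costs one power of `s`; the exponent grows with the length of a sequence of
computations, and not with the lengths of lists. -/
theorem bind {f : α → Timed β} {Q : β → Prop} (hx : Within s j x P) (hjk : j ≤ k)
    (hf : ∀ a, P a → Within s k (f a) Q) : Within s (k + 1) (x >>= f) Q := by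
  obtain ⟨h₁, h₂⟩ := hf _ hx.2
  refine ⟨?_, h₂⟩
  have h₃ : s ^ j ≤ s ^ k := pow_base_mono hjk
  have h₄ : 2 * s ^ k ≤ s ^ (k + 1) := mul_pow_base_le (by norm_num) k
  have h₅ := hx.1
  change x.time + (f x.val).time ≤ _
  omega

/-- The result may be replaced by its exact value. -/
theorem and_val (h : Within s k x P) : Within s k x fun a => P a ∧ a = x.val := ⟨h.1, h.2, rfl⟩

theorem tick : Within s k (tick 1) fun _ => True := ⟨one_le_pow_base k, trivial⟩

theorem natOp {a b : ℕ} (ha : a ≤ s ^ k) (hb : b ≤ s ^ k) (r : α) :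
    Within s (2 * k + 2) (natOp a b r) (· = r) := by
  refine ⟨?_, rfl⟩
  have h₁ : Nat.size a ≤ a := Nat.size_le.2 Nat.lt_two_pow_self
  have h₂ : Nat.size b ≤ b := Nat.size_le.2 Nat.lt_two_pow_self
  have h₃ : 3 * s ^ k ≤ s ^ (k + 1) := mul_pow_base_le (by norm_num) k
  have h₄ : 1 ≤ s ^ k := one_le_pow_base k
  calc (Nat.size a + Nat.size b + 1) ^ 2 ≤ (s ^ (k + 1)) ^ 2 := Nat.pow_le_pow_left (by omega) 2
    _ = s ^ (2 * k + 2) := by rw [← pow_mul]; congr 1; ring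

theorem ratOp {a b : ℚ} (ha : Small s k a) (hb : Small s k b) (r : α) :
    Within s (2 * k + 2) (ratOp a b r) (· = r) := by
  refine ⟨?_, rfl⟩
  have h₁ := bits_le ha.1 ha.2
  have h₂ := bits_le hb.1 hb.2
  have h₃ : 12 * s ^ k ≤ s ^ (k + 1) := mul_pow_base_le le_rfl k
  have h₄ : 1 ≤ s ^ k := one_le_pow_base k
  calc (bits a + bits b) ^ 2 ≤ (s ^ (k + 1)) ^ 2 := Nat.pow_le_pow_left (by omega) 2
    _ = s ^ (2 * k + 2) := by rw [← pow_mul]; congr 1; ring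

section Lists

variable {a b : ℕ} {l : List α}

theorem length_mul_le {n c : ℕ} (hc : c ≤ 6) (hn : n ≤ s ^ a) :
    n * (c * s ^ b) + 1 ≤ s ^ (a + b + 1) := by
  have h₁ : 12 * s ^ (a + b) ≤ s ^ (a + b + 1) := mul_pow_base_le le_rfl _
  have h₂ : 1 ≤ s ^ (a + b) := one_le_pow_base _
  have h₃ : n * (c * s ^ b) ≤ s ^ a * (6 * s ^ b) := by gcongr
  have h₄ : s ^ a * (6 * s ^ b) = 6 * s ^ (a + b) := by ring
  omega

theorem lengthT (h : l.length ≤ s ^ a) :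
    Within s (a + 1) (lengthT l) (· = l.length) := by
  refine ⟨?_, rfl⟩
  have := length_mul_le (b := 0) (by norm_num : 1 ≤ 6) h
  simpa [UtilityConfiguration.lengthT] using this

theorem getT {i : ℕ} {d : α} (h : i ≤ s ^ a) : Within s (a + 1) (getT l i d) (· = l.getD i d) := by
  refine ⟨?_, rfl⟩
  have := length_mul_le (b := 0) (by norm_num : 1 ≤ 6) h
  simpa [UtilityConfiguration.getT] using this

theorem rangeT {n : ℕ} (h : n ≤ s ^ a) : Within s (a + 1) (rangeT n) (· = List.range n) := by
  refine ⟨?_, rfl⟩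
  have := length_mul_le (b := 0) (by norm_num : 1 ≤ 6) h
  simpa [UtilityConfiguration.rangeT] using this

theorem enumerateT (h : l.length ≤ s ^ a) :
    Within s (a + 1) (enumerateT l) (· = l.zipIdx) := by
  refine ⟨?_, rfl⟩
  have := length_mul_le (b := 0) (by norm_num : 1 ≤ 6) h
  simpa [UtilityConfiguration.enumerateT] using this

theorem appendT {l' : List α} (h : l.length ≤ s ^ a) :
    Within s (a + 1) (appendT l l') (· = l ++ l') := by
  refine ⟨?_, rfl⟩
  have := length_mul_le (b := 0) (by norm_num : 1 ≤ 6) h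
  simpa [UtilityConfiguration.appendT] using this

theorem mapT {f : α → Timed β} {P : β → Prop} (hl : l.length ≤ s ^ a)
    (hf : ∀ x ∈ l, Within s b (f x) P) :
    Within s (a + b + 1) (mapT f l) fun r => r.length = l.length ∧ ∀ y ∈ r, P y := by
  have key : (UtilityConfiguration.mapT f l).time ≤ l.length * (2 * s ^ b) + 1 := by
    clear hl
    induction l with
    | nil => exact (by simp : 1 + 0 ≤ 0 * _ + 1)
    | cons x l ih =>
      have ih := ih fun y hy => hf y (List.mem_cons_of_mem _ hy)
      have h₁ := (hf x (by simp)).1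
      have h₂ : 1 ≤ s ^ b := one_le_pow_base b
      change 1 + ((f x).time + ((UtilityConfiguration.mapT f l).time + 0)) ≤ _
      rw [List.length_cons, add_mul]
      omega
  refine ⟨key.trans (length_mul_le (by norm_num) hl), ?_, ?_⟩
  · simp
  · intro y hy
    rw [val_mapT, List.mem_map] at hy
    obtain ⟨x, hx, rfl⟩ := hy
    exact (hf x hx).2

theorem filterT {p : α → Timed Bool} (hl : l.length ≤ s ^ a)
    (hp : ∀ x ∈ l, Within s b (p x) fun _ => True) :
    Within s (a + b + 1) (filterT p l) fun r => r.Sublist l := by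
  have key : (UtilityConfiguration.filterT p l).time ≤ l.length * (2 * s ^ b) + 1 := by
    clear hl
    induction l with
    | nil => exact (by simp : 1 + 0 ≤ 0 * _ + 1)
    | cons x l ih =>
      have ih := ih fun y hy => hp y (List.mem_cons_of_mem _ hy)
      have h₁ := (hp x (by simp)).1
      have h₂ : 1 ≤ s ^ b := one_le_pow_base b
      change 1 + ((p x).time + ((UtilityConfiguration.filterT p l).time + 0)) ≤ _
      rw [List.length_cons, add_mul]
      omega
  refine ⟨key.trans (length_mul_le (by norm_num) hl), ?_⟩
  rw [val_filterT]
  exact List.filter_sublist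

theorem flatMapT {f : α → Timed (List β)} {P : β → Prop} (hl : l.length ≤ s ^ a)
    (hf : ∀ x ∈ l, Within s b (f x) fun r => r.length ≤ s ^ b ∧ ∀ y ∈ r, P y) :
    Within s (a + b + 1) (flatMapT f l) fun r => r.length ≤ s ^ (a + b) ∧ ∀ y ∈ r, P y := by
  have key : (UtilityConfiguration.flatMapT f l).time ≤ l.length * (4 * s ^ b) + 1 ∧
      (l.flatMap fun x => (f x).val).length ≤ l.length * s ^ b := by
    clear hl
    induction l with
    | nil => exact ⟨(by simp : 1 + 0 ≤ 0 * _ + 1), by simp⟩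
    | cons x l ih =>
      obtain ⟨ih₁, ih₂⟩ := ih fun y hy => hf y (List.mem_cons_of_mem _ hy)
      obtain ⟨h₁, h₂, -⟩ := hf x (by simp)
      have h₃ : 1 ≤ s ^ b := one_le_pow_base b
      constructor
      · change 1 + ((f x).time + ((UtilityConfiguration.flatMapT f l).time +
          ((f x).val.length + 1))) ≤ _
        rw [List.length_cons, add_mul]
        omega
      · rw [List.flatMap_cons, List.length_append, List.length_cons, add_mul]
        omega
  refine ⟨key.1.trans (length_mul_le (by norm_num) hl), ?_, ?_⟩
  · rw [val_flatMapT, pow_add]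
    exact key.2.trans (Nat.mul_le_mul_right _ hl)
  · intro y hy
    rw [val_flatMapT, List.mem_flatMap] at hy
    obtain ⟨x, hx, hy⟩ := hy
    exact (hf x hx).2.2 y hy

/-- Bound for a fold with an invariant that may refer to the elements still to come. -/
theorem foldT {f : β → α → Timed β} (Inv : List α → β → Prop) {c : β} (hl : l.length ≤ s ^ a)
    (h₀ : Inv l c)
    (hf : ∀ x ∈ l, ∀ l' c, l'.length < l.length → Inv (x :: l') c →
      Within s b (f c x) (Inv l')) :
    Within s (a + b + 1) (foldT f c l) (Inv []) := by
  have key : (UtilityConfiguration.foldT f c l).time ≤ l.length * (2 * s ^ b) + 1 ∧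
      Inv [] (UtilityConfiguration.foldT f c l).val := by
    clear hl
    induction l generalizing c with
    | nil => exact ⟨(by simp : 1 + 0 ≤ 0 * _ + 1), h₀⟩
    | cons x l ih =>
      obtain ⟨h₁, h₂⟩ := hf x (by simp) l c (by simp) h₀
      obtain ⟨h₃, h₄⟩ := ih h₂ fun y hy l' c hl' =>
        hf y (List.mem_cons_of_mem _ hy) l' c (by rw [List.length_cons]; omega)
      have h₅ : 1 ≤ s ^ b := one_le_pow_base b
      refine ⟨?_, h₄⟩
      change 1 + ((f c x).time + (UtilityConfiguration.foldT f _ l).time) ≤ _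
      rw [List.length_cons, add_mul]
      omega
  exact ⟨key.1.trans (length_mul_le (by norm_num) hl), key.2⟩

/-- Bound for a fold with an invariant that may refer to the number of elements seen so far. -/
theorem foldT_index {f : β → α → Timed β} (Inv : ℕ → β → Prop) {c : β} (hl : l.length ≤ s ^ a)
    (h₀ : Inv 0 c)
    (hf : ∀ x ∈ l, ∀ i c, i < l.length → Inv i c → Within s b (f c x) (Inv (i + 1))) :
    Within s (a + b + 1) (UtilityConfiguration.foldT f c l) (Inv l.length) := by
  refine (foldT (fun l' c => l'.length ≤ l.length ∧ Inv (l.length - l'.length) c) hl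
    ⟨le_rfl, by simpa using h₀⟩ fun x hx l' c hl' hc => ?_).mono le_rfl
    fun c hc => by simpa using hc.2
  refine (hf x hx _ c ?_ hc.2).mono le_rfl fun c hc => ⟨hl'.le, ?_⟩
  · rw [List.length_cons]; omega
  · rwa [List.length_cons, show l.length - (l'.length + 1) + 1 = l.length - l'.length by omega] at hc

theorem allT {p : α → Timed Bool} (hl : l.length ≤ s ^ a)
    (hp : ∀ x ∈ l, Within s b (p x) fun _ => True) :
    Within s (a + b + 1) (allT p l) fun _ => True := by
  have key : (UtilityConfiguration.allT p l).time ≤ l.length * (2 * s ^ b) + 1 := by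
    clear hl
    induction l with
    | nil => exact (by simp : 1 + 0 ≤ 0 * _ + 1)
    | cons x l ih =>
      have ih := ih fun y hy => hp y (List.mem_cons_of_mem _ hy)
      have h₁ := (hp x (by simp)).1
      have h₂ : 1 ≤ s ^ b := one_le_pow_base b
      change 1 + ((p x).time +
        (if (p x).val then UtilityConfiguration.allT p l else Pure.pure false).time) ≤ _
      rw [List.length_cons, add_mul]
      split
      · omega
      · change 1 + ((p x).time + 0) ≤ _
        omega
  exact ⟨key.trans (length_mul_le (by norm_num) hl), trivial⟩

theorem tuplesT {S : List α} (hS : S.length ≤ s ^ a) (n : ℕ) :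
    Within s (a * n + n + 4) (tuplesT S n) fun T => T.length ≤ s ^ (a * n) ∧
      ∀ t ∈ T, t.length = n ∧ ∀ x ∈ t, x ∈ S := by
  have hlen : ∀ n, (UtilityConfiguration.tuplesT S n).val.length = S.length ^ n := by
    intro n
    induction n with
    | zero => rfl
    | succ n ih =>
      simp [UtilityConfiguration.tuplesT, List.length_flatMap, ih, pow_succ, mul_comm]
  refine ⟨?_, ?_, fun t ht => (mem_tuplesT S n t).1 ht⟩
  · induction n with
    | zero =>
      refine (one_le_pow_base (s := s) _).trans' ?_
      exact le_of_eq (by rfl)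
    | succ n ih =>
      have h : Within s (a * (n + 1) + (n + 1) + 4) (UtilityConfiguration.tuplesT S (n + 1))
          fun _ => True := by
        refine Within.bind (k := a * (n + 1) + n + 4)
          (P := fun T => T = (UtilityConfiguration.tuplesT S n).val) ⟨ih, rfl⟩
          (by rw [mul_add]; omega) fun T hT => ?_
        have hT' : T.length ≤ s ^ (a * n) := by
          rw [hT, hlen, pow_mul]
          exact Nat.pow_le_pow_left hS n
        refine (flatMapT (b := a * n + 2) (P := fun _ => True) hS fun x _ => ?_).mono
          (by rw [mul_add]; omega) fun _ _ => trivial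
        refine (mapT (b := 1) (P := fun _ => True) hT' fun t _ =>
          Within.bind tick le_rfl fun _ _ => .pure trivial).mono (by omega) fun r hr =>
            ⟨hr.1 ▸ hT'.trans (pow_base_mono (by omega)), fun _ _ => trivial⟩
      exact h.1
  · rw [hlen, pow_mul]
    exact Nat.pow_le_pow_left hS n

end Lists

end Within

end Bounds

/-! ### Step bounds for preprocessing -/

section Preprocessing

variable {s : ℕ} [hs : Fact (12 ≤ s)]

/-- All three numbers of a point mass have `O(s ^ k)` bits. -/
def SmallPoint (s k : ℕ) (x : MassPoint ℚ) : Prop :=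
  Small s k x.agent ∧ Small s k x.principal ∧ Small s k x.prob

/-- Denominators multiply in a sum of unrelated fractions, so their bit lengths add up. -/
theorem Within.sumT {l : List ℚ} {a b : ℕ} (hl : l.length ≤ s ^ a) (h : ∀ r ∈ l, Small s b r) :
    Within s (3 * a + 2 * b + 5) (sumT l) (Small s (a + b + 1)) := by
  have hB : 1 ≤ s ^ b := one_le_pow_base b
  have hle : ∀ i ≤ l.length, i * s ^ b + 1 ≤ s ^ (a + b + 1) := fun i hi =>
    (Nat.add_le_add_right (Nat.mul_le_mul_left i (by omega : s ^ b ≤ 1 * s ^ b)) 1).trans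
      (length_mul_le (by norm_num) (hi.trans hl))
  refine (Within.foldT_index (b := 2 * (a + b + 1) + 2)
    (fun i c => c.den ≤ 2 ^ (i * s ^ b + 1) ∧ |c| ≤ 2 ^ (i * s ^ b + 1)) hl (by simp)
    fun r hr i c hi hc => ?_).mono (by omega) fun c hc => Small.of_le (hle _ le_rfl) hc.1 hc.2
  refine (Within.ratOp (Small.of_le (hle i hi.le) hc.1 hc.2)
    ((h r hr).mono (by omega)) _).mono le_rfl ?_
  rintro _ rfl
  rw [show (i + 1) * s ^ b + 1 = (i * s ^ b + 1) + s ^ b by ring]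
  exact ⟨add_den_le hc.1 (h r hr).1, add_abs_le (by omega) hB hc.2 (h r hr).2⟩

theorem length_points_le {I : Instance} {a : ℕ} (h : ∀ A ∈ I, A.length ≤ a)
    (h' : ∀ A ∈ I, ∀ D ∈ A, D.length ≤ a) : (points I).length ≤ I.length * (a * a) := by
  rw [points, List.length_flatMap]
  refine (List.sum_le_card_nsmul _ (a * a) fun n hn => ?_).trans (by simp)
  obtain ⟨Ai, hAi, rfl⟩ := List.mem_map.1 hn
  have hA := List.fst_mem_of_mem_zipIdx hAi
  rw [List.length_flatMap]
  refine (List.sum_le_card_nsmul _ a fun n hn => ?_).trans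
    (by simpa using Nat.mul_le_mul_right a (h _ hA))
  obtain ⟨Dj, hDj, rfl⟩ := List.mem_map.1 hn
  simpa using h' _ hA _ (List.fst_mem_of_mem_zipIdx hDj)

/-- An instance whose lists and numbers are bounded by `s`. -/
structure Bounded (s : ℕ) (I : Instance) : Prop where
  length_le : I.length ≤ s
  length_action_le : ∀ A ∈ I, A.length ≤ s
  length_dist_le : ∀ A ∈ I, ∀ D ∈ A, D.length ≤ s
  agent : ∀ A ∈ I, ∀ D ∈ A, ∀ x ∈ D, ∀ a : ℚ, x.agent = a → Small s 1 a
  principal : ∀ A ∈ I, ∀ D ∈ A, ∀ x ∈ D, Small s 1 x.principal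
  prob : ∀ A ∈ I, ∀ D ∈ A, ∀ x ∈ D, Small s 1 x.prob

variable {I : Instance}

theorem tag_le_of_mem_points (hI : Bounded s I) {x : (ℕ × ℕ) × MassPoint (WithBot ℚ)}
    (hx : x ∈ points I) : x.1.1 ≤ s ∧ x.1.2 ≤ s := by
  obtain ⟨Ai, hAi, hx⟩ := List.mem_flatMap.1 hx
  obtain ⟨Dj, hDj, hx⟩ := List.mem_flatMap.1 hx
  obtain ⟨y, -, rfl⟩ := List.mem_map.1 hx
  have h₁ := List.snd_lt_of_mem_zipIdx hAi
  have h₂ := List.snd_lt_of_mem_zipIdx hDj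
  have h₃ := hI.length_le
  have h₄ := hI.length_action_le _ (List.fst_mem_of_mem_zipIdx hAi)
  simp only
  omega

theorem Within.allPoints (hI : Bounded s I) :
    Within s 10 (allPoints I) fun L => L = points I ∧ L.length ≤ s ^ 3 := by
  have key : Within s 10 (UtilityConfiguration.allPoints I) fun _ => True := by
    refine .bind (Within.enumerateT (a := 1) (by simpa using hI.length_le)) (by norm_num) ?_
    rintro _ rfl
    refine (Within.flatMapT (a := 1) (b := 7) (P := fun _ => True)
      (by simpa using hI.length_le) fun Ai hAi => ?_).mono (by norm_num) fun _ _ => trivial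
    have hA := List.fst_mem_of_mem_zipIdx hAi
    refine .bind (Within.enumerateT (a := 1) (by simpa using hI.length_action_le _ hA))
      (by norm_num) ?_
    rintro _ rfl
    refine (Within.flatMapT (a := 1) (b := 3) (P := fun _ => True)
      (by simpa using hI.length_action_le _ hA) fun Dj hDj => ?_).mono (by norm_num) fun r hr =>
        ⟨hr.1.trans (pow_base_mono (by norm_num)), hr.2⟩
    have hD := hI.length_dist_le _ hA _ (List.fst_mem_of_mem_zipIdx hDj)
    refine (Within.mapT (a := 1) (b := 1) (P := fun _ => True) (by simpa using hD) fun x _ =>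
      .bind Within.tick le_rfl fun _ _ => .pure trivial).mono (by norm_num) fun r hr => ?_
    refine ⟨hr.1 ▸ hD.trans ?_, hr.2⟩
    simpa using pow_base_mono (s := s) (by norm_num : 1 ≤ 3)
  refine ⟨key.1, val_allPoints I, ?_⟩
  rw [val_allPoints]
  refine (length_points_le hI.length_action_le hI.length_dist_le).trans ?_
  rw [show s ^ 3 = s * (s * s) by ring]
  exact Nat.mul_le_mul_right _ hI.length_le

theorem Within.bottomT {L : List ((ℕ × ℕ) × MassPoint (WithBot ℚ))} (hL : L.length ≤ s ^ 3)
    (h : ∀ x ∈ L, ∀ a : ℚ, x.2.agent = a → Small s 1 a) :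
    Within s 10 (bottomT L) (Small s 2) := by
  refine .bind (Within.foldT_index (b := 5) (fun _ c => Small s 1 c) hL .zero ?_)
    (by norm_num) fun c hc => ?_
  · rintro ⟨t, ⟨xa, xp, xq⟩⟩ hx i c _ hc
    cases xa with
    | bot => exact .bind (Within.tick (k := 4)) le_rfl fun _ _ => .pure hc
    | coe a =>
      have ha := h _ hx a rfl
      refine .bind (Within.ratOp ha hc _) (by norm_num) fun b _ => .pure ?_
      split
      · exact ha
      · exact hc
  · refine (Within.ratOp hc .one _).mono (by norm_num) ?_
    rintro _ rfl
    exact hc.sub .one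

theorem Within.insertT {τ : Type} (x : τ × MassPoint ℚ) {l : List (τ × MassPoint ℚ)} {a : ℕ}
    (hl : l.length ≤ s ^ a) (hx : Small s 1 x.2.principal)
    (h : ∀ y ∈ l, Small s 1 y.2.principal) :
    Within s (a + 5) (insertT x l) fun _ => True := by
  have key : (UtilityConfiguration.insertT x l).time ≤ l.length * (2 * s ^ 4) + 1 := by
    clear hl
    induction l with
    | nil => exact (by simp : 1 + 0 ≤ 0 * _ + 1)
    | cons y l ih =>
      have ih := ih fun z hz => h z (List.mem_cons_of_mem _ hz)
      have h₁ := (Within.ratOp hx (h y (by simp)) (decide (x.2.principal ≤ y.2.principal))).1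
      have h₂ : 1 ≤ s ^ 4 := one_le_pow_base 4
      rw [List.length_cons, add_mul]
      change 1 + ((leT x.2.principal y.2.principal).time +
        (if decide (x.2.principal ≤ y.2.principal) = true then Pure.pure (x :: y :: l) else _ :
          Timed _).time) ≤ _
      change (leT x.2.principal y.2.principal).time ≤ s ^ 4 at h₁
      split
      · change 1 + (_ + 0) ≤ _
        omega
      · change 1 + (_ + ((UtilityConfiguration.insertT x l).time + 0)) ≤ _
        omega
  exact ⟨(key.trans (length_mul_le (by norm_num) hl)).trans (pow_base_mono (by omega)), trivial⟩

theorem Within.sortT {τ : Type} {l : List (τ × MassPoint ℚ)} {a : ℕ}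
    (hl : l.length ≤ s ^ a) (h : ∀ y ∈ l, Small s 1 y.2.principal) :
    Within s (2 * a + 6) (sortT l) fun r => r.Perm l := by
  have key : (UtilityConfiguration.sortT l).time ≤ l.length * (2 * s ^ (a + 5)) + 1 := by
    induction l with
    | nil => exact (by simp : 1 + 0 ≤ 0 * _ + 1)
    | cons y l ih =>
      have ih := ih ((Nat.le_succ _).trans hl) fun z hz => h z (List.mem_cons_of_mem _ hz)
      have h₁ := (Within.insertT y (l := (UtilityConfiguration.sortT l).val) (a := a)
        ((sortT_perm l).length_eq ▸ (Nat.le_succ _).trans hl) (h y (by simp))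
        fun z hz => h z (List.mem_cons_of_mem _ ((sortT_perm l).mem_iff.1 hz))).1
      rw [List.length_cons, add_mul]
      change (UtilityConfiguration.sortT l).time + (UtilityConfiguration.insertT y _).time ≤ _
      omega
  exact ⟨(key.trans (length_mul_le (by norm_num) hl)).trans (pow_base_mono (by omega)),
    sortT_perm l⟩

theorem Within.minGapT {S : List ℚ} (hS : S.length ≤ s ^ 3) (h : ∀ a ∈ S, Small s 2 a) :
    Within s 20 (minGapT S) (Small s 3) := by
  refine (Within.foldT_index (b := 15) (fun _ g => Small s 3 g) hS .one fun a ha i g _ hg =>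
    ?_).mono (by norm_num) fun _ h => h
  refine (Within.foldT_index (b := 11) (fun _ g => Small s 3 g) hS hg fun b hb i g _ hg =>
    ?_).mono (by norm_num) fun _ h => h
  refine .bind (Within.ratOp (h b hb) (h a ha) _) (by norm_num) ?_
  rintro _ rfl
  have hd := (h b hb).sub (h a ha)
  refine .bind (Within.ratOp .zero hd _) (by norm_num) fun _ _ => ?_
  refine .bind (Within.ratOp hd hg _) (by norm_num) fun _ _ => .pure ?_
  split
  · exact hd
  · exact hg

theorem sq_add_one_le {M : ℕ} (hM : M ≤ s) : M ^ 2 + 1 ≤ s ^ 3 := by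
  have h₁ : M ^ 2 ≤ s ^ 2 := Nat.pow_le_pow_left hM 2
  have h₂ : 2 * s ^ 2 ≤ s ^ 3 := mul_pow_base_le (by norm_num) 2
  have h₃ : 1 ≤ s ^ 2 := one_le_pow_base 2
  omega

theorem Small.unit {M : ℕ} (hM : M ≤ s) : Small s 3 (1 / (M : ℚ) ^ 2) := by
  refine Small.div .one ?_
  rw [← Nat.cast_pow]
  exact .natCast (Nat.pow_le_pow_left hM 2)

/-- The counter `l` of pieces advances by at most `M² + 1`. -/
theorem Within.splitPoint {M : ℕ} (hM₁ : 1 ≤ M) (hM : M ≤ s) {δ : ℚ} (hδ : Small s 7 δ) {l : ℕ}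
    (hl : l + (M ^ 2 + 1) ≤ s ^ 6) {x : MassPoint ℚ} (hx : SmallPoint s 2 x) (hx₁ : x.prob ≤ 1) :
    Within s 40 (splitPoint M δ l x) fun r => r.1 ≤ l + (M ^ 2 + 1) ∧
      r.2.length ≤ M ^ 2 + 1 ∧ ∀ y ∈ r.2, SmallPoint s 9 y := by
  have hu := Small.unit (s := s) hM
  have hM2 : M ^ 2 ≤ s ^ 2 := Nat.pow_le_pow_left hM 2
  obtain ⟨hxa, hxp, hxq⟩ := hx
  refine .bind (Within.ratOp (hxq.mono (by norm_num)) hu _) (by norm_num) ?_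
  rintro _ rfl
  have hsc := (hxq.mono (by norm_num : 2 ≤ 3)).div hu
  refine .bind (Within.ratOp hsc hsc _) (by norm_num) ?_
  rintro _ rfl
  have hk := floor_pieces_le hM₁ hx₁
  obtain ⟨k, hk'⟩ : ∃ k, ⌊x.prob / (1 / (M : ℚ) ^ 2)⌋₊ = k := ⟨_, rfl⟩
  rw [hk'] at hk ⊢
  refine .bind (Within.rangeT (a := 2) (hk.trans hM2)) (by norm_num) ?_
  rintro _ rfl
  have hag : ∀ k' ≤ k, Small s 9 (x.agent + δ * ((l + k' : ℕ) : ℚ)) := fun k' hk' =>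
    (hxa.mono (by norm_num)).add (hδ.mul (.natCast
      ((by omega : l + k' ≤ l + (M ^ 2 + 1)).trans (hl.trans (pow_base_mono (by norm_num))))))
  have hshift : ∀ k' ≤ k, Small s 8 (δ * ((l + k' : ℕ) : ℚ)) := fun k' hk' =>
    hδ.mul (.natCast
      ((by omega : l + k' ≤ l + (M ^ 2 + 1)).trans (hl.trans (pow_base_mono (by norm_num)))))
  have hnat : ∀ k' ≤ k, Small s 7 ((l + k' : ℕ) : ℚ) := fun k' hk' => .natCast
    ((by omega : l + k' ≤ l + (M ^ 2 + 1)).trans (hl.trans (pow_base_mono (by norm_num))))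
  have hl6 : l ≤ s ^ 6 := by omega
  refine .bind (Within.mapT (a := 2) (b := 22) (P := fun y => SmallPoint s 9 y)
    (by simpa using hk.trans hM2) fun k' hk' => ?_) (by norm_num) fun whole hwhole => ?_
  · have hk'' := (List.mem_range.1 hk').le
    refine .bind (Within.natOp hl6 (hk''.trans (by omega)) _) (by norm_num) ?_
    rintro _ rfl
    refine .bind (Within.ratOp hδ (hnat k' hk'') _) (by norm_num) ?_
    rintro _ rfl
    refine .bind (Within.ratOp (hxa.mono (by norm_num)) (hshift k' hk'') _) (by norm_num) ?_
    rintro _ rfl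
    exact .pure ⟨hag k' hk'', hxp.mono (by norm_num), hu.mono (by norm_num)⟩
  · refine .bind (Within.natOp hl6 (by omega : k ≤ s ^ 6) _) (by norm_num) ?_
    rintro _ rfl
    refine .bind (Within.ratOp hδ (hnat k le_rfl) _) (by norm_num) ?_
    rintro _ rfl
    refine .bind (Within.ratOp (hxa.mono (by norm_num)) (hshift k le_rfl) _) (by norm_num) ?_
    rintro _ rfl
    have hk3 : Small s 3 (k : ℚ) := .natCast ((hk.trans hM2).trans (pow_base_mono (by norm_num)))
    refine .bind (Within.ratOp hk3 hu _) (by norm_num) ?_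
    rintro _ rfl
    refine .bind (Within.ratOp (hxq.mono (by norm_num)) (hk3.mul hu) _) (by norm_num) ?_
    rintro _ rfl
    have hone : 1 ≤ s ^ 6 := one_le_pow_base 6
    refine .bind (Within.natOp (k := 6) (by omega) hone _) (by norm_num) ?_
    rintro _ rfl
    rw [List.length_range] at hwhole
    refine .bind (Within.appendT (a := 2) (hwhole.1 ▸ hk.trans hM2)) (by norm_num) ?_
    rintro _ rfl
    refine .pure ⟨by simp only; omega, by simp [hwhole.1, hk], fun y hy => ?_⟩
    rcases List.mem_append.1 hy with hy | hy
    · exact hwhole.2 y hy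
    · rw [List.mem_singleton] at hy
      subst hy
      exact ⟨hag k le_rfl, hxp.mono (by norm_num),
        ((hxq.mono (by norm_num : 2 ≤ 4)).sub (hk3.mul hu)).mono (by norm_num)⟩

/-- A preprocessed instance whose lists and numbers are polynomially bounded in `s`. -/
structure BoundedPre (s : ℕ) (J : List (List FDist)) : Prop where
  length_le : J.length ≤ s
  length_action_le : ∀ A ∈ J, A.length ≤ s
  length_dist_le : ∀ A ∈ J, ∀ D ∈ A, D.length ≤ s ^ 6
  point : ∀ A ∈ J, ∀ D ∈ A, ∀ x ∈ D, SmallPoint s 9 x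

theorem Within.preprocess {M : ℕ} (hM₁ : 1 ≤ M) (hM : M ≤ s) (hI : Bounded s I)
    (hV : I.Valid) : Within s 60 (preprocess M I) (BoundedPre s) := by
  refine .bind (Within.allPoints hI) (by norm_num) ?_
  rintro _ ⟨rfl, hlen⟩
  have hmem : ∀ x ∈ points I, ∃ A ∈ I, ∃ D ∈ A, x.2 ∈ D := fun x hx => mem_points hx
  have htag := fun x hx => tag_le_of_mem_points hI (x := x) hx
  refine .bind (Within.bottomT hlen fun x hx a ha => ?_) (by norm_num) fun bot hbot => ?_
  · obtain ⟨A, hA, D, hD, hx⟩ := hmem x hx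
    exact hI.agent A hA D hD _ hx a ha
  refine .bind (Within.mapT (b := 1)
    (P := fun y : (ℕ × ℕ) × MassPoint ℚ => SmallPoint s 2 y.2 ∧ Small s 1 y.2.principal ∧
      y.2.prob ≤ 1 ∧ y.1.1 ≤ s ∧ y.1.2 ≤ s) hlen fun x hx => .bind Within.tick le_rfl fun _ _ => .pure ?_) (by norm_num) ?_
  · have hx' := hx
    obtain ⟨A, hA, D, hD, hx⟩ := hmem x hx
    have hp := hI.principal A hA D hD _ hx
    refine ⟨⟨?_, hp.mono (by norm_num), (hI.prob A hA D hD _ hx).mono (by norm_num)⟩, hp,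
      ((hV.2 A hA).2 D hD).prob_le_one hx, htag _ hx'⟩
    cases hxa : x.2.agent with
    | bot => simpa using hbot
    | coe a => simpa using (hI.agent A hA D hD _ hx a hxa).mono (by norm_num)
  rintro L₁ ⟨hlen₁, hL₁⟩
  refine .bind (Within.sortT (a := 3) (hlen₁ ▸ hlen) fun y hy => (hL₁ y hy).2.1) (by norm_num)
    fun L hL => ?_
  have hlenL : L.length ≤ s ^ 3 := hL.length_eq ▸ hlen₁ ▸ hlen
  have hL' := fun y hy => hL₁ y (hL.mem_iff.1 hy)
  refine .bind (Within.mapT (b := 1) (P := fun a => Small s 2 a) hlenL fun x hx =>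
    .bind Within.tick le_rfl fun _ _ => .pure (hL' x hx).1.1) (by norm_num) ?_
  rintro agents ⟨hlena, hagents⟩
  refine .bind (Within.minGapT (hlena ▸ hlenL) hagents) (by norm_num) fun gap hgap => ?_
  refine .bind (Within.lengthT hlenL) (by norm_num) ?_
  rintro _ rfl
  have hM3 := sq_add_one_le (s := s) hM
  refine .bind (Within.natOp hlenL hM3 _) (by norm_num) ?_
  rintro _ rfl
  have hmax : L.length * (M ^ 2 + 1) ≤ s ^ 6 :=
    (Nat.mul_le_mul hlenL hM3).trans (le_of_eq (by ring))
  refine .bind (Within.ratOp (k := 6) (hgap.mono (by norm_num)) (.natCast hmax) _) (by norm_num) ?_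
  rintro _ rfl
  have hδ := (hgap.mono (by norm_num : 3 ≤ 6)).div (.natCast hmax)
  refine .bind (Within.foldT_index (b := 44)
    (fun i (acc : ℕ × List ((ℕ × ℕ) × MassPoint ℚ)) => acc.1 ≤ i * (M ^ 2 + 1) ∧
      acc.2.length ≤ i * (M ^ 2 + 1) ∧ ∀ y ∈ acc.2, SmallPoint s 9 y.2 ∧ y.1.1 ≤ s ∧ y.1.2 ≤ s)
    hlenL (by simp) ?_)
    (by norm_num) fun split hsplit => ?_
  · rintro x hx i ⟨l, out⟩ hi ⟨hl, hout, hsm⟩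
    have hi' : i * (M ^ 2 + 1) + (M ^ 2 + 1) ≤ L.length * (M ^ 2 + 1) := by
      rw [← Nat.succ_mul]
      exact Nat.mul_le_mul_right _ hi
    simp only at hl hout hsm ⊢
    refine .bind (Within.splitPoint hM₁ hM hδ (by omega) (hL' x hx).1 (hL' x hx).2.2.1)
      (by norm_num) ?_
    rintro r ⟨hr₁, hr₂, hr₃⟩
    refine .bind (Within.mapT (a := 3) (b := 1) (P := fun y => SmallPoint s 9 y.2 ∧ y.1.1 ≤ s ∧ y.1.2 ≤ s)
      (hr₂.trans hM3) fun y hy => .bind Within.tick le_rfl fun _ _ => .pure ⟨hr₃ y hy, (hL' x hx).2.2.2⟩)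
      (by norm_num) ?_
    rintro tagged ⟨ht₁, ht₂⟩
    refine .bind (Within.appendT (a := 6) (by omega)) (by norm_num) ?_
    rintro _ rfl
    refine .pure ⟨?_, ?_, fun y hy => ?_⟩
    · simp only; rw [Nat.succ_mul]; omega
    · simp only [List.length_append, ht₁]; rw [Nat.succ_mul]; omega
    · rcases List.mem_append.1 hy with hy | hy
      · exact hsm y hy
      · exact ht₂ y hy
  obtain ⟨-, hlens, hsm⟩ := hsplit
  refine .bind (Within.enumerateT (a := 1) (by simpa using hI.length_le)) (by norm_num) ?_
  rintro _ rfl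
  refine (Within.mapT (a := 1) (b := 30) (P := fun A => A.length ≤ s ∧ ∀ D ∈ A,
    D.length ≤ s ^ 6 ∧ ∀ x ∈ D, SmallPoint s 9 x)
    (by simpa using hI.length_le) fun Ai hAi => ?_).mono (by norm_num) ?_
  · have hA := List.fst_mem_of_mem_zipIdx hAi
    have hAi' : Ai.2 ≤ s ^ 1 := by
      have := List.snd_lt_of_mem_zipIdx hAi
      have := hI.length_le
      rw [pow_one]
      omega
    refine .bind (Within.enumerateT (a := 1) (by simpa using hI.length_action_le _ hA))
      (by norm_num) ?_
    rintro _ rfl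
    refine (Within.mapT (a := 1) (b := 20) (P := fun D : FDist =>
      D.length ≤ s ^ 6 ∧ ∀ x ∈ D, SmallPoint s 9 x)
      (by simpa using hI.length_action_le _ hA) fun Dj hDj => ?_).mono (by norm_num) fun r hr =>
        ⟨hr.1 ▸ by simpa using hI.length_action_le _ hA, hr.2⟩
    have hDj' : Dj.2 ≤ s ^ 1 := by
      have := List.snd_lt_of_mem_zipIdx hDj
      have := hI.length_action_le _ hA
      rw [pow_one]
      omega
    have hlens' : split.2.length ≤ s ^ 6 := hlens.trans hmax
    refine .bind (Within.filterT (b := 6) hlens' fun y hy => ?_) (by norm_num) fun mine hmine => ?_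
    · obtain ⟨-, h₁, h₂⟩ := hsm y hy
      refine .bind (Within.natOp (by simpa using h₁) hAi' _) (by norm_num) fun _ _ => ?_
      exact .bind (Within.natOp (by simpa using h₂) hDj' _) le_rfl fun _ _ => .pure trivial
    · have hlenm := hmine.length_le.trans hlens'
      exact (Within.mapT (b := 1) hlenm fun y hy => .bind Within.tick le_rfl fun _ _ =>
        .pure (hsm y (hmine.subset hy)).1).mono (by norm_num) fun r hr => ⟨hr.1 ▸ hlenm, hr.2⟩
  · rintro r ⟨hr₁, hr₂⟩
    exact ⟨by simpa [hr₁] using hI.length_le, fun A hA => (hr₂ A hA).1,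
      fun A hA D hD => ((hr₂ A hA).2 D hD).1, fun A hA D hD => ((hr₂ A hA).2 D hD).2⟩

end Preprocessing

/-! ### Step bounds for the dynamic program -/

section Solve

variable {s : ℕ} [hs : Fact (12 ≤ s)]

/-- A guess of the bins whose numbers have `O(s ^ 9)` bits. -/
def BoundedGuess (s M : ℕ) (û : List ℚ) : Prop := û.length = M ∧ ∀ u ∈ û, Small s 9 u

theorem BoundedGuess.getD {M : ℕ} {û : List ℚ} (h : BoundedGuess s M û) (i : ℕ) :
    Small s 9 (û.getD i 0) := by
  by_cases hi : i < û.length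
  · rw [List.getD_eq_getElem _ _ hi]
    exact h.2 _ (List.getElem_mem hi)
  · rw [List.getD_eq_default _ _ (not_lt.1 hi)]
    exact .zero

variable {M : ℕ} {û : List ℚ}

theorem Within.inCumBin (hû : BoundedGuess s M û) {j : ℕ} (hj : j ≤ s) {x : ℚ}
    (hx : Small s 9 x) : Within s 21 (inCumBin M û j x) fun _ => True := by
  refine .bind (Within.getT (a := 1) (by rw [pow_one]; omega)) (by norm_num) ?_
  rintro _ rfl
  split
  · exact (Within.ratOp hx (hû.getD _) _).mono le_rfl fun _ _ => trivial
  · exact (Within.ratOp hx (hû.getD _) _).mono le_rfl fun _ _ => trivial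

theorem Within.inBin (hû : BoundedGuess s M û) {j : ℕ} (hj : j ≤ s) {x : ℚ}
    (hx : Small s 9 x) : Within s 23 (inBin M û j x) fun _ => True := by
  refine .bind (Within.inCumBin hû hj hx) (by norm_num) fun _ _ => ?_
  split
  · exact .pure trivial
  · refine .bind (Within.getT (a := 1) (by rw [pow_one]; omega)) (by norm_num) ?_
    rintro _ rfl
    exact .bind (Within.ratOp (hû.getD _) hx _) (by norm_num) fun _ _ => .pure trivial

theorem Within.binStats (hû : BoundedGuess s M û) {j : ℕ} (hj : j ≤ s) {D : FDist}
    (hlen : D.length ≤ s ^ 6) (hD : ∀ x ∈ D, SmallPoint s 9 x) :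
    Within s 60 (binStats M û D j) fun r => Small s 17 r.1 ∧ Small s 19 r.2 := by
  refine .bind (Within.filterT hlen fun x hx => Within.inCumBin hû hj (hD x hx).1) (by norm_num)
    fun cum hcum => ?_
  refine .bind (Within.filterT hlen fun x hx => Within.inBin hû hj (hD x hx).1) (by norm_num)
    fun bin hbin => ?_
  have hlenc := hcum.length_le.trans hlen
  have hlenb := hbin.length_le.trans hlen
  have hDc := fun x hx => hD x (hcum.subset hx)
  have hDb := fun x hx => hD x (hbin.subset hx)
  refine .bind (Within.mapT (b := 1) (P := fun r => Small s 9 r) hlenc fun x hx =>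
    .bind Within.tick le_rfl fun _ _ => .pure (hDc x hx).2.2) (by norm_num) ?_
  rintro cumProbs ⟨hc, hcs⟩
  refine .bind (Within.mapT (b := 1) (P := fun r => Small s 9 r) hlenb fun x hx =>
    .bind Within.tick le_rfl fun _ _ => .pure (hDb x hx).2.2) (by norm_num) ?_
  rintro binProbs ⟨hb, hbs⟩
  refine .bind (Within.mapT (b := 20) (P := fun r => Small s 10 r) hlenb fun x hx =>
    (Within.ratOp (hDb x hx).2.2 (hDb x hx).2.1 _).mono (by norm_num) ?_) (by norm_num) ?_
  · rintro _ rfl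
    exact (hDb x hx).2.2.mul (hDb x hx).2.1
  rintro binUtils ⟨hu, hus⟩
  refine .bind (Within.sumT (hc ▸ hlenc) hcs) (by norm_num) fun pCum hpCum => ?_
  refine .bind (Within.sumT (hb ▸ hlenb) hbs) (by norm_num) fun pBin hpBin => ?_
  refine .bind (Within.sumT (hu ▸ hlenb) hus) (by norm_num) fun eBin heBin => ?_
  refine .bind (Within.ratOp hpBin hpCum _) (by norm_num) ?_
  rintro _ rfl
  refine .bind (Within.ratOp heBin (hpBin.mono (by norm_num)) _) (by norm_num) ?_
  rintro _ rfl
  have hq := hpBin.div hpCum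
  have he := heBin.div (hpBin.mono (by norm_num))
  refine .bind (Within.ratOp he (hq.mono (by norm_num)) _) (by norm_num) ?_
  rintro _ rfl
  exact .pure ⟨hq, he.mul (hq.mono (by norm_num))⟩

theorem Within.summary (hM : M ≤ s) (hû : BoundedGuess s M û) {N : ℕ} (hN : N ≤ s ^ 3) {D : FDist}
    (hlen : D.length ≤ s ^ 6) (hD : ∀ x ∈ D, SmallPoint s 9 x) (hD₀ : D.Nonneg) :
    Within s 70 (summary M N û D) fun r =>
      (r.1.length = M ∧ ∀ k ∈ r.1, k ≤ s ^ 3) ∧ Small s 22 r.2 := by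
  have key : Within s 70 (UtilityConfiguration.summary M N û D) fun r => Small s 22 r.2 := by
    refine .bind (Within.rangeT (a := 1) (by simpa using hM)) (by norm_num) ?_
    rintro _ rfl
    refine .bind (Within.mapT (a := 1) (b := 61)
      (P := fun r : ℕ × ℚ × ℚ => r.1 ≤ s ∧ Small s 17 r.2.1 ∧ Small s 19 r.2.2)
      (by simpa using hM) fun i hi => ?_) (by norm_num) ?_
    · have hi : i + 1 ≤ s := (List.mem_range.1 hi).trans_le hM
      exact .bind (Within.binStats hû hi hlen hD) le_rfl fun r hr => .pure ⟨hi, hr⟩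
    rintro stats ⟨hst, hsts⟩
    rw [List.length_range] at hst
    have hst' : stats.length ≤ s ^ 1 := by rw [pow_one]; omega
    refine .bind (Within.mapT (b := 40) (P := fun _ => True) hst' fun r hr => ?_) (by norm_num)
      fun ks _ => ?_
    · have hN' : Small s 17 (N : ℚ) := .natCast (hN.trans (pow_base_mono (by norm_num)))
      refine .bind (Within.ratOp (hsts r hr).2.1 hN' _) (by norm_num) ?_
      rintro _ rfl
      have h := (hsts r hr).2.1.mul hN'
      exact (Within.ratOp h h _).mono (by norm_num) fun _ _ => trivial
    refine .bind (Within.mapT (b := 40) (P := fun r => Small s 20 r) hst' fun r hr => ?_)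
      (by norm_num) ?_
    · split
      · have h5 : 5 ≤ s ^ 1 := by have := hs.out; rw [pow_one]; omega
        have h1 : Small s 2 ((r.1 : ℚ) - 5) :=
          (Small.natCast (by simpa using (hsts r hr).1)).sub
            (by simpa using Small.natCast (k := 1) h5)
        have h2 : Small s 2 ((M : ℚ) - 1) := (Small.natCast (by simpa using hM)).sub .one
        have h3 := h1.div h2
        refine (Within.ratOp (h3.mono (by norm_num)) (hsts r hr).2.2 _).mono (by norm_num) ?_
        rintro _ rfl
        exact (h3.mono (by norm_num : 3 ≤ 19)).mul (hsts r hr).2.2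
      · exact .bind (Within.tick (k := 39)) le_rfl fun _ _ => .pure .zero
    rintro terms ⟨ht, hts⟩
    exact .bind (Within.sumT (a := 1) (by omega) hts) (by norm_num) fun ψ hψ => .pure hψ
  refine ⟨key.1, ?_, key.2⟩
  rw [val_summary N û hD₀]
  refine ⟨by simp, fun k hk => ?_⟩
  obtain ⟨i, -, rfl⟩ := List.mem_map.1 hk
  obtain ⟨h₀, h₁⟩ := increment_mem (M := M) (û := û) (j := i + 1) hD₀
  refine (Nat.floor_le_of_le ?_).trans hN
  exact mul_le_of_le_one_left (Nat.cast_nonneg _) h₁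

theorem Within.feasible (hM : M ≤ s) {N : ℕ} (hN : N ≤ s ^ 4) {k : List ℕ} (hk : k.length = M)
    (hk' : ∀ a ∈ k, a ≤ s ^ 4) : Within s 20 (feasible M N k) fun _ => True := by
  have hlen : k.length ≤ s ^ 1 := by rw [pow_one]; omega
  have hM' : Small s 2 (1 / (M : ℚ)) := Small.div .one (.natCast (by simpa using hM))
  refine .bind (Within.enumerateT hlen) (by norm_num) ?_
  rintro _ rfl
  refine (Within.allT (a := 1) (b := 17) (by simpa using hlen) fun kj hkj => ?_).mono
    (by norm_num) fun _ h => h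
  have h₁ : kj.2 ≤ s ^ 1 := by
    have := List.snd_lt_of_mem_zipIdx hkj
    omega
  have h₂ := hk' _ (List.fst_mem_of_mem_zipIdx hkj)
  have hj : Small s 2 ((kj.2 : ℚ) + 1) := (Small.natCast h₁).add .one
  refine .bind (Within.ratOp (.natCast h₂) (.natCast hN) _) (by norm_num) ?_
  rintro _ rfl
  have hest : Small s 5 ((kj.1 : ℚ) / N) := (Small.natCast h₂).div (.natCast hN)
  have hlow : Small s 5 ((1 - 1 / (M : ℚ)) / ((kj.2 : ℚ) + 1) - 1 / (M : ℚ) ^ 2) :=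
    ((Small.sub .one hM').div (hj.mono (by norm_num))).sub ((Small.unit hM).mono (by norm_num))
  refine .bind (Within.ratOp hlow hest _) (k := 15) (by norm_num) fun _ _ => ?_
  split
  · exact .bind (j := 14) (.bind (Within.tick (k := 13)) le_rfl fun _ _ =>
      .pure (P := fun _ => True) trivial) le_rfl fun _ _ => .pure trivial
  · have hup : Small s 5 ((1 + 1 / (M : ℚ)) / ((kj.2 : ℚ) + 1 - 1)) :=
      ((Small.add .one hM').div (hj.sub .one)).mono (by norm_num)
    exact .bind (Within.ratOp hest hup _) (by norm_num) fun _ _ => .pure trivial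

theorem Within.addVecT {v w : List ℕ} (hv : v.length ≤ s) (hv' : ∀ a ∈ v, a ≤ s ^ 4)
    (hw' : ∀ a ∈ w, a ≤ s ^ 4) :
    Within s 12 (addVecT v w) fun r => r = List.zipWith (· + ·) v w ∧ ∀ a ∈ r, a ≤ s ^ 5 := by
  have key : (UtilityConfiguration.addVecT v w).time ≤ v.length * (1 * s ^ 10) + 1 := by
    clear hv
    induction v generalizing w with
    | nil => cases w <;> exact (by simp : 1 + 0 ≤ 0 * _ + 1)
    | cons a v ih =>
      cases w with
      | nil => exact (by omega : 1 + 0 ≤ _ + 1)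
      | cons b w =>
        have ih := ih (fun a ha => hv' a (List.mem_cons_of_mem _ ha))
          fun a ha => hw' a (List.mem_cons_of_mem _ ha)
        have h₁ := (Within.natOp (hv' a (by simp)) (hw' b (by simp)) (a + b)).1
        change (natAddT a b).time ≤ s ^ 10 at h₁
        change (natAddT a b).time + ((UtilityConfiguration.addVecT v w).time + 0) ≤ _
        rw [List.length_cons, add_mul]
        omega
  refine ⟨key.trans (length_mul_le (a := 1) (by norm_num) (by simpa using hv)), by simp, ?_⟩
  intro c hc
  rw [val_addVecT, List.mem_iff_getElem] at hc
  obtain ⟨i, hi, rfl⟩ := hc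
  rw [List.length_zipWith] at hi
  have h₁ := hv' _ (List.getElem_mem (by omega : i < v.length))
  have h₂ := hw' _ (List.getElem_mem (by omega : i < w.length))
  have h₃ : 2 * s ^ 4 ≤ s ^ 5 := mul_pow_base_le (by norm_num) 4
  rw [List.getElem_zipWith]
  omega

theorem Within.eqVecT {v w : List ℕ} (hv : v.length ≤ s) (hv' : ∀ a ∈ v, a ≤ s ^ 5)
    (hw' : ∀ a ∈ w, a ≤ s ^ 5) : Within s 14 (eqVecT v w) fun _ => True := by
  have key : (UtilityConfiguration.eqVecT v w).time ≤ v.length * (1 * s ^ 12) + 1 := by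
    clear hv
    induction v generalizing w with
    | nil => cases w <;> exact (by simp : 1 + 0 ≤ 0 * _ + 1)
    | cons a v ih =>
      cases w with
      | nil => exact (by omega : 1 + 0 ≤ _ + 1)
      | cons b w =>
        have ih := ih (fun a ha => hv' a (List.mem_cons_of_mem _ ha))
          fun a ha => hw' a (List.mem_cons_of_mem _ ha)
        have h₁ := (Within.natOp (hv' a (by simp)) (hw' b (by simp)) (decide (a = b))).1
        change (natEqT a b).time ≤ s ^ 12 at h₁
        change (natEqT a b).time + (if decide (a = b) = true then
          UtilityConfiguration.eqVecT v w else Pure.pure false).time ≤ _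
        rw [List.length_cons, add_mul]
        split
        · omega
        · change _ + 0 ≤ _
          omega
  exact ⟨key.trans (length_mul_le (a := 1) (by norm_num) (by simpa using hv)), trivial⟩

theorem Within.lookupT {k : List ℕ} (hk : k.length ≤ s) (hk' : ∀ a ∈ k, a ≤ s ^ 5) {t : Table}
    {b : ℕ} (ht : t.length ≤ s ^ b) (ht' : ∀ e ∈ t, ∀ a ∈ e.1, a ≤ s ^ 5) :
    Within s (b + 15) (lookupT k t) fun r => ∀ x, r = some x → ∃ e ∈ t, e.2 = some x := by
  have key : (UtilityConfiguration.lookupT k t).time ≤ t.length * (2 * s ^ 14) + 1 ∧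
      ∀ x, (UtilityConfiguration.lookupT k t).val = some x → ∃ e ∈ t, e.2 = some x := by
    clear ht
    induction t with
    | nil =>
      refine ⟨(by simp : 1 + 0 ≤ 0 * _ + 1), fun x hx => ?_⟩
      cases hx
    | cons e t ih =>
      obtain ⟨ih₁, ih₂⟩ := ih fun e he => ht' e (List.mem_cons_of_mem _ he)
      have h₁ := (Within.eqVecT hk hk' (ht' e (by simp))).1
      have h₂ : 1 ≤ s ^ 14 := one_le_pow_base 14
      constructor
      · change 1 + ((UtilityConfiguration.eqVecT k e.1).time +
          (if (UtilityConfiguration.eqVecT k e.1).val = true then Pure.pure e.2 else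
            UtilityConfiguration.lookupT k t).time) ≤ _
        rw [List.length_cons, add_mul]
        split
        · change 1 + (_ + 0) ≤ _
          omega
        · omega
      · intro x hx
        change (if (UtilityConfiguration.eqVecT k e.1).val = true then Pure.pure e.2 else
            UtilityConfiguration.lookupT k t).val = some x at hx
        split at hx
        · exact ⟨e, by simp, hx⟩
        · obtain ⟨e', he', h⟩ := ih₂ x hx
          exact ⟨e', List.mem_cons_of_mem _ he', h⟩
  exact ⟨key.1.trans (length_mul_le (by norm_num) ht), key.2⟩

theorem Within.betterT {k : ℕ} {Q : ℚ × List ℕ → Prop} (hQ : ∀ x, Q x → Small s k x.1)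
    {a b : Option (ℚ × List ℕ)} (ha : ∀ x, a = some x → Q x) (hb : ∀ x, b = some x → Q x) :
    Within s (2 * k + 3) (betterT a b) fun r => ∀ x, r = some x → Q x := by
  match a, b with
  | some x, some y =>
    refine .bind (Within.ratOp (hQ _ (ha x rfl)) (hQ _ (hb y rfl)) _) le_rfl fun c _ => .pure ?_
    split
    · exact hb
    · exact ha
  | some x, none => exact .bind (Within.tick (k := 2 * k + 2)) le_rfl fun _ _ => .pure ha
  | none, y => exact .bind (Within.tick (k := 2 * k + 2)) le_rfl fun _ _ => .pure hb

/-- A memo table for `i` remaining actions: the values are sums of `i` contributions. -/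
structure BoundedTable (s M i : ℕ) (t : Table) : Prop where
  length_le : t.length ≤ s ^ (5 * M)
  key : ∀ e ∈ t, ∀ a ∈ e.1, a ≤ s ^ 4
  value : ∀ e ∈ t, ∀ x, e.2 = some x →
    x.1.den ≤ 2 ^ (i * s ^ 22 + 1) ∧ |x.1| ≤ 2 ^ (i * s ^ 22 + 1)

/-- The steps spent on the individual actions add up, and so do the bit lengths of the values. -/
theorem Within.optTable (hM₁ : 1 ≤ M) (hM : M ≤ s) {N : ℕ} (hN : N ≤ s ^ 4) {keys : List (List ℕ)}
    (hkeys : keys.length ≤ s ^ (5 * M)) (hkeys' : ∀ k ∈ keys, k.length = M ∧ ∀ a ∈ k, a ≤ s ^ 4)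
    {S : List (List (List ℕ × ℚ))} (hS : S.length ≤ s) (hS' : ∀ A ∈ S, A.length ≤ s ∧
      ∀ c ∈ A, (c.1.length = M ∧ ∀ k ∈ c.1, k ≤ s ^ 3) ∧ Small s 22 c.2) :
    Within s (10 * M + 70) (optTable M N keys S) (BoundedTable s M S.length) := by
  have key : (UtilityConfiguration.optTable M N keys S).time ≤
      S.length * (1 * s ^ (10 * M + 68)) + s ^ (10 * M + 68) ∧
      BoundedTable s M S.length (UtilityConfiguration.optTable M N keys S).val := by
    induction S with
    | nil =>
      have h : Within s (10 * M + 68) (UtilityConfiguration.optTable M N keys []) fun t =>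
          t.length = keys.length ∧ ∀ e ∈ t, (∀ a ∈ e.1, a ≤ s ^ 4) ∧ ∀ x, e.2 = some x →
            x.1 = 0 := by
        refine (Within.mapT (b := 21) hkeys fun k hk => .bind
          (Within.feasible hM hN (hkeys' k hk).1 (hkeys' k hk).2) le_rfl fun b _ =>
            .pure ⟨(hkeys' k hk).2, fun x hx => ?_⟩).mono (by omega) fun _ h => h
        cases b <;> simp at hx
        subst hx
        rfl
      refine ⟨h.1.trans (by simp), h.2.1 ▸ hkeys, fun e he => (h.2.2 e he).1, fun e he x hx => ?_⟩
      rw [(h.2.2 e he).2 x hx]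
      simp
    | cons A S ih =>
      obtain ⟨ih₁, ih₂⟩ := ih ((Nat.le_succ _).trans hS) fun A hA => hS' A (by simp [hA])
      obtain ⟨hA, hA'⟩ := hS' A (by simp)
      rw [List.length_cons] at hS
      have hsmall : ∀ r : ℚ, r.den ≤ 2 ^ (S.length * s ^ 22 + 1) →
          |r| ≤ 2 ^ (S.length * s ^ 22 + 1) → Small s 24 r := fun r => Small.of_le
        ((by simp : S.length * s ^ 22 + 1 ≤ S.length * (1 * s ^ 22) + 1).trans
          (length_mul_le (a := 1) (by norm_num) (by simp; omega)))
      have hsmall' : ∀ r : ℚ, r.den ≤ 2 ^ ((S.length + 1) * s ^ 22 + 1) →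
          |r| ≤ 2 ^ ((S.length + 1) * s ^ 22 + 1) → Small s 24 r := fun r => Small.of_le
        ((by simp : (S.length + 1) * s ^ 22 + 1 ≤ (S.length + 1) * (1 * s ^ 22) + 1).trans
          (length_mul_le (a := 1) (by norm_num) (by simp; omega)))
      set next := UtilityConfiguration.optTable M N keys S with hnext
      have h : Within s (10 * M + 68) (do
          let configs ← UtilityConfiguration.enumerateT A
          UtilityConfiguration.mapT (fun k => do
            let best ← UtilityConfiguration.foldT (fun (best : Option (ℚ × List ℕ)) c => do
              let k' ← UtilityConfiguration.addVecT k c.1.1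
              let r ← UtilityConfiguration.lookupT k' next.val
              match r with
              | none => do
                UtilityConfiguration.tick 1
                return best
              | some x => do
                let v ← addT c.1.2 x.1
                UtilityConfiguration.betterT best (some (v, c.2 :: x.2))) none configs
            return (k, best)) keys) fun t =>
          t.length = keys.length ∧ ∀ e ∈ t, (∀ a ∈ e.1, a ≤ s ^ 4) ∧ ∀ x, e.2 = some x →
            x.1.den ≤ 2 ^ ((S.length + 1) * s ^ 22 + 1) ∧
              |x.1| ≤ 2 ^ ((S.length + 1) * s ^ 22 + 1) := by
        refine .bind (Within.enumerateT (a := 1) (by simpa using hA)) (by omega) ?_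
        rintro _ rfl
        refine (Within.mapT (b := 5 * M + 65) hkeys fun k hk => .bind (Within.foldT_index (a := 1)
          (b := 5 * M + 60) (fun _ best => ∀ x, best = some x →
            x.1.den ≤ 2 ^ ((S.length + 1) * s ^ 22 + 1) ∧
              |x.1| ≤ 2 ^ ((S.length + 1) * s ^ 22 + 1)) (by simpa using hA) (by simp) ?_)
          (by omega) fun best hbest => .pure ⟨(hkeys' k hk).2, hbest⟩).mono (by omega) fun _ h => h
        intro c hc _ best _ hbest
        obtain ⟨⟨-, hc₁⟩, hc₂⟩ := hA' _ (List.fst_mem_of_mem_zipIdx hc)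
        obtain ⟨hk₁, hk₂⟩ := hkeys' k hk
        refine .bind (Within.addVecT (hk₁ ▸ hM) hk₂
          fun a ha => (hc₁ a ha).trans (pow_base_mono (by norm_num))) (by omega) ?_
        rintro _ ⟨rfl, hk'⟩
        refine .bind (Within.lookupT (by simp; omega) hk' ih₂.length_le fun e he a ha =>
          (ih₂.key e he a ha).trans (pow_base_mono (by norm_num))) (by omega) fun r hr => ?_
        match r, hr with
        | none, _ =>
          exact .bind (Within.tick (k := 5 * M + 57)) le_rfl fun _ _ => .pure hbest
        | some x, hx =>
          obtain ⟨e, he, hex⟩ := hx x rfl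
          obtain ⟨h₁, h₂⟩ := ih₂.value e he x hex
          refine .bind (Within.ratOp (hc₂.mono (by norm_num)) (hsmall _ h₁ h₂) _) (by omega) ?_
          rintro _ rfl
          refine (Within.betterT (k := 24) (fun x hx => hsmall' _ hx.1 hx.2) hbest ?_).mono
            (by omega) fun _ h => h
          intro y hy
          cases hy
          rw [show (S.length + 1) * s ^ 22 + 1 = s ^ 22 + (S.length * s ^ 22 + 1) by ring]
          exact ⟨add_den_le hc₂.1 h₁, add_abs_le (one_le_pow_base _) (by omega) hc₂.2 h₂⟩
      obtain ⟨h₁, h₂, h₃⟩ := h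
      refine ⟨?_, h₂ ▸ hkeys, fun e he => (h₃ e he).1, fun e he => (h₃ e he).2⟩
      refine (Nat.add_le_add ih₁ h₁).trans (le_of_eq ?_)
      rw [List.length_cons]
      ring
  refine ⟨?_, key.2⟩
  have h₁ : S.length * (1 * s ^ (10 * M + 68)) + s ^ (10 * M + 68) ≤
      2 * (s * s ^ (10 * M + 68)) := by
    rw [one_mul]
    have h₂ : S.length * s ^ (10 * M + 68) ≤ s * s ^ (10 * M + 68) := Nat.mul_le_mul_right _ hS
    have h₃ : 1 * s ^ (10 * M + 68) ≤ s * s ^ (10 * M + 68) :=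
      Nat.mul_le_mul_right _ (by have := hs.out; omega)
    omega
  refine (key.1.trans h₁).trans ?_
  rw [← pow_succ']
  exact mul_pow_base_le (by norm_num) _

theorem Within.solve (hM₁ : 1 ≤ M) (hM : M ≤ s) {J : List (List FDist)} (hJ : BoundedPre s J)
    (hJ₀ : ∀ A ∈ J, ∀ D ∈ A, D.Nonneg) (hû : BoundedGuess s M û) :
    Within s (10 * M + 80) (solve M J û) fun _ => True := by
  have hM2 : M ^ 2 ≤ s ^ 2 := Nat.pow_le_pow_left hM 2
  have hn : J.length ≤ s ^ 1 := by simpa using hJ.length_le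
  refine .bind (Within.lengthT hn) (by omega) ?_
  rintro _ rfl
  refine .bind (Within.natOp (k := 2) hM2 (hn.trans (pow_base_mono (by norm_num))) _)
    (by omega) ?_
  rintro _ rfl
  have hN : M ^ 2 * J.length ≤ s ^ 3 := (Nat.mul_le_mul hM2 hn).trans (le_of_eq (by ring))
  refine .bind (Within.mapT (b := 72) (P := fun A : List (List ℕ × ℚ) => A.length ≤ s ∧
      ∀ c ∈ A, (c.1.length = M ∧ ∀ k ∈ c.1, k ≤ s ^ 3) ∧ Small s 22 c.2) hn fun A hA =>
    (Within.mapT (a := 1) (b := 70) (by simpa using hJ.length_action_le A hA) fun D hD =>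
      Within.summary hM hû hN (hJ.length_dist_le A hA D hD) (hJ.point A hA D hD)
        (hJ₀ A hA D hD)).mono (by norm_num) fun r hr =>
          ⟨hr.1 ▸ hJ.length_action_le A hA, hr.2⟩) (by omega) ?_
  rintro S ⟨hS, hS'⟩
  refine .bind (Within.natOp (k := 3) (hn.trans (pow_base_mono (by norm_num))) hN _)
    (by omega) ?_
  rintro _ rfl
  have htop : J.length * (M ^ 2 * J.length) ≤ s ^ 4 :=
    (Nat.mul_le_mul hn hN).trans (le_of_eq (by ring))
  have htop' : J.length * (M ^ 2 * J.length) + 1 ≤ s ^ 5 := by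
    have h₁ : 2 * s ^ 4 ≤ s ^ 5 := mul_pow_base_le (by norm_num) 4
    have h₂ : 1 ≤ s ^ 4 := one_le_pow_base 4
    omega
  refine .bind (Within.rangeT htop') (by omega) ?_
  rintro _ rfl
  refine .bind (Within.tuplesT (a := 5) (by simpa using htop') M) (by omega) ?_
  rintro keys ⟨hkeys, hkeys'⟩
  refine .bind (Within.optTable hM₁ hM (hN.trans (pow_base_mono (by norm_num))) hkeys
    (fun k hk => ⟨(hkeys' k hk).1, fun a ha => ?_⟩) (hS ▸ hJ.length_le) hS') (by omega)
    fun t ht => ?_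
  · have := List.mem_range.1 ((hkeys' k hk).2 a ha)
    omega
  refine .bind (Within.mapT (a := 1) (b := 1) (P := fun a => a = 0) (by rw [hû.1]; simpa using hM)
    fun _ _ => .bind Within.tick le_rfl fun _ _ => .pure rfl) (by omega) ?_
  rintro start ⟨hst, hst'⟩
  refine .bind (Within.lookupT (by rw [hst, hû.1]; exact hM)
    (fun a ha => by rw [hst' a ha]; exact Nat.zero_le _) ht.length_le fun e he a ha =>
      (ht.key e he a ha).trans (pow_base_mono (by norm_num))) (by omega) fun r _ => ?_
  cases r with
  | none => exact .pure trivial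
  | some x => exact .pure trivial

end Solve

/-! ### Step bounds for the evaluation of a configuration -/

section Evaluate

/-- The masses have a common denominator of at most `e` bits, and their sum is at most `2 ^ e`. The
bit lengths of common denominators only add up when distributions are combined, even though every
mass of one distribution enters every mass of the combination. -/
def Commensurable (e : ℕ) (F : FDist) : Prop :=
  ∃ q, 0 < q ∧ q ≤ 2 ^ e ∧ (∀ x ∈ F, x.prob.den ∣ q) ∧ (F.map fun x => |x.prob|).sum ≤ 2 ^ e

theorem den_add_dvd {q : ℕ} {r r' : ℚ} (h : r.den ∣ q) (h' : r'.den ∣ q) : (r + r').den ∣ q :=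
  (Rat.add_den_dvd_lcm r r').trans (Nat.lcm_dvd h h')

theorem den_sum_dvd {q : ℕ} {l : List ℚ} (h : ∀ r ∈ l, r.den ∣ q) : l.sum.den ∣ q := by
  induction l with
  | nil => simp
  | cons r l ih =>
    rw [List.sum_cons]
    exact den_add_dvd (h r (by simp)) (ih fun r hr => h r (List.mem_cons_of_mem _ hr))

theorem den_mass_dvd (P : ℚ → Prop) [DecidablePred P] {q : ℕ} {F : FDist}
    (h : ∀ x ∈ F, x.prob.den ∣ q) : (mass P F).den ∣ q := by
  refine den_sum_dvd fun r hr => ?_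
  obtain ⟨x, hx, rfl⟩ := List.mem_map.1 hr
  change (x.prob * if P x.agent then 1 else 0).den ∣ q
  split
  · simpa using h x hx
  · simp

theorem abs_mass_le (P : ℚ → Prop) [DecidablePred P] (F : FDist) :
    |mass P F| ≤ (F.map fun x => |x.prob|).sum := by
  rw [mass, mean]
  induction F with
  | nil => simp
  | cons x F ih =>
    simp only [List.map_cons, List.sum_cons]
    refine (abs_add_le _ _).trans (add_le_add ?_ ih)
    split <;> simp

theorem sum_abs_prob_nonneg (F : FDist) : 0 ≤ (F.map fun x => |x.prob|).sum :=
  List.sum_nonneg fun r hr => by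
    obtain ⟨x, -, rfl⟩ := List.mem_map.1 hr
    exact abs_nonneg _

theorem sum_abs_mul_le {F : FDist} {t : ℚ} {g : MassPoint ℚ → ℚ} (h : ∀ x ∈ F, |g x| ≤ t) :
    (F.map fun x => |x.prob * g x|).sum ≤ (F.map fun x => |x.prob|).sum * t := by
  rw [← List.sum_map_mul_right]
  refine List.sum_le_sum fun x hx => ?_
  rw [abs_mul]
  exact mul_le_mul_of_nonneg_left (h x hx) (abs_nonneg _)

theorem Commensurable.mono {e e' : ℕ} {F : FDist} (h : Commensurable e F) (hee : e ≤ e') :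
    Commensurable e' F := by
  obtain ⟨q, h₁, h₂, h₃, h₄⟩ := h
  exact ⟨q, h₁, h₂.trans (Nat.pow_le_pow_right (by norm_num) hee), h₃,
    h₄.trans (pow_le_pow_right₀ (by norm_num) hee)⟩

theorem Commensurable.better {e e' : ℕ} {F G : FDist} (hF : Commensurable e F)
    (hG : Commensurable e' G) : Commensurable (e + e' + 1) (better F G) := by
  obtain ⟨q, h₁, h₂, h₃, h₄⟩ := hF
  obtain ⟨q', h₁', h₂', h₃', h₄'⟩ := hG
  refine ⟨q * q', Nat.mul_pos h₁ h₁', ?_, ?_, ?_⟩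
  · calc q * q' ≤ 2 ^ e * 2 ^ e' := Nat.mul_le_mul h₂ h₂'
      _ = 2 ^ (e + e') := (pow_add _ _ _).symm
      _ ≤ 2 ^ (e + e' + 1) := Nat.pow_le_pow_right (by norm_num) (Nat.le_succ _)
  · intro x hx
    rcases List.mem_append.1 hx with hx | hx
    · obtain ⟨y, hy, rfl⟩ := List.mem_map.1 hx
      exact (Rat.mul_den_dvd _ _).trans (Nat.mul_dvd_mul (h₃ y hy) (den_mass_dvd _ h₃'))
    · obtain ⟨y, hy, rfl⟩ := List.mem_map.1 hx
      rw [mul_comm q]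
      exact (Rat.mul_den_dvd _ _).trans (Nat.mul_dvd_mul (h₃' y hy) (den_mass_dvd _ h₃))
  · have hF₀ := sum_abs_prob_nonneg F
    have hG₀ := sum_abs_prob_nonneg G
    have h₅ := sum_abs_mul_le (F := F) (g := fun x => mass (· < x.agent) G)
      fun x _ => abs_mass_le _ G
    have h₆ := sum_abs_mul_le (F := G) (g := fun x => mass (· < x.agent) F)
      fun x _ => abs_mass_le _ F
    have h₇ := mul_le_mul h₄ h₄' hG₀ (by positivity)
    simp only [UtilityConfiguration.better, List.map_append, List.map_map, Function.comp_def,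
      List.sum_append]
    rw [pow_succ, pow_add]
    linarith

variable {s : ℕ} [hs : Fact (12 ≤ s)]

theorem Commensurable.small {e k : ℕ} {F : FDist} (h : Commensurable e F) (he : e ≤ s ^ k)
    {x : MassPoint ℚ} (hx : x ∈ F) : Small s k x.prob := by
  obtain ⟨q, h₁, h₂, h₃, h₄⟩ := h
  have h₅ : |x.prob| ≤ (F.map fun x => |x.prob|).sum :=
    List.single_le_sum (fun r hr => by
      obtain ⟨y, -, rfl⟩ := List.mem_map.1 hr
      exact abs_nonneg _) _ (List.mem_map.2 ⟨x, hx, rfl⟩)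
  exact Small.of_le (a := e) he ((Nat.le_of_dvd h₁ (h₃ x hx)).trans h₂) (h₅.trans h₄)

theorem Commensurable.of_small {k : ℕ} {F : FDist} (h : ∀ x ∈ F, Small s k x.prob) :
    Commensurable (F.length * s ^ k + 1) F := by
  induction F with
  | nil => exact ⟨1, one_pos, by simp, by simp, by simp⟩
  | cons x F ih =>
    obtain ⟨q, h₁, h₂, h₃, h₄⟩ := ih fun y hy => h y (List.mem_cons_of_mem _ hy)
    obtain ⟨h₅, h₆⟩ := h x (by simp)
    have h₇ : (F.length + 1) * s ^ k + 1 = s ^ k + (F.length * s ^ k + 1) := by ring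
    rw [List.length_cons, h₇]
    refine ⟨x.prob.den * q, Nat.mul_pos x.prob.den_pos h₁, ?_, ?_, ?_⟩
    · rw [pow_add]
      exact Nat.mul_le_mul h₅ h₂
    · intro y hy
      rcases List.mem_cons.1 hy with rfl | hy
      · exact dvd_mul_right _ _
      · exact (h₃ y hy).trans (dvd_mul_left _ _)
    · rw [List.map_cons, List.sum_cons]
      exact (add_le_add h₆ h₄).trans (add_two_pow_le (one_le_pow_base k) (by omega))

/-- Summing numbers with a common denominator does not increase bit lengths. -/
theorem Within.sumT_of_dvd {l : List ℚ} {a b q : ℕ} (hl : l.length ≤ s ^ a) (hq₀ : 0 < q)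
    (hq : q ≤ 2 ^ s ^ b) (hd : ∀ r ∈ l, r.den ∣ q) (ht : (l.map fun r => |r|).sum ≤ 2 ^ s ^ b) :
    Within s (a + 2 * b + 3) (UtilityConfiguration.sumT l) (Small s b) := by
  have hnn : ∀ l : List ℚ, 0 ≤ (l.map fun r => |r|).sum := fun l =>
    List.sum_nonneg fun r hr => by
      obtain ⟨x, -, rfl⟩ := List.mem_map.1 hr
      exact abs_nonneg _
  have hsmall : ∀ r : ℚ, r.den ∣ q → |r| ≤ 2 ^ s ^ b → Small s b r := fun r h₁ h₂ =>
    ⟨(Nat.le_of_dvd hq₀ h₁).trans hq, h₂⟩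
  refine (Within.foldT (b := 2 * b + 2) (fun l' c => c.den ∣ q ∧
    |c| + (l'.map fun r => |r|).sum ≤ 2 ^ s ^ b) hl (by simpa using ht) ?_).mono (by omega) ?_
  · rintro r hr l' c - ⟨h₁, h₂⟩
    rw [List.map_cons, List.sum_cons] at h₂
    have h₃ := hnn l'
    have h₄ := abs_nonneg c
    have h₅ := abs_nonneg r
    refine (Within.ratOp (hsmall c h₁ (by linarith)) (hsmall r (hd r hr) (by linarith)) _).mono
      le_rfl ?_
    rintro _ rfl
    exact ⟨den_add_dvd h₁ (hd r hr), by linarith [abs_add_le c r]⟩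
  · rintro c ⟨h₁, h₂⟩
    exact hsmall c h₁ (by simpa using h₂)

theorem Within.probBelow {F : FDist} {a : ℚ} (ha : Small s 9 a) (hlen : F.length ≤ s ^ 7)
    (hF : ∀ x ∈ F, Small s 9 x.agent) {e : ℕ} (hF' : Commensurable e F) (he : e ≤ s ^ 18) :
    Within s 55 (probBelow F a) (Small s 18) := by
  refine .bind (Within.filterT (b := 20) hlen fun x hx =>
    (Within.ratOp (hF x hx) ha _).mono le_rfl fun _ _ => trivial) (by norm_num) fun G hG => ?_
  have hlen' := hG.length_le.trans hlen
  have key : Within s 10 (UtilityConfiguration.mapT (fun x : MassPoint ℚ => do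
      UtilityConfiguration.tick 1
      return x.prob) G) fun r => r = G.map fun x => x.prob :=
    ⟨((Within.mapT (b := 1) (P := fun _ => True) hlen' fun x hx => .bind Within.tick le_rfl
      fun _ _ => .pure trivial).mono (by norm_num) fun _ h => h).1, by simp⟩
  refine .bind key (by norm_num) ?_
  rintro _ rfl
  obtain ⟨q, h₁, h₂, h₃, h₄⟩ := hF'.mono he
  refine (Within.sumT_of_dvd (a := 7) (by simpa using hlen') h₁ h₂ (fun r hr => ?_) ?_).mono
    (by norm_num) fun _ h => h
  · obtain ⟨x, hx, rfl⟩ := List.mem_map.1 hr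
    exact h₃ x (hG.subset hx)
  · rw [List.map_map]
    refine (List.Sublist.sum_le_sum (hG.map _) fun r hr => ?_).trans h₄
    obtain ⟨x, -, rfl⟩ := List.mem_map.1 hr
    exact abs_nonneg _

/-- The distribution of the utilities from the favorite one of `i` actions. -/
structure BoundedFavorite (s i : ℕ) (F : FDist) : Prop where
  length_le : F.length ≤ i * s ^ 6
  point : ∀ x ∈ F, Small s 9 x.agent ∧ Small s 9 x.principal
  commensurable : Commensurable (i * s ^ 17) F

theorem Within.combine {D F : FDist} (hlen : D.length ≤ s ^ 6) (hD : ∀ x ∈ D, SmallPoint s 9 x)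
    {i : ℕ} (hF : BoundedFavorite s i F) (hi : i + 1 ≤ s) :
    Within s 66 (combine D F) (BoundedFavorite s (i + 1)) := by
  have hD' : Commensurable (s ^ 16) D := (Commensurable.of_small fun x hx => (hD x hx).2.2).mono
    (by simpa using length_mul_le (s := s) (c := 1) (b := 9) (by norm_num) hlen)
  have hlenF : F.length ≤ s ^ 7 := by
    refine hF.length_le.trans ?_
    rw [pow_succ' s 6]
    exact Nat.mul_le_mul_right _ (by omega)
  have hei : i * s ^ 17 ≤ s ^ 18 := by
    rw [pow_succ' s 17]
    exact Nat.mul_le_mul_right _ (by omega)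
  have hlenD := hlen.trans (pow_base_mono (s := s) (by norm_num : 6 ≤ 7))
  have he : s ^ 16 ≤ s ^ 18 := pow_base_mono (by norm_num)
  have key : Within s 66 (UtilityConfiguration.combine D F) fun _ => True := by
    refine .bind (Within.mapT (b := 56) (P := fun _ => True) hlenD fun x hx => ?_) (by norm_num)
      fun D' hD'' => ?_
    · refine .bind (Within.probBelow (hD x hx).1 hlenF (fun y hy => (hF.point y hy).1)
        hF.commensurable hei) (by norm_num) fun b hb => ?_
      exact .bind (Within.ratOp ((hD x hx).2.2.mono (by norm_num)) hb _) (by norm_num)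
        fun _ _ => .pure trivial
    refine .bind (Within.mapT (b := 56) (P := fun _ => True) hlenF fun x hx => ?_) (by norm_num)
      fun F' hF'' => ?_
    · refine .bind (Within.probBelow (hF.point x hx).1 hlenD (fun y hy => (hD y hy).1)
        hD' he) (by norm_num) fun b hb => ?_
      exact .bind (Within.ratOp (hF.commensurable.small hei hx) hb _) (by norm_num)
        fun _ _ => .pure trivial
    exact (Within.appendT (hD''.1 ▸ hlenD)).mono (by norm_num) fun _ _ => trivial
  refine ⟨key.1, ?_⟩
  rw [val_combine]
  refine ⟨?_, fun x hx => ?_, (hD'.better hF.commensurable).mono ?_⟩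
  · have := hF.length_le
    rw [better, List.length_append, List.length_map, List.length_map, add_mul]
    omega
  · rcases List.mem_append.1 hx with hx | hx
    · obtain ⟨y, hy, rfl⟩ := List.mem_map.1 hx
      exact ⟨(hD y hy).1, (hD y hy).2.1⟩
    · obtain ⟨y, hy, rfl⟩ := List.mem_map.1 hx
      exact hF.point y hy
  · have h₁ : 2 * s ^ 16 ≤ s ^ 17 := mul_pow_base_le (by norm_num) 16
    have h₂ : 1 ≤ s ^ 16 := one_le_pow_base 16
    rw [add_mul]
    omega

/-- The steps spent on the individual actions add up, since the sizes of the intermediate distributions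
are bounded linearly in the number of actions. -/
theorem Within.favorite {J : List (List FDist)} {C : List ℕ}
    (hC : List.Forall₂ (fun (A : List FDist) (c : ℕ) => c < A.length) J C) (hJ : BoundedPre s J) :
    Within s 69 (favorite J C) (BoundedFavorite s J.length) := by
  have hsingle : ∀ D : FDist, D.length ≤ s ^ 6 → (∀ x ∈ D, SmallPoint s 9 x) →
      BoundedFavorite s 1 D := by
    intro D hlen hD
    refine ⟨by simpa using hlen, fun x hx => ⟨(hD x hx).1, (hD x hx).2.1⟩,
      (Commensurable.of_small fun x hx => (hD x hx).2.2).mono ?_⟩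
    rw [one_mul]
    refine le_trans ?_ (pow_base_mono (by norm_num : 16 ≤ 17))
    simpa using length_mul_le (s := s) (c := 1) (b := 9) (by norm_num) hlen
  have key : (UtilityConfiguration.favorite J C).time ≤ J.length * (1 * s ^ 67) + 1 ∧
      BoundedFavorite s J.length (UtilityConfiguration.favorite J C).val := by
    induction hC with
    | nil =>
      refine ⟨(by simp : 1 + 0 ≤ 0 * _ + 1), ?_⟩
      change BoundedFavorite s 0 []
      exact ⟨by simp, by simp, 1, one_pos, by simp, by simp, by simp⟩
    | @cons A c J C hc hC ih =>
      have hJ' : BoundedPre s J := ⟨(Nat.le_succ _).trans hJ.length_le,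
        fun A hA => hJ.length_action_le A (by simp [hA]),
        fun A hA => hJ.length_dist_le A (by simp [hA]), fun A hA => hJ.point A (by simp [hA])⟩
      have hcs : c + 1 ≤ s := hc.trans_le (hJ.length_action_le A (by simp))
      have hmem : A.getD c [] ∈ A := by
        rw [List.getD_eq_getElem _ _ hc]
        exact List.getElem_mem hc
      have hlen := hJ.length_dist_le A (by simp) _ hmem
      have hpt := hJ.point A (by simp) _ hmem
      have hs67 : s ≤ s ^ 67 := Nat.le_self_pow (by norm_num) s
      cases hC with
      | nil =>
        refine ⟨?_, hsingle _ hlen hpt⟩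
        change c + 1 ≤ _
        rw [List.length_cons, add_mul]
        omega
      | @cons A' c' J C hc' hC =>
        obtain ⟨h₁, h₂⟩ := ih hJ'
        have h : Within s 67 (do
            let D ← UtilityConfiguration.getT A c []
            UtilityConfiguration.combine D (UtilityConfiguration.favorite (A' :: J) (c' :: C)).val)
            (BoundedFavorite s ((A' :: J).length + 1)) := by
          refine .bind (Within.getT (a := 1) (by rw [pow_one]; omega)) (by norm_num) ?_
          rintro _ rfl
          exact (Within.combine hlen hpt h₂ hJ.length_le).mono (by norm_num) fun _ h => h
        refine ⟨?_, h.2⟩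
        refine (Nat.add_le_add h₁ h.1).trans (le_of_eq ?_)
        simp only [List.length_cons]
        ring
  exact ⟨key.1.trans (length_mul_le (a := 1) (by norm_num) (by simpa using hJ.length_le)), key.2⟩

theorem Within.evaluate {J : List (List FDist)} {C : List ℕ}
    (hC : List.Forall₂ (fun (A : List FDist) (c : ℕ) => c < A.length) J C) (hJ : BoundedPre s J) :
    Within s 72 (evaluate J C) (Small s 27) := by
  refine .bind (Within.favorite hC hJ) (by norm_num) fun F hF => ?_
  have hlen : F.length ≤ s ^ 7 := by
    refine hF.length_le.trans ?_
    rw [pow_succ' s 6]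
    exact Nat.mul_le_mul_right _ hJ.length_le
  have he : J.length * s ^ 17 ≤ s ^ 18 := by
    rw [pow_succ' s 17]
    exact Nat.mul_le_mul_right _ hJ.length_le
  refine .bind (Within.mapT (b := 38) (P := fun r => Small s 19 r) hlen fun x hx => ?_)
    (by norm_num) ?_
  · have h₁ := hF.commensurable.small he hx
    have h₂ := (hF.point x hx).2.mono (by norm_num : 9 ≤ 18)
    refine (Within.ratOp h₁ h₂ _).mono (by norm_num) ?_
    rintro _ rfl
    exact h₁.mul h₂
  rintro terms ⟨ht, hts⟩
  exact (Within.sumT (ht ▸ hlen) hts).mono (by norm_num) fun _ h => h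

end Evaluate

/-! ### The running time of the algorithm -/

section Algorithm

variable {s : ℕ} [hs : Fact (12 ≤ s)]

theorem Within.isMonotoneT {l : List ℚ} (hlen : l.length ≤ s) (hl : ∀ r ∈ l, Small s 9 r) :
    Within s 22 (isMonotoneT l) fun _ => True := by
  have key : (UtilityConfiguration.isMonotoneT l).time ≤ l.length * (1 * s ^ 20) + 1 := by
    clear hlen
    induction l with
    | nil => exact (by simp : 1 + 0 ≤ 0 * _ + 1)
    | cons a l ih =>
      have ih := ih fun r hr => hl r (List.mem_cons_of_mem _ hr)
      cases l with
      | nil => exact (by omega : 1 + 0 ≤ _ + 1)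
      | cons b l =>
        have h₁ := (Within.ratOp (hl a (by simp)) (hl b (by simp)) (decide (a ≤ b))).1
        change (leT a b).time ≤ s ^ 20 at h₁
        change (leT a b).time + (if decide (a ≤ b) = true then
          UtilityConfiguration.isMonotoneT (b :: l) else Pure.pure false).time ≤ _
        rw [List.length_cons, add_mul]
        split
        · omega
        · change _ + 0 ≤ _
          omega
  exact ⟨key.trans (length_mul_le (a := 1) (by norm_num) (by simpa using hlen)), trivial⟩

variable {M : ℕ}

theorem Within.guesses (hM₁ : 1 ≤ M) (hM : M ≤ s) {J : List (List FDist)} (hJ : BoundedPre s J) :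
    Within s (12 * M + 30) (guesses M J) fun G =>
      G.length ≤ s ^ (11 * M) ∧ ∀ û ∈ G, BoundedGuess s M û := by
  refine .bind (Within.flatMapT (a := 1) (b := 10) (P := fun r => Small s 9 r)
    (by simpa using hJ.length_le) fun A hA => ?_) (by omega) ?_
  · refine (Within.flatMapT (a := 1) (b := 8) (P := fun r => Small s 9 r)
      (by simpa using hJ.length_action_le A hA) fun D hD => ?_).mono (by norm_num) fun r hr =>
        ⟨hr.1.trans (pow_base_mono (by norm_num)), hr.2⟩
    have hlen := hJ.length_dist_le A hA D hD
    exact (Within.mapT (b := 1) hlen fun x hx => .bind Within.tick le_rfl fun _ _ =>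
      .pure (hJ.point A hA D hD x hx).1).mono (by norm_num) fun r hr =>
        ⟨hr.1 ▸ hlen.trans (pow_base_mono (by norm_num)), hr.2⟩
  rintro S ⟨hS, hS'⟩
  refine .bind (Within.tuplesT hS M) (by omega) ?_
  rintro T ⟨hT, hT'⟩
  have hguess : ∀ û ∈ T, BoundedGuess s M û := fun û hû =>
    ⟨(hT' û hû).1, fun u hu => hS' u ((hT' û hû).2 u hu)⟩
  exact (Within.filterT hT fun û hû => Within.isMonotoneT ((hT' û hû).1 ▸ hM)
    (hguess û hû).2).mono (by omega) fun G hG =>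
      ⟨hG.length_le.trans hT, fun û hû => hguess û (hG.subset hû)⟩

theorem Within.algorithm (hM₁ : 1 ≤ M) (hM : M ≤ s) {I : Instance} (hI : Bounded s I)
    (hV : I.Valid) : Within s (21 * M + 100) (algorithm M I) fun _ => True := by
  obtain ⟨β, hJ⟩ := exists_isRefinement hM₁ hV
  refine .bind (Within.preprocess hM₁ hM hI hV).and_val (by omega) ?_
  rintro J ⟨hB, rfl⟩
  refine .bind (Within.guesses hM₁ hM hB) (by omega) ?_
  rintro G ⟨hG, hG'⟩
  refine .bind (Within.foldT_index (b := 10 * M + 84)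
    (fun _ best => ∀ x : ℚ × List ℕ, best = some x → Small s 27 x.1) hG (by simp) ?_) (by omega)
    fun best _ => ?_
  · intro û hû _ best _ hbest
    refine .bind (Within.solve hM₁ hM hB hJ.nonneg (hG' û hû)).and_val (by omega) ?_
    rintro r ⟨-, hr⟩
    cases r with
    | none => exact .pure hbest
    | some C =>
      have hC := ((solve_spec hJ.nonneg (hG' û hû).1).1 C hr.symm).1
      refine .bind (Within.evaluate hC hB) (by omega) fun v hv => ?_
      refine (Within.betterT (k := 27) (Q := fun x => Small s 27 x.1) (fun _ h => h) hbest
        ?_).mono (by omega) fun _ h => h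
      rintro _ ⟨⟩
      exact hv
  · cases best with
    | some x => exact .pure trivial
    | none =>
      exact (Within.mapT (a := 1) (b := 1) (P := fun _ => True) (by simpa using hI.length_le)
        fun _ _ => .bind Within.tick le_rfl fun _ _ => .pure trivial).mono (by omega)
          fun _ _ => trivial

end Algorithm

theorem length_le_sum_succ {α : Type} (l : List α) (f : α → ℕ) :
    l.length ≤ (l.map fun a => 1 + f a).sum := by
  induction l with
  | nil => simp
  | cons a l ih =>
    rw [List.length_cons, List.map_cons, List.sum_cons]
    omega

theorem le_sum_map {α : Type} {l : List α} (f : α → ℕ) {a : α} (ha : a ∈ l) :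
    f a ≤ (l.map f).sum :=
  List.single_le_sum (fun _ _ => Nat.zero_le _) _ (List.mem_map_of_mem ha)

/-- The input size bounds all lengths of lists and all bit lengths. -/
theorem bounded_of_size_le {s : ℕ} [Fact (12 ≤ s)] {I : Instance} (hI : I.size ≤ s) : Bounded s I := by
  have hA : ∀ A ∈ I, 1 + (A.map fun D => 1 + (D.map fun x =>
      1 + agentBits x.agent + bits x.principal + bits x.prob).sum).sum ≤ s := fun A hA =>
    (le_sum_map (fun A : List Dist => 1 + (A.map fun D => 1 + (D.map fun x =>
      1 + agentBits x.agent + bits x.principal + bits x.prob).sum).sum) hA).trans hI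
  have hD : ∀ A ∈ I, ∀ D ∈ A, 1 + (D.map fun x =>
      1 + agentBits x.agent + bits x.principal + bits x.prob).sum ≤ s := fun A hA' D hD => by
    have h₁ := le_sum_map (fun D : Dist => 1 + (D.map fun x =>
      1 + agentBits x.agent + bits x.principal + bits x.prob).sum) hD
    have h₂ := hA A hA'
    omega
  have hx : ∀ A ∈ I, ∀ D ∈ A, ∀ x ∈ D,
      1 + agentBits x.agent + bits x.principal + bits x.prob ≤ s := fun A hA' D hD' x hx => by
    have h₁ := le_sum_map (fun x : MassPoint (WithBot ℚ) =>
      1 + agentBits x.agent + bits x.principal + bits x.prob) hx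
    have h₂ := hD A hA' D hD'
    omega
  refine ⟨(length_le_sum_succ I _).trans hI, fun A hA' => ?_, fun A hA' D hD' => ?_,
    fun A hA' D hD' x hx' a ha => .of_bits ?_, fun A hA' D hD' x hx' => .of_bits ?_,
    fun A hA' D hD' x hx' => .of_bits ?_⟩
  · exact (length_le_sum_succ A _).trans ((Nat.le_add_left _ _).trans (hA A hA'))
  · have h₁ := length_le_sum_succ D fun x => agentBits x.agent + bits x.principal + bits x.prob
    have h₂ := hD A hA' D hD'
    simp only [← add_assoc] at h₁
    omega
  · have := hx A hA' D hD' x hx'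
    rw [ha] at this
    change 1 + bits a + _ + _ ≤ s at this
    omega
  · have := hx A hA' D hD' x hx'
    omega
  · have := hx A hA' D hD' x hx'
    omega

theorem runsInPolynomialTime_algorithm {M : ℕ} (hM : 1 ≤ M) :
    RunsInPolynomialTime (algorithm M) := by
  refine ⟨(Polynomial.X + Polynomial.C (M + 12)) ^ (21 * M + 100), fun I hI => ?_⟩
  have : Fact (12 ≤ I.size + (M + 12)) := ⟨by omega⟩
  have h := (Within.algorithm (s := I.size + (M + 12)) hM (by omega)
    (bounded_of_size_le (by omega)) hI).1
  simpa using h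

/-! ### The approximation scheme -/

/-- A smaller factor is a weaker guarantee, because utilities are nonnegative. -/
theorem IsApproximation.mono {M : ℕ} (hM : 1 ≤ M) {α α' : ℝ} {𝒦 : Instance → Prop}
    (h : IsApproximation α (algorithm M) 𝒦) (hα : α' ≤ α) :
    IsApproximation α' (algorithm M) 𝒦 := by
  intro I hI hal
  obtain ⟨h₁, h₂⟩ := h I hI hal
  obtain ⟨β, hJ⟩ := exists_isRefinement hM hI
  refine ⟨h₁, fun C hC => le_trans ?_ (h₂ C hC)⟩
  have := hJ.expectedUtility_nonneg hI hC
  exact mul_le_mul_of_nonneg_right hα (by exact_mod_cast this)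

/-- The loss `log M / M` becomes arbitrarily small. -/
theorem exists_fineness (ε : ℝ) (hε : 0 < ε) :
    ∃ M : ℕ, 2 ≤ M ∧ 40 * (Real.log M / M) ≤ ε := by
  have h₁ : Filter.Tendsto (fun x : ℝ => Real.log x / x) Filter.atTop (nhds 0) :=
    Real.isLittleO_log_id_atTop.tendsto_div_nhds_zero
  have h₂ := (h₁.comp tendsto_natCast_atTop_atTop).eventually (gt_mem_nhds (by positivity : 0 < ε / 40))
  obtain ⟨M, hM, hM₂⟩ := (h₂.and (Filter.eventually_ge_atTop 2)).exists
  refine ⟨M, hM₂, ?_⟩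
  simp only [Function.comp_apply] at hM
  linarith

end UtilityConfiguration

theorem mainTheorem2 :
    (∃ c : ℝ, 0 < c ∧ ∀ M : ℕ, 2 ≤ M →
      UtilityConfiguration.IsApproximation (1 - c * (Real.log M / M))
        (UtilityConfiguration.algorithm M)
        (UtilityConfiguration.IsUtilityAligned fun _ => 2)) ∧
    (∀ M : ℕ, 1 ≤ M →
      UtilityConfiguration.RunsInPolynomialTime (UtilityConfiguration.algorithm M)) ∧
    (∃ M : ℝ → ℕ, UtilityConfiguration.IsPTAS
      (fun ε => UtilityConfiguration.algorithm (M ε))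
      (UtilityConfiguration.IsUtilityAligned fun _ => 2)) := by
  refine ⟨⟨40, by norm_num, fun M hM => UtilityConfiguration.isApproximation_algorithm hM⟩,
    fun M hM => UtilityConfiguration.runsInPolynomialTime_algorithm hM, ?_⟩
  choose! M hM₂ hM using UtilityConfiguration.exists_fineness
  refine ⟨M, fun ε hε => ⟨?_, ?_⟩⟩
  · have hM₁ : 1 ≤ M ε := one_le_two.trans (hM₂ ε hε)
    exact (UtilityConfiguration.isApproximation_algorithm (hM₂ ε hε)).mono hM₁
      (by linarith [hM ε hε])
  · exact UtilityConfiguration.runsInPolynomialTime_algorithm (one_le_two.trans (hM₂ ε hε))
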